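/- **Theorem 2 (sequential case).** *Setting.* For every $n$ let $\mu_1,\dots,\mu_n$ be (possibly random) states, observed as $Y_i=\mu_i+\varepsilon_i$, where $\varepsilon_1,\dots,\varepsilon_n$ are i.i.d. $N(0,1)$ and independent of $(\mu_1,\dots,\mu_n)$; all objects may depend on $n$. Let $\mathcal F_i=\sigma(Y_1,\dots,Y_{i-1})$, let $\tilde\mu_i$ be $\mathcal F_i$-measurable and let $\hat\mu_i$ be $\sigma(Y_1,\dots,Y_i)$-measurable. Put $Z_i=Y_i-\tilde\mu_i$ and $\nu_i=\mu_i-\tilde\mu_i$, and let $F^n_\nu=n^{-1}\sum_{i=1}^n\delta_{\nu_i}$ be the (random) empirical distribution of $\nu_1,\dots,\nu_n$. *Sequential estimators.* Let $K(x)=2(e^x+e^{-x})^{-2}$ and $\sigma_n=1/\log n$. For $i\ge 2$ let $\hat f_i(z)=\frac1{i-1}\sum_{j<i}\sigma_n^{-1}K\bigl((Z_j-z)/\sigma_n\bigr)$ and $\hat\delta^i(z)=z+\hat f_i'(z)/\hat f_i(z)$, and let $\hat\delta^1(z)=z$. Put $\hat\mu^{IS}_i=\tilde\mu_i+\hat\delta^i(Z_i)$.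 The oracle is $\mu^{IS}_i=\tilde\mu_i+\delta^i(Z_i)$, where, with $\eta\sim N(0,1)$ and with $\nu_1,\dots,\nu_i$ held fixed, $\delta^i$ minimizes $\sum_{j\le i}E_\eta\bigl(\delta(\nu_j+\eta)-\nu_j\bigr)^2$ over $\delta:\mathbb R\to\mathbb R$; that is, $\delta^i(z)=z+f_i'(z)/f_i(z)$ with $f_i(z)=\frac1i\sum_{j\le i}\varphi(z-\nu_j)$ and $\varphi$ the standard normal density. *Assumptions.* 1. There are constants $\rho_M$, $M\ge1$, not depending on $n$, with $\limsup_{M\to\infty}M^2\rho_M<1$, such that for all $j<i\le n$, replacing $Y_j$ by $Y_j+d$ changes $\tilde\mu_i$ by at most $\rho_{i-j}|d|$. 2. There are $\mathcal F_n$-measurable $\alpha_n<1$ such that $\hat\mu_i=\alpha_n\tilde\mu_i+(1-\alpha_n)Y_i+\zeta_i$, where $E\zeta_i^2\to0$ as $n\to\infty$ with $i/n$ bounded away from $0$ and $1$. 3. $\frac1n\sum_{i=1}^nP(|Y_i-\tilde\mu_i|>\log n)\le(\log n)^{-8}$ for all large $n$. *Conclusion.* (i) Under Assumptions 1 and 3,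 $$E\|\hat{\boldsymbol\mu}^{IS}-\boldsymbol\mu\|^2\le E\|\boldsymbol\mu^{IS}-\boldsymbol\mu\|^2+o(n),$$ and, if the benchmark $\hat{\boldsymbol\mu}$ satisfies Assumption 2, also $$E\|\boldsymbol\mu^{IS}-\boldsymbol\mu\|^2+o(n)\le E\|\hat{\boldsymbol\mu}-\boldsymbol\mu\|^2+o(n).$$ (ii) Under Assumptions 1–3, if $\alpha_n\to\alpha\in(0,1)$ in probability, and $F^n_\nu$ converges weakly, in probability, to a (deterministic) probability distribution different from $N(0,(1-\alpha)/\alpha)$, then there is $c<1$ such that for all large enough $n$ $$E\|\hat{\boldsymbol\mu}^{IS}-\boldsymbol\mu\|^2\le c\,E\|\hat{\boldsymbol\mu}-\boldsymbol\mu\|^2.$$ -/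

import Mathlib

open MeasureTheory ProbabilityTheory Filter Topology
open scoped ENNReal NNReal BoundedContinuousFunction

namespace SeqEB

noncomputable section

/-! Time points `1, …, n` are the elements of `Fin n`. All objects form triangular arrays: they may
depend on the horizon `n`. Estimators are functions of the data vector `y = (Y_1, …, Y_n)`. -/

/-- The observation model at one horizon: `ε_1, …, ε_n` are i.i.d. standard normal and independent
of the (arbitrary, possibly random) vector of states `μ_1, …, μ_n`. -/
structure NoiseModel {Ω : Type*} [MeasurableSpace Ω] (P : Measure Ω) {n : ℕ}
    (μ ε : Fin n → Ω → ℝ) : Prop where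
  measurable_state : ∀ i, Measurable (μ i)
  measurable_noise : ∀ i, Measurable (ε i)
  law_noise : ∀ i, P.map (ε i) = gaussianReal 0 1
  iIndep_noise : iIndepFun ε P
  indep_state : IndepFun (fun ω i => ε i ω) (fun ω i => μ i ω) P

/-- The data vector `Y_i = μ_i + ε_i`. -/
def obs {Ω : Type*} {n : ℕ} (μ ε : Fin n → Ω → ℝ) (ω : Ω) : Fin n → ℝ :=
  fun i => μ i ω + ε i ω

/-- The residuals `Z_i = Y_i - μ̃_i`, as functions of the data. -/
def resid {n : ℕ} (m : Fin n → (Fin n → ℝ) → ℝ) (y : Fin n → ℝ) : Fin n → ℝ :=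
  fun i => y i - m i y

/-- The centred states `ν_i = μ_i - μ̃_i`. -/
def centred {Ω : Type*} {n : ℕ} (μ ε : Fin n → Ω → ℝ) (m : Fin n → (Fin n → ℝ) → ℝ) (ω : Ω) :
    Fin n → ℝ :=
  fun i => μ i ω - m i (obs μ ε ω)

/-! ### The assumptions -/

/-- `μ̃_i` is a measurable function of `Y_1, …, Y_{i-1}`, and is Lipschitz in `Y_j` with constant
`ρ_{i-j}` for `j < i`, where `ρ` does not depend on `n` and `limsup_M M² ρ_M < 1`. -/
structure LipschitzPredictor (m : ∀ n, Fin n → (Fin n → ℝ) → ℝ) (ρ : ℕ → ℝ) : Prop where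
  measurable : ∀ n i, Measurable (m n i)
  dependsOn : ∀ n i, DependsOn (m n i) (Set.Iio i)
  lipschitz : ∀ n (i j : Fin n), j < i → ∀ (y : Fin n → ℝ) (d : ℝ),
    |m n i (Function.update y j (y j + d)) - m n i y| ≤ ρ ((i : ℕ) - (j : ℕ)) * |d|
  limsup_lt : limsup (fun M : ℕ => (((M : ℝ) ^ 2 * ρ M : ℝ) : EReal)) atTop < 1

/-- `μ̂_i` is a measurable function of `Y_1, …, Y_i`. -/
structure SequentialFilter (h : ∀ n, Fin n → (Fin n → ℝ) → ℝ) : Prop where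
  measurable : ∀ n i, Measurable (h n i)
  dependsOn : ∀ n i, DependsOn (h n i) (Set.Iic i)

/-- `μ̂_i = α_n μ̃_i + (1 - α_n) Y_i + ζ_i`, where `α_n < 1` is a measurable function of
`Y_1, …, Y_{n-1}` and `E ζ_i² → 0` as `n → ∞`, as long as `i / n` stays away from `0` and `1`. -/
structure AsympWeightedAverage {Ω : Type*} [MeasurableSpace Ω] (P : Measure Ω)
    (μ ε : ∀ n, Fin n → Ω → ℝ) (m h : ∀ n, Fin n → (Fin n → ℝ) → ℝ)
    (α : ∀ n, (Fin n → ℝ) → ℝ) : Prop where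
  measurable : ∀ n, Measurable (α n)
  dependsOn : ∀ n, DependsOn (α n) {j : Fin n | (j : ℕ) + 1 < n}
  lt_one : ∀ n y, α n y < 1
  remainder : ∀ κ : ℝ, 0 < κ → ∀ r : ℝ≥0∞, 0 < r → ∀ᶠ n : ℕ in atTop, ∀ i : Fin n,
    κ * n ≤ (i : ℕ) + 1 → ((i : ℕ) + 1 : ℝ) ≤ (1 - κ) * n →
      ∫⁻ ω, ENNReal.ofReal ((h n i (obs (μ n) (ε n) ω)
        - (α n (obs (μ n) (ε n) ω) * m n i (obs (μ n) (ε n) ω)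
          + (1 - α n (obs (μ n) (ε n) ω)) * obs (μ n) (ε n) ω i)) ^ 2) ∂P ≤ r

/-- `n⁻¹ ∑ᵢ P(|Y_i - μ̃_i| > log n) ≤ (log n)⁻⁸` for all large `n`. -/
def TightResiduals {Ω : Type*} [MeasurableSpace Ω] (P : Measure Ω)
    (μ ε : ∀ n, Fin n → Ω → ℝ) (m : ∀ n, Fin n → (Fin n → ℝ) → ℝ) : Prop :=
  ∀ᶠ n : ℕ in atTop,
    (1 / (n : ℝ)) * ∑ i : Fin n,
        P.real {ω | Real.log n < |resid (m n) (obs (μ n) (ε n) ω) i|}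
      ≤ 1 / Real.log n ^ 8

/-! ### The sequential empirical Bayes estimator -/

/-- The logistic kernel, the derivative of the distribution function `(1 + e^{-2x})⁻¹`. -/
def kern (x : ℝ) : ℝ := 2 / (Real.exp x + Real.exp (-x)) ^ 2

/-- The kernel density estimate with bandwidth `σ` from the points `x_j`, `j ∈ s`. -/
def kernelDensity {ι : Type*} (σ : ℝ) (s : Finset ι) (x : ι → ℝ) (z : ℝ) : ℝ :=
  (s.card : ℝ)⁻¹ * ∑ j ∈ s, σ⁻¹ * kern ((x j - z) / σ)

/-- The decision function estimated from the points `x_j`, `j ∈ s`. It is the identity when there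
are no points. -/
def estDecision {ι : Type*} (σ : ℝ) (s : Finset ι) (x : ι → ℝ) (z : ℝ) : ℝ :=
  z + deriv (kernelDensity σ s x) z / kernelDensity σ s x z

/-- `μ̂^{IS}_i = μ̃_i + δ̂^i(Z_i)`, with `δ̂^i` estimated from `Z_1, …, Z_{i-1}` with bandwidth
`1 / log n`. -/
def estimIS {n : ℕ} (m : Fin n → (Fin n → ℝ) → ℝ) (i : Fin n) (y : Fin n → ℝ) : ℝ :=
  m i y + estDecision (1 / Real.log n) (Finset.Iio i) (resid m y) (resid m y i)

/-! ### The sequential oracle -/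

/-- The density `|s|⁻¹ ∑_{j ∈ s} φ(z - ν_j)`, with `φ` the standard normal density. -/
def mixDensity {ι : Type*} (s : Finset ι) (ν : ι → ℝ) (z : ℝ) : ℝ :=
  (s.card : ℝ)⁻¹ * ∑ j ∈ s, gaussianPDFReal 0 1 (z - ν j)

/-- The Bayes decision function for the prior that is uniform on the `ν_j`, `j ∈ s`, for one
observation with standard normal noise. -/
def oracleDecision {ι : Type*} (s : Finset ι) (ν : ι → ℝ) (z : ℝ) : ℝ :=
  z + deriv (mixDensity s ν) z / mixDensity s ν z

/-- The risk `R(δ, ν) = E (δ(ν + η) - ν)²`, `η ∼ N(0,1)`. -/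
def normalRisk (δ : ℝ → ℝ) (v : ℝ) : ℝ≥0∞ :=
  ∫⁻ e, ENNReal.ofReal ((δ (v + e) - v) ^ 2) ∂(gaussianReal 0 1)

lemma mixDensity_hasDerivAt {ι : Type*} (s : Finset ι) (ν : ι → ℝ) (z : ℝ) :
    HasDerivAt (mixDensity s ν)
      ((s.card : ℝ)⁻¹ * ∑ j ∈ s, gaussianPDFReal 0 1 (z - ν j) * (ν j - z)) z := by
  unfold mixDensity
  refine HasDerivAt.const_mul _ (HasDerivAt.fun_sum fun j _ => ?_)
  simp only [gaussianPDFReal]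
  have h1 : HasDerivAt (fun x : ℝ => -(x - ν j - 0) ^ 2 / (2 * ((1 : ℝ≥0) : ℝ))) (ν j - z) z := by
    have h2 : HasDerivAt (fun x : ℝ => x - ν j - 0) 1 z :=
      ((hasDerivAt_id z).sub_const _).sub_const _
    have := ((h2.pow 2).neg).div_const (2 * ((1 : ℝ≥0) : ℝ))
    refine this.congr_deriv ?_
    simp
    ring
  have := (h1.exp).const_mul (√(2 * Real.pi * ((1 : ℝ≥0) : ℝ)))⁻¹
  exact this.congr_deriv (by ring)

lemma sum_weight_oracle {ι : Type*} (s : Finset ι) (ν : ι → ℝ) (z : ℝ) :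
    ∑ j ∈ s, gaussianPDFReal 0 1 (z - ν j) * (oracleDecision s ν z - ν j) = 0 := by
  rcases s.eq_empty_or_nonempty with rfl | hs
  · simp
  have hc : (s.card : ℝ)⁻¹ ≠ 0 := by
    simpa using hs.ne_empty
  have hw : ∑ j ∈ s, gaussianPDFReal 0 1 (z - ν j) ≠ 0 :=
    (Finset.sum_pos (fun j _ => gaussianPDFReal_pos 0 1 _ one_ne_zero) hs).ne'
  have h : oracleDecision s ν z - z
      = (∑ j ∈ s, gaussianPDFReal 0 1 (z - ν j) * (ν j - z))
        / ∑ j ∈ s, gaussianPDFReal 0 1 (z - ν j) := by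
    rw [oracleDecision, (mixDensity_hasDerivAt s ν z).deriv, mixDensity,
      mul_div_mul_left _ _ hc]
    ring
  have h2 : ∑ j ∈ s, gaussianPDFReal 0 1 (z - ν j) * (oracleDecision s ν z - ν j)
      = (oracleDecision s ν z - z) * ∑ j ∈ s, gaussianPDFReal 0 1 (z - ν j)
        - ∑ j ∈ s, gaussianPDFReal 0 1 (z - ν j) * (ν j - z) := by
    rw [Finset.mul_sum, ← Finset.sum_sub_distrib]
    exact Finset.sum_congr rfl fun j _ => by ring
  rw [h2, h, div_mul_cancel₀ _ hw, sub_self]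

lemma normalRisk_eq {δ : ℝ → ℝ} (hδ : Measurable δ) (v : ℝ) :
    normalRisk δ v
      = ∫⁻ z, ENNReal.ofReal (gaussianPDFReal 0 1 (z - v) * (δ z - v) ^ 2) := by
  have hm : Measurable fun z : ℝ => ENNReal.ofReal ((δ z - v) ^ 2) := by fun_prop
  have h1 : normalRisk δ v = ∫⁻ z, ENNReal.ofReal ((δ z - v) ^ 2) ∂(gaussianReal v 1) := by
    have : gaussianReal v 1 = (gaussianReal 0 1).map (fun e => v + e) := by
      rw [gaussianReal_map_const_add, zero_add]
    rw [this, lintegral_map hm (measurable_const_add v), normalRisk]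
  rw [h1, gaussianReal_of_var_ne_zero v one_ne_zero,
    lintegral_withDensity_eq_lintegral_mul _ (measurable_gaussianPDF v 1) hm]
  refine lintegral_congr fun z => ?_
  rw [Pi.mul_apply, gaussianPDF, ENNReal.ofReal_mul (gaussianPDFReal_nonneg _ _ _),
    gaussianPDFReal_sub, zero_add]

/-- The oracle decision function minimizes `∑_{j ∈ s} R(δ, ν_j)` over all decision functions. -/
theorem oracleDecision_isMin {ι : Type*} (s : Finset ι) (ν : ι → ℝ) (δ : ℝ → ℝ)
    (hδ : Measurable δ) :
    ∑ j ∈ s, normalRisk (oracleDecision s ν) (ν j) ≤ ∑ j ∈ s, normalRisk δ (ν j) := by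
  have hmix : Measurable (mixDensity s ν) := by
    unfold mixDensity
    exact measurable_const.mul (Finset.measurable_fun_sum s fun j _ =>
      (measurable_gaussianPDFReal 0 1).comp (measurable_id.sub_const _))
  have ho : Measurable (oracleDecision s ν) :=
    measurable_id.add ((measurable_deriv _).div hmix)
  have key : ∀ g : ℝ → ℝ, Measurable g → ∑ j ∈ s, normalRisk g (ν j)
      = ∫⁻ z, ENNReal.ofReal (∑ j ∈ s, gaussianPDFReal 0 1 (z - ν j) * (g z - ν j) ^ 2) := by
    intro g hg
    rw [Finset.sum_congr rfl fun j _ => normalRisk_eq hg (ν j), ← lintegral_finsetSum]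
    · refine lintegral_congr fun z => ?_
      rw [ENNReal.ofReal_sum_of_nonneg]
      exact fun j _ => mul_nonneg (gaussianPDFReal_nonneg _ _ _) (sq_nonneg _)
    · intro j _
      exact (((measurable_gaussianPDFReal 0 1).comp (measurable_id.sub_const _)).mul
        ((hg.sub_const _).pow_const 2)).ennreal_ofReal
  rw [key _ ho, key _ hδ]
  refine lintegral_mono fun z => ENNReal.ofReal_le_ofReal ?_
  have h0 := sum_weight_oracle s ν z
  have hexp : ∑ j ∈ s, gaussianPDFReal 0 1 (z - ν j) * (δ z - ν j) ^ 2
      = ∑ j ∈ s, gaussianPDFReal 0 1 (z - ν j) * (oracleDecision s ν z - ν j) ^ 2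
        + 2 * (δ z - oracleDecision s ν z)
          * ∑ j ∈ s, gaussianPDFReal 0 1 (z - ν j) * (oracleDecision s ν z - ν j)
        + (δ z - oracleDecision s ν z) ^ 2 * ∑ j ∈ s, gaussianPDFReal 0 1 (z - ν j) := by
    rw [Finset.mul_sum, Finset.mul_sum, ← Finset.sum_add_distrib, ← Finset.sum_add_distrib]
    exact Finset.sum_congr rfl fun j _ => by ring
  rw [hexp, h0, mul_zero, add_zero]
  exact le_add_of_nonneg_right (mul_nonneg (sq_nonneg _)
    (Finset.sum_nonneg fun j _ => gaussianPDFReal_nonneg _ _ _))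

/-- `μ^{IS}_i = μ̃_i + δ^i(Z_i)`, with `δ^i` the minimizer of `∑_{j ≤ i} R(δ, ν_j)`. -/
def oracleIS {Ω : Type*} {n : ℕ} (μ ε : Fin n → Ω → ℝ) (m : Fin n → (Fin n → ℝ) → ℝ)
    (i : Fin n) (ω : Ω) : ℝ :=
  m i (obs μ ε ω)
    + oracleDecision (Finset.Iic i) (centred μ ε m ω) (resid m (obs μ ε ω) i)

/-! ### Risks, little-o and the empirical distribution of the `ν_i` -/

/-- `E ‖estimate - μ‖²`, possibly infinite. -/
def risk {Ω : Type*} [MeasurableSpace Ω] (P : Measure Ω) {n : ℕ} (μ est : Fin n → Ω → ℝ) :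
    ℝ≥0∞ :=
  ∫⁻ ω, ENNReal.ofReal (∑ i, (est i ω - μ i ω) ^ 2) ∂P

/-- `A_n ≤ B_n + o(n)`. -/
def LeUpToLittleO (A B : ℕ → ℝ≥0∞) : Prop :=
  ∃ r : ℕ → ℝ, r =o[atTop] (fun n : ℕ => (n : ℝ)) ∧
    ∀ᶠ n in atTop, A n ≤ B n + ENNReal.ofReal (r n)

/-- The empirical distribution `n⁻¹ ∑ᵢ δ_{v_i}`. -/
def empirical {n : ℕ} (v : Fin n → ℝ) : Measure ℝ :=
  (n : ℝ≥0∞)⁻¹ • ∑ i, Measure.dirac (v i)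

/-- The random empirical distributions of the rows of `v` converge weakly to `G`, in probability. -/
def EmpiricalTendsto {Ω : Type*} [MeasurableSpace Ω] (P : Measure Ω)
    (v : ∀ n, Ω → Fin n → ℝ) (G : Measure ℝ) : Prop :=
  ∀ f : ℝ →ᵇ ℝ, TendstoInMeasure P (fun (n : ℕ) ω => ∫ x, f x ∂(empirical (v n ω))) atTop
    (fun _ => ∫ x, f x ∂G)

end

end SeqEB

/-
At time `i` the oracle applies the Bayes rule of the empirical prior of `ν_1, …, ν_i`, and the
estimator the same formula with the mixture density and its derivative replaced by kernel averages
over `Z_1, …, Z_{i-1}`. Given the past, each `Z_j` is `ν_j` plus a fresh standard normal, so a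
kernel average differs from the average of its conditional means by a martingale, and those means
are the mixture density and its derivative smoothed at bandwidth `1 / log n`. Where the mixture
density is not tiny the two rules are therefore close with high probability; it is tiny at only a
few of the residuals that are not large, because the mixture puts little mass there, and on the
remaining events the estimator moves its observation by at most `2 log n`.

The benchmark is close to the linear rule with slope `1 - α_n`, whose risk on the `ν_i` is at least
that of the rule chosen with full knowledge of `ν_1, …, ν_n`. The sequential oracle does no worse
than this batch rule: its risk at time `i` is at most the increment of the minimal total risk of
the first `i` decisions, and these increments telescope. The slope is random and depends on all the
data, but the losses of linear rules are quadratic in the slope, with coefficients that are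
martingale sums, hence uniformly close to their conditional means.

If the linear rule with slope `1 - a` were the Bayes rule of the limiting prior `G`, the density of
`G ∗ N(0,1)` would satisfy `f' = -a z f`, hence be that of `N(0, 1 / a)`, and `G` would be
`N(0, (1 - a) / a)`. Otherwise some bounded perturbation of the linear rule lowers its risk by a
fixed amount per time, on an event whose probability is bounded below.
-/

namespace SeqEB

open scoped BigOperators

local notation "φ" => gaussianPDFReal 0 1
local notation "γ" => gaussianReal 0 1

/-! ### The standard normal density -/

/-- The derivative `φ'(u) = -u φ(u)` of the standard normal density. -/
noncomputable def stdPDFDeriv (u : ℝ) : ℝ := -u * φ u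

/-- The scale `τ⁻¹ φ(u) + τ¹⁵` that dominates the derivatives of `φ` near `u`: a large multiple of
the density itself, up to an error that is negligible where `φ(u)` is not small. -/
noncomputable def slackPDF (τ u : ℝ) : ℝ := τ⁻¹ * φ u + τ ^ 15

lemma stdPDF_eq (u : ℝ) : φ u = (√(2 * Real.pi))⁻¹ * Real.exp (-u ^ 2 / 2) := by
  simp [gaussianPDFReal]

lemma stdPDF_eq_fun : φ = fun u => (√(2 * Real.pi))⁻¹ * Real.exp (-u ^ 2 / 2) :=
  funext stdPDF_eq

lemma stdPDF_const_le_one : (√(2 * Real.pi))⁻¹ ≤ 1 := by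
  refine inv_le_one_of_one_le₀ (Real.one_le_sqrt.2 ?_)
  linarith [Real.pi_gt_three]

lemma stdPDF_pos (u : ℝ) : 0 < φ u := gaussianPDFReal_pos 0 1 u one_ne_zero

lemma stdPDF_le_one (u : ℝ) : φ u ≤ 1 := by
  rw [stdPDF_eq]
  have hexp : Real.exp (-u ^ 2 / 2) ≤ 1 := Real.exp_le_one_iff.2 (by linarith [sq_nonneg u])
  exact mul_le_one₀ stdPDF_const_le_one (Real.exp_pos _).le hexp

lemma abs_stdPDF_le_one (u : ℝ) : |φ u| ≤ 1 := by
  rw [abs_of_pos (stdPDF_pos u)]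
  exact stdPDF_le_one u

lemma continuous_stdPDF : Continuous φ := by
  rw [stdPDF_eq_fun]
  fun_prop

lemma continuous_stdPDFDeriv : Continuous stdPDFDeriv :=
  continuous_neg.mul continuous_stdPDF

lemma hasDerivAt_stdPDF (u : ℝ) : HasDerivAt φ (stdPDFDeriv u) u := by
  have hsq : HasDerivAt (fun u : ℝ => -u ^ 2 / 2) (-u) u :=
    ((hasDerivAt_pow 2 u).fun_neg.div_const 2).congr_deriv (by ring)
  rw [stdPDFDeriv, stdPDF_eq_fun]
  exact (hsq.exp.const_mul _).congr_deriv (by ring)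

lemma hasDerivAt_stdPDFDeriv (u : ℝ) : HasDerivAt stdPDFDeriv ((u ^ 2 - 1) * φ u) u :=
  ((hasDerivAt_neg u).mul (hasDerivAt_stdPDF u)).congr_deriv (by rw [stdPDFDeriv]; ring)

lemma abs_le_sq_add_one (v : ℝ) : |v| ≤ v ^ 2 + 1 := by
  rw [← sq_abs]
  nlinarith [sq_nonneg (|v| - 1)]

lemma abs_stdPDFDeriv_le (u : ℝ) : |stdPDFDeriv u| ≤ (u ^ 2 + 1) * φ u := by
  rw [stdPDFDeriv, abs_mul, abs_neg, abs_of_pos (stdPDF_pos u)]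
  exact mul_le_mul_of_nonneg_right (abs_le_sq_add_one u) (stdPDF_pos u).le

lemma abs_stdPDFDeriv_le_one (u : ℝ) : |stdPDFDeriv u| ≤ 1 := by
  have hexp : |u| ≤ Real.exp (u ^ 2 / 2) := by
    nlinarith [Real.add_one_le_exp (u ^ 2 / 2), sq_abs u, sq_nonneg (|u| - 1)]
  have hmul : |u| * Real.exp (-u ^ 2 / 2) ≤ 1 := by
    rw [neg_div, Real.exp_neg, ← div_eq_mul_inv]
    exact div_le_one_of_le₀ hexp (Real.exp_pos _).le
  calc |stdPDFDeriv u| = (√(2 * Real.pi))⁻¹ * (|u| * Real.exp (-u ^ 2 / 2)) := by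
        rw [stdPDFDeriv, abs_mul, abs_neg, abs_of_pos (stdPDF_pos u), stdPDF_eq]
        ring
    _ ≤ 1 := mul_le_one₀ stdPDF_const_le_one (by positivity) hmul

lemma slackPDF_pos {τ : ℝ} (hτ : 0 < τ) (u : ℝ) : 0 < slackPDF τ u := by
  have := stdPDF_pos u
  unfold slackPDF
  positivity

lemma pow_le_inv_mul_pow_succ_add_pow {q τ : ℝ} (hq : 0 ≤ q) (hτ : 0 < τ) (k : ℕ) :
    q ^ k ≤ τ⁻¹ * q ^ (k + 1) + τ ^ k := by
  rcases le_total τ q with h | h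
  · calc q ^ k ≤ (τ⁻¹ * q) * q ^ k := le_mul_of_one_le_left (by positivity)
          ((one_le_inv_mul₀ hτ).2 h)
      _ = τ⁻¹ * q ^ (k + 1) := by ring
      _ ≤ _ := le_add_of_nonneg_right (by positivity)
  · exact (pow_le_pow_left₀ hq h k).trans (le_add_of_nonneg_left (by positivity))

lemma sq_add_one_mul_exp_le {u v : ℝ} (h : |v - u| ≤ 1) :
    (v ^ 2 + 1) * Real.exp (-v ^ 2 / 2) ≤ 64 * Real.exp 15 * Real.exp (-u ^ 2 / 32) ^ 15 := by
  have hpoly : v ^ 2 + 1 ≤ 64 * Real.exp (v ^ 2 / 64) := by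
    nlinarith [sq_nonneg v, Real.add_one_le_exp (v ^ 2 / 64)]
  have hu : u ^ 2 ≤ 31 / 30 * v ^ 2 + 31 := by
    obtain ⟨h1, h2⟩ := abs_le.1 h
    nlinarith [sq_nonneg (v + 30 * (v - u))]
  calc (v ^ 2 + 1) * Real.exp (-v ^ 2 / 2)
      ≤ 64 * Real.exp (v ^ 2 / 64) * Real.exp (-v ^ 2 / 2) := by gcongr
    _ = 64 * Real.exp (v ^ 2 / 64 + -v ^ 2 / 2) := by rw [Real.exp_add]; ring
    _ ≤ 64 * Real.exp (15 + (15 : ℕ) * (-u ^ 2 / 32)) := by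
        refine mul_le_mul_of_nonneg_left (Real.exp_le_exp.2 ?_) (by norm_num)
        push_cast
        linarith
    _ = _ := by rw [Real.exp_add, Real.exp_nat_mul]; ring

lemma exists_sq_add_one_mul_stdPDF_le : ∃ C : ℝ, 1 ≤ C ∧ ∀ τ u v : ℝ, 0 < τ → |v - u| ≤ 1 →
    (v ^ 2 + 1) * φ v ≤ C * slackPDF τ u := by
  set c := (√(2 * Real.pi))⁻¹
  have hc1 : c ≤ 1 := stdPDF_const_le_one
  refine ⟨64 * Real.exp 15, by linarith [Real.one_le_exp (show (0 : ℝ) ≤ 15 by norm_num)],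
    fun τ u v hτ h => ?_⟩
  set q := Real.exp (-u ^ 2 / 32) with hq
  have hφ : φ u = c * q ^ 16 := by
    rw [stdPDF_eq, hq, ← Real.exp_nat_mul]
    congr 2
    push_cast
    ring
  calc (v ^ 2 + 1) * φ v = c * ((v ^ 2 + 1) * Real.exp (-v ^ 2 / 2)) := by rw [stdPDF_eq]; ring
    _ ≤ c * (64 * Real.exp 15 * q ^ 15) := 
        mul_le_mul_of_nonneg_left (sq_add_one_mul_exp_le h) (by positivity)
    _ ≤ c * (64 * Real.exp 15 * (τ⁻¹ * q ^ 16 + τ ^ 15)) := by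
        gcongr
        exact pow_le_inv_mul_pow_succ_add_pow (Real.exp_pos _).le hτ 15
    _ = 64 * Real.exp 15 * (τ⁻¹ * φ u + c * τ ^ 15) := by rw [hφ]; ring
    _ ≤ 64 * Real.exp 15 * slackPDF τ u := by
        unfold slackPDF
        gcongr
        exact mul_le_of_le_one_left (by positivity) hc1

lemma abs_add_sub_le_of_hasDerivAt {f f' : ℝ → ℝ} (hf : ∀ v, HasDerivAt f (f' v) v) {B K u : ℝ}
    (hB : ∀ v, |f v| ≤ B) (hK : ∀ v, |v - u| ≤ 1 → |f' v| ≤ K) (k : ℕ) (s : ℝ) :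
    |f (u + s) - f u| ≤ K * |s| + 2 * B * |s| ^ k := by
  have hB0 : 0 ≤ B := (abs_nonneg _).trans (hB 0)
  have hK0 : 0 ≤ K := (abs_nonneg _).trans (hK u (by simp))
  rcases le_or_gt |s| 1 with hs | hs
  · have hmean := (convex_closedBall u 1).norm_image_sub_le_of_norm_hasDerivWithin_le
      (fun v _ => (hf v).hasDerivWithinAt) hK (Metric.mem_closedBall_self zero_le_one)
      (show u + s ∈ Metric.closedBall u 1 by simpa [Real.dist_eq] using hs)
    rw [add_sub_cancel_left] at hmean
    exact hmean.trans (le_add_of_nonneg_right (by positivity))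
  · calc |f (u + s) - f u| ≤ |f (u + s)| + |f u| := abs_sub _ _
      _ ≤ 2 * B * 1 := by linarith [hB (u + s), hB u]
      _ ≤ 2 * B * |s| ^ k := by gcongr; exact one_le_pow₀ hs.le
      _ ≤ _ := le_add_of_nonneg_left (by positivity)

/-! ### The logistic kernel -/

/-- The derivative of the logistic kernel. -/
noncomputable def kernDeriv (x : ℝ) : ℝ := -Real.sinh x / Real.cosh x ^ 3

/-- The logistic kernel at bandwidth `σ`. -/
noncomputable def kernScaled (σ t : ℝ) : ℝ := σ⁻¹ * kern (t / σ)

/-- The derivative of `z ↦ kernScaled σ (x - z)`, as a function of `t = x - z`. -/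
noncomputable def kernScaledDeriv (σ t : ℝ) : ℝ := -(σ⁻¹ * σ⁻¹ * kernDeriv (t / σ))

/-- The `k`-th absolute moment of the logistic kernel. -/
noncomputable def kernMoment (k : ℕ) : ℝ := ∫ y, kern y * |y| ^ k

lemma kern_eq (x : ℝ) : kern x = (2 * Real.cosh x ^ 2)⁻¹ := by
  rw [kern, Real.cosh_eq]
  field_simp

lemma kern_eq_fun : kern = fun x => (2 * Real.cosh x ^ 2)⁻¹ := funext kern_eq

lemma kern_pos (x : ℝ) : 0 < kern x := by unfold kern; positivity

lemma kern_le_half (x : ℝ) : kern x ≤ 1 / 2 := by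
  rw [kern_eq, one_div]
  gcongr
  nlinarith [Real.one_le_cosh x]

lemma continuous_kern : Continuous kern := by
  rw [kern_eq_fun]
  exact Continuous.inv₀ (by fun_prop) fun x => by positivity

lemma continuous_kernDeriv : Continuous kernDeriv :=
  Continuous.div (by fun_prop) (by fun_prop) fun x => by positivity

lemma hasDerivAt_kern (x : ℝ) : HasDerivAt kern (kernDeriv x) x := by
  have hcosh : Real.cosh x ≠ 0 := (Real.cosh_pos x).ne'
  have h := (((Real.hasDerivAt_cosh x).fun_pow 2).const_mul 2).fun_inv (by positivity)
  rw [kern_eq_fun, kernDeriv]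
  refine h.congr_deriv ?_
  push_cast
  field_simp

lemma abs_kernDeriv_le (x : ℝ) : |kernDeriv x| ≤ 2 * kern x := by
  have hcosh : 0 < Real.cosh x := Real.cosh_pos x
  have hsinh : |Real.sinh x| ≤ Real.cosh x := by
    rw [Real.abs_sinh, ← Real.cosh_abs]
    exact (Real.sinh_lt_cosh |x|).le
  calc |kernDeriv x| = |Real.sinh x| / Real.cosh x ^ 3 := by
        rw [kernDeriv, abs_div, abs_neg, abs_of_pos (pow_pos hcosh 3)]
    _ ≤ Real.cosh x / Real.cosh x ^ 3 := by gcongr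
    _ = 2 * kern x := by rw [kern_eq]; field_simp

lemma kern_le_exp (x : ℝ) : kern x ≤ 2 * Real.exp (-|x|) := by
  have h : Real.exp |x| ≤ (Real.exp x + Real.exp (-x)) ^ 2 := by
    have hcosh : 2 ≤ Real.exp x + Real.exp (-x) := by
      linarith [Real.one_le_cosh x, Real.cosh_eq x]
    nlinarith [Real.exp_abs_le x]
  rw [kern, Real.exp_neg |x|, ← div_eq_mul_inv]
  gcongr

lemma kern_mul_abs_pow_le (k : ℕ) (y : ℝ) :
    kern y * |y| ^ k ≤ 2 * (k.factorial + (k + 2).factorial) * (1 + y ^ 2)⁻¹ := by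
  have hpow (j : ℕ) : |y| ^ j ≤ j.factorial * Real.exp |y| :=
    (div_le_iff₀' (by positivity)).1 (Real.pow_div_factorial_le_exp _ (abs_nonneg y) j)
  rw [← div_eq_mul_inv, le_div_iff₀ (by positivity)]
  calc kern y * |y| ^ k * (1 + y ^ 2) = kern y * (|y| ^ k + |y| ^ (k + 2)) := by
        rw [← sq_abs y]; ring
    _ ≤ 2 * Real.exp (-|y|) *
          (k.factorial * Real.exp |y| + (k + 2).factorial * Real.exp |y|) := by
        gcongr
        exacts [kern_le_exp y, hpow k, hpow (k + 2)]
    _ = 2 * (k.factorial + (k + 2).factorial) * (Real.exp (-|y|) * Real.exp |y|) := by ring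
    _ = _ := by rw [← Real.exp_add, neg_add_cancel, Real.exp_zero, mul_one]

lemma integrable_kern_mul_abs_pow (k : ℕ) : Integrable fun y => kern y * |y| ^ k := by
  refine (integrable_inv_one_add_sq.const_mul
    (2 * (k.factorial + (k + 2).factorial) : ℝ)).mono'
    (continuous_kern.mul (by fun_prop)).aestronglyMeasurable (ae_of_all _ fun y => ?_)
  rw [Real.norm_of_nonneg (mul_nonneg (kern_pos y).le (by positivity))]
  exact kern_mul_abs_pow_le k y

lemma kernMoment_nonneg (k : ℕ) : 0 ≤ kernMoment k :=
  integral_nonneg fun y => mul_nonneg (kern_pos y).le (by positivity)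

lemma integrable_kern : Integrable kern := by
  simpa using integrable_kern_mul_abs_pow 0

lemma integrable_kernDeriv : Integrable kernDeriv :=
  (integrable_kern.const_mul 2).mono' continuous_kernDeriv.aestronglyMeasurable
    (ae_of_all _ abs_kernDeriv_le)

lemma kernScaled_pos {σ : ℝ} (hσ : 0 < σ) (t : ℝ) : 0 < kernScaled σ t :=
  mul_pos (inv_pos.2 hσ) (kern_pos _)

lemma abs_kernScaled_le {σ : ℝ} (hσ : 0 < σ) (t : ℝ) : |kernScaled σ t| ≤ σ⁻¹ := by
  rw [abs_of_pos (kernScaled_pos hσ t)]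
  exact mul_le_of_le_one_right (by positivity) ((kern_le_half _).trans (by norm_num))

lemma abs_kernScaledDeriv_le {σ : ℝ} (hσ : 0 < σ) (t : ℝ) :
    |kernScaledDeriv σ t| ≤ 2 / σ * kernScaled σ t := by
  rw [kernScaledDeriv, kernScaled, abs_neg, abs_mul, abs_of_pos (by positivity : 0 < σ⁻¹ * σ⁻¹)]
  refine (mul_le_mul_of_nonneg_left (abs_kernDeriv_le _) (by positivity)).trans_eq ?_
  ring

lemma abs_kernScaledDeriv_le_inv_sq {σ : ℝ} (hσ : 0 < σ) (t : ℝ) :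
    |kernScaledDeriv σ t| ≤ σ⁻¹ ^ 2 := by
  calc |kernScaledDeriv σ t| ≤ 2 / σ * kernScaled σ t := abs_kernScaledDeriv_le hσ t
    _ = σ⁻¹ ^ 2 * (2 * kern (t / σ)) := by rw [kernScaled]; ring
    _ ≤ σ⁻¹ ^ 2 := mul_le_of_le_one_right (by positivity) (by linarith [kern_le_half (t / σ)])

lemma continuous_kernScaled (σ : ℝ) : Continuous (kernScaled σ) :=
  continuous_const.mul (continuous_kern.comp (by fun_prop))

lemma continuous_kernScaledDeriv (σ : ℝ) : Continuous (kernScaledDeriv σ) :=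
  (continuous_const.mul (continuous_kernDeriv.comp (by fun_prop))).neg

lemma hasDerivAt_kernScaled {σ : ℝ} (x z : ℝ) :
    HasDerivAt (fun z => kernScaled σ (x - z)) (kernScaledDeriv σ (x - z)) z := by
  have h : HasDerivAt (fun z : ℝ => (x - z) / σ) (-1 / σ) z :=
    ((hasDerivAt_id z).const_sub x).div_const σ
  refine (((hasDerivAt_kern _).comp z h).const_mul σ⁻¹).congr_deriv ?_
  rw [kernScaledDeriv]
  ring

lemma hasDerivAt_logistic (x : ℝ) :
    HasDerivAt (fun x : ℝ => (1 + Real.exp (-2 * x))⁻¹) (kern x) x := by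
  have h : HasDerivAt (fun x : ℝ => 1 + Real.exp (-2 * x)) (Real.exp (-2 * x) * (-2)) x :=
    ((hasDerivAt_const_mul (-2 : ℝ)).exp).const_add 1
  refine (h.fun_inv (by positivity)).congr_deriv ?_
  have hsq : Real.exp (-2 * x) = (Real.exp x)⁻¹ ^ 2 := by
    rw [← Real.exp_neg, ← Real.exp_nat_mul]
    congr 1
    push_cast
    ring
  rw [kern, hsq, Real.exp_neg]
  field_simp

lemma integral_kern : ∫ y, kern y = 1 := by
  have htop : Tendsto (fun x : ℝ => (1 + Real.exp (-2 * x))⁻¹) atTop (𝓝 1) := by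
    have h : Tendsto (fun x : ℝ => Real.exp (-2 * x)) atTop (𝓝 0) :=
      Real.tendsto_exp_atBot.comp (tendsto_id.const_mul_atTop_of_neg (by norm_num))
    simpa using (h.const_add 1).inv₀ (by norm_num)
  have hbot : Tendsto (fun x : ℝ => (1 + Real.exp (-2 * x))⁻¹) atBot (𝓝 0) := by
    have h : Tendsto (fun x : ℝ => Real.exp (-2 * x)) atBot atTop :=
      Real.tendsto_exp_atTop.comp (tendsto_id.const_mul_atBot_of_neg (by norm_num))
    exact (tendsto_atTop_add_const_left _ 1 h).inv_tendsto_atTop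
  simpa using integral_of_hasDerivAt_of_tendsto hasDerivAt_logistic integrable_kern hbot htop

/-! ### Kernel smoothing -/

/-- The function `f` smoothed by the logistic kernel at bandwidth `σ`. -/
noncomputable def kernSmooth (σ : ℝ) (f : ℝ → ℝ) (u : ℝ) : ℝ := ∫ y, kern y * f (u + σ * y)

lemma integrable_kern_mul_comp {f : ℝ → ℝ} (hf : Continuous f) {B : ℝ} (hB : ∀ y, |f y| ≤ B)
    (σ u : ℝ) : Integrable fun y => kern y * f (u + σ * y) :=
  integrable_kern.mul_bdd (hf.comp (by fun_prop)).aestronglyMeasurable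
    (ae_of_all _ fun y => hB (u + σ * y))

lemma abs_kernSmooth_sub_le {f : ℝ → ℝ} (hf : Continuous f) {A B D σ u : ℝ} {k : ℕ}
    (hB : ∀ y, |f y| ≤ B) (hσ : 0 ≤ σ)
    (hinc : ∀ s, |f (u + s) - f u| ≤ A * |s| + D * |s| ^ k) :
    |kernSmooth σ f u - f u| ≤ A * σ * kernMoment 1 + D * σ ^ k * kernMoment k := by
  have hint1 := (integrable_kern_mul_abs_pow 1).const_mul (A * σ)
  have hintk := (integrable_kern_mul_abs_pow k).const_mul (D * σ ^ k)
  calc |kernSmooth σ f u - f u| = ‖∫ y, kern y * (f (u + σ * y) - f u)‖ := by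
        simp_rw [mul_sub]
        rw [integral_sub (integrable_kern_mul_comp hf hB σ u) (integrable_kern.mul_const _),
          integral_mul_const, integral_kern, one_mul, kernSmooth, Real.norm_eq_abs]
    _ ≤ ∫ y, (A * σ * (kern y * |y| ^ 1) + D * σ ^ k * (kern y * |y| ^ k)) := by
        refine norm_integral_le_of_norm_le (hint1.add hintk) (ae_of_all _ fun y => ?_)
        have hy := hinc (σ * y)
        rw [abs_mul, abs_of_nonneg hσ] at hy
        rw [norm_mul, Real.norm_of_nonneg (kern_pos y).le, Real.norm_eq_abs]
        refine (mul_le_mul_of_nonneg_left hy (kern_pos y).le).trans_eq ?_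
        ring
    _ = _ := by
        rw [integral_add hint1 hintk, integral_const_mul, integral_const_mul, kernMoment,
          kernMoment]

lemma exists_abs_kernSmooth_sub_le : ∃ C : ℝ, 1 ≤ C ∧ ∀ τ u : ℝ, 0 < τ →
    |stdPDFDeriv u| ≤ C * slackPDF τ u ∧ ∀ σ : ℝ, 0 ≤ σ →
    |kernSmooth σ φ u - φ u| ≤ C * (σ * slackPDF τ u + σ ^ 5) ∧
    |kernSmooth σ stdPDFDeriv u - stdPDFDeriv u| ≤ C * (σ * slackPDF τ u + σ ^ 5) := by
  obtain ⟨C, hC1, hC⟩ := exists_sq_add_one_mul_stdPDF_le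
  have hM1 := kernMoment_nonneg 1
  have hM5 := kernMoment_nonneg 5
  refine ⟨C * (1 + kernMoment 1) + 2 * kernMoment 5, by nlinarith, fun τ u hτ => ?_⟩
  have hw := slackPDF_pos hτ u
  have hsmooth {f f' : ℝ → ℝ} (hf : ∀ v, HasDerivAt f (f' v) v) (hf1 : ∀ v, |f v| ≤ 1)
      (hf' : ∀ v, |f' v| ≤ (v ^ 2 + 1) * φ v) {σ : ℝ} (hσ : 0 ≤ σ) :
      |kernSmooth σ f u - f u|
        ≤ (C * (1 + kernMoment 1) + 2 * kernMoment 5) * (σ * slackPDF τ u + σ ^ 5) := by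
    have hcont : Continuous f := continuous_iff_continuousAt.2 fun v => (hf v).continuousAt
    have hinc := abs_add_sub_le_of_hasDerivAt hf hf1 (fun v hv => (hf' v).trans (hC τ u v hτ hv)) 5
    calc |kernSmooth σ f u - f u|
        ≤ C * slackPDF τ u * σ * kernMoment 1 + 2 * 1 * σ ^ 5 * kernMoment 5 :=
          abs_kernSmooth_sub_le hcont hf1 hσ hinc
      _ = C * kernMoment 1 * (σ * slackPDF τ u) + 2 * kernMoment 5 * σ ^ 5 := by ring
      _ ≤ _ := by rw [mul_add]; gcongr <;> nlinarith
  refine ⟨?_, fun σ hσ => ⟨?_, ?_⟩⟩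
  · refine ((abs_stdPDFDeriv_le u).trans (hC τ u u hτ (by simp))).trans ?_
    gcongr
    nlinarith
  · exact hsmooth hasDerivAt_stdPDF abs_stdPDF_le_one abs_stdPDFDeriv_le hσ
  · refine hsmooth hasDerivAt_stdPDFDeriv abs_stdPDFDeriv_le_one (fun v => ?_) hσ
    rw [abs_mul, abs_of_pos (stdPDF_pos v)]
    refine mul_le_mul_of_nonneg_right (abs_le.2 ⟨?_, ?_⟩) (stdPDF_pos v).le <;>
      linarith [sq_nonneg v]

lemma integral_stdNormal_comp_affine {σ : ℝ} (hσ : 0 < σ) (g : ℝ → ℝ) (v z : ℝ) :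
    ∫ e, g ((v + e - z) / σ) ∂γ = σ * ∫ y, g y * φ (z - v + σ * y) := by
  have hshift := integral_add_right_eq_self (μ := volume)
    (fun e => φ e * g ((v + e - z) / σ)) (z - v)
  have hscale := Measure.integral_comp_mul_left (fun e => φ (z - v + e) * g (e / σ)) σ
  rw [abs_of_pos (inv_pos.2 hσ), smul_eq_mul, eq_inv_mul_iff_mul_eq₀ hσ.ne'] at hscale
  simp_rw [integral_gaussianReal_eq_integral_smul one_ne_zero, smul_eq_mul]
  rw [← hshift]
  calc _ = ∫ e, φ (z - v + e) * g (e / σ) := by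
        refine integral_congr_ae (ae_of_all _ fun e => ?_)
        ring_nf
    _ = _ := by
        rw [← hscale]
        congr 2 with y
        rw [mul_div_cancel_left₀ _ hσ.ne', mul_comm]

lemma integral_kern_stdNormal {σ : ℝ} (hσ : 0 < σ) (v z : ℝ) :
    ∫ e, kernScaled σ (v + e - z) ∂γ = kernSmooth σ φ (z - v) := by
  unfold kernScaled
  rw [integral_const_mul, integral_stdNormal_comp_affine hσ, inv_mul_cancel_left₀ hσ.ne',
    kernSmooth]

lemma integral_kernDeriv_stdNormal {σ : ℝ} (hσ : 0 < σ) (v z : ℝ) :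
    ∫ e, kernScaledDeriv σ (v + e - z) ∂γ = kernSmooth σ stdPDFDeriv (z - v) := by
  have hderiv (y : ℝ) :
      HasDerivAt (fun y => φ (z - v + σ * y)) (stdPDFDeriv (z - v + σ * y) * σ) y :=
    (hasDerivAt_stdPDF _).comp y ((hasDerivAt_const_mul σ).const_add (z - v))
  have hparts : ∫ y, φ (z - v + σ * y) * kernDeriv y
      = -∫ y, stdPDFDeriv (z - v + σ * y) * σ * kern y := by
    refine integral_mul_deriv_eq_deriv_mul_of_integrable (fun y _ => hderiv y)
      (fun y _ => hasDerivAt_kern y) ?_ ?_ ?_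
    · exact integrable_kernDeriv.bdd_mul (continuous_stdPDF.comp (by fun_prop)).aestronglyMeasurable
        (ae_of_all _ fun y => abs_stdPDF_le_one _)
    · refine ((integrable_kern_mul_comp continuous_stdPDFDeriv abs_stdPDFDeriv_le_one σ
        (z - v)).const_mul σ).congr (ae_of_all _ fun y => ?_)
      simp only [Pi.mul_apply]
      ring
    · exact (integrable_kern_mul_comp continuous_stdPDF abs_stdPDF_le_one σ (z - v)).congr
        (ae_of_all _ fun y => mul_comm _ _)
  have hσ0 := hσ.ne'
  unfold kernScaledDeriv
  rw [integral_neg, integral_const_mul, integral_stdNormal_comp_affine hσ, kernSmooth]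
  simp_rw [mul_comm (kernDeriv _), hparts, mul_right_comm _ σ, mul_comm _ σ]
  rw [integral_const_mul]
  simp_rw [mul_comm (stdPDFDeriv _)]
  field_simp

/-! ### The estimated and the oracle decision function -/

section DecisionFunctions

variable {ι : Type*} {s : Finset ι}

lemma mixDensity_eq_expect (s : Finset ι) (ν : ι → ℝ) (z : ℝ) :
    mixDensity s ν z = 𝔼 j ∈ s, φ (z - ν j) := by
  rw [mixDensity, Finset.expect_eq_sum_div_card, div_eq_inv_mul]

lemma kernelDensity_eq_expect (σ : ℝ) (s : Finset ι) (x : ι → ℝ) (z : ℝ) :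
    kernelDensity σ s x z = 𝔼 j ∈ s, kernScaled σ (x j - z) := by
  rw [Finset.expect_eq_sum_div_card, div_eq_inv_mul]
  rfl

lemma mixDensity_pos (hs : s.Nonempty) (ν : ι → ℝ) (z : ℝ) : 0 < mixDensity s ν z := by
  rw [mixDensity_eq_expect]
  exact Finset.expect_pos (fun j _ => stdPDF_pos _) hs

lemma hasDerivAt_expect {f : ι → ℝ → ℝ} {f' : ι → ℝ} {z : ℝ}
    (h : ∀ j, HasDerivAt (f j) (f' j) z) :
    HasDerivAt (fun z => 𝔼 j ∈ s, f j z) (𝔼 j ∈ s, f' j) z := by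
  simp_rw [Finset.expect_eq_sum_div_card]
  exact (HasDerivAt.fun_sum fun j _ => h j).div_const _

lemma estDecision_eq (σ : ℝ) (s : Finset ι) (x : ι → ℝ) (z : ℝ) :
    estDecision σ s x z = z + (𝔼 j ∈ s, kernScaledDeriv σ (x j - z))
      / 𝔼 j ∈ s, kernScaled σ (x j - z) := by
  have h := hasDerivAt_expect (s := s) fun j => hasDerivAt_kernScaled (σ := σ) (x j) z
  rw [estDecision, kernelDensity_eq_expect, funext (kernelDensity_eq_expect σ s x), h.deriv]

lemma oracleDecision_eq (s : Finset ι) (ν : ι → ℝ) (z : ℝ) :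
    oracleDecision s ν z = z + (𝔼 j ∈ s, stdPDFDeriv (z - ν j)) / mixDensity s ν z := by
  have h := hasDerivAt_expect (s := s) fun j => (hasDerivAt_stdPDF (z - ν j)).comp_sub_const z (ν j)
  rw [oracleDecision, ← h.deriv, funext (mixDensity_eq_expect s ν)]

lemma abs_expect_le_expect {f g : ι → ℝ} (h : ∀ j, |f j| ≤ g j) :
    |𝔼 j ∈ s, f j| ≤ 𝔼 j ∈ s, g j :=
  (Finset.abs_expect_le s f).trans (Finset.expect_le_expect fun j _ => h j)

lemma abs_estDecision_sub_le {σ : ℝ} (hσ : 0 < σ) (s : Finset ι) (x : ι → ℝ) (z : ℝ) :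
    |estDecision σ s x z - z| ≤ 2 / σ := by
  have hdens : 0 ≤ 𝔼 j ∈ s, kernScaled σ (x j - z) :=
    Finset.expect_nonneg fun j _ => (kernScaled_pos hσ _).le
  rw [estDecision_eq, add_sub_cancel_left, abs_div, abs_of_nonneg hdens]
  refine div_le_of_le_mul₀ hdens (by positivity) ?_
  rw [Finset.mul_expect]
  exact abs_expect_le_expect fun j => abs_kernScaledDeriv_le hσ _

lemma abs_expect_sub_expect_insert_le [DecidableEq ι] {i : ι} (hi : i ∉ s) (hs : s.Nonempty)
    {f : ι → ℝ} (hf : ∀ j, |f j| ≤ 1) :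
    |𝔼 j ∈ s, f j - 𝔼 j ∈ insert i s, f j| ≤ 2 * (s.card : ℝ)⁻¹ := by
  have hmean : |𝔼 j ∈ s, f j| ≤ 1 :=
    (abs_expect_le_expect hf).trans_eq (Finset.expect_const hs 1)
  have hinsert : 𝔼 j ∈ s, f j - 𝔼 j ∈ insert i s, f j
      = (𝔼 j ∈ s, f j - f i) / (s.card + 1) := by
    rw [Finset.expect_eq_sum_div_card (insert i s), Finset.sum_insert hi,
      Finset.card_insert_of_notMem hi, ← Finset.card_mul_expect s f]
    push_cast
    field_simp
    ring
  rw [hinsert, abs_div, abs_of_pos (by positivity : (0 : ℝ) < s.card + 1), div_eq_mul_inv]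
  gcongr
  · linarith [abs_sub (𝔼 j ∈ s, f j) (f i), hf i]
  · linarith

lemma abs_div_sub_div_le {F F' A A' d k : ℝ} (hF : 0 < F) (hA : |A - F| ≤ d * F)
    (hA' : |A' - F'| ≤ d * F) (hF' : |F'| ≤ k * F) (hd : d ≤ 1 / 2) :
    |A' / A - F' / F| ≤ 2 * d * (1 + k) := by
  have hd0 : 0 ≤ d := nonneg_of_mul_nonneg_left ((abs_nonneg _).trans hA) hF
  have hk0 : 0 ≤ k := nonneg_of_mul_nonneg_left ((abs_nonneg _).trans hF') hF
  have hAF : F ≤ 2 * A := by nlinarith [(abs_le.1 hA).1]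
  have hA0 : 0 < A := by linarith
  have hsub : A' / A - F' / F = ((A' - F') * F - F' * (A - F)) / (A * F) := by field_simp; ring
  rw [hsub, abs_div, abs_of_pos (mul_pos hA0 hF), div_le_iff₀ (mul_pos hA0 hF)]
  calc |(A' - F') * F - F' * (A - F)| ≤ |(A' - F') * F| + |F' * (A - F)| := abs_sub _ _
    _ = |A' - F'| * F + |F'| * |A - F| := by rw [abs_mul, abs_mul, abs_of_pos hF]
    _ ≤ d * F * F + k * F * (d * F) := by gcongr
    _ = d * (1 + k) * (F * F) := by ring
    _ ≤ d * (1 + k) * (2 * A * F) := by gcongr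
    _ = _ := by ring

/-- The fluctuation of the kernel average `𝔼 j ∈ s, g (Z j - z)` around its mean, when
`Z j ∼ N(ν j, 1)`. -/
noncomputable def kernelNoise (g : ℝ → ℝ) (s : Finset ι) (ν Z : ι → ℝ) (z : ℝ) : ℝ :=
  𝔼 j ∈ s, (g (Z j - z) - ∫ e, g (ν j + e - z) ∂γ)

/-- The point `z` is well estimated, at bandwidth `τ ^ 4`, from the observations `Z j`, `j ∈ s`, of
the states `ν j`: the sample is large, the oracle density of the states with index in `insert i s`
is not tiny at `z`, and the kernel averages are close to their means. -/
structure WellEstimated [DecidableEq ι] (τ : ℝ) (s : Finset ι) (i : ι) (ν Z : ι → ℝ) (z : ℝ) :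
    Prop where
  card_large : 1 ≤ τ ^ 80 * s.card
  density_large : τ ^ 16 ≤ mixDensity (insert i s) ν z
  noise_small : |kernelNoise (kernScaled (τ ^ 4)) s ν Z z| ≤ τ ^ 19
  derivNoise_small : |kernelNoise (kernScaledDeriv (τ ^ 4)) s ν Z z| ≤ τ ^ 19

variable {τ C : ℝ} {i : ι} {ν Z : ι → ℝ} {z : ℝ}

lemma expect_slackPDF (hs : s.Nonempty) (τ : ℝ) (ν : ι → ℝ) (z : ℝ) :
    𝔼 j ∈ s, slackPDF τ (z - ν j) = τ⁻¹ * mixDensity s ν z + τ ^ 15 := by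
  simp only [slackPDF]
  rw [Finset.expect_add_distrib, ← Finset.mul_expect, Finset.expect_const hs, mixDensity_eq_expect]

lemma abs_expect_kernSmooth_sub_le (hs : s.Nonempty) (hτ : 0 < τ) {f : ℝ → ℝ}
    (hsmooth : ∀ u, |kernSmooth (τ ^ 4) f u - f u| ≤ C * (τ ^ 4 * slackPDF τ u + (τ ^ 4) ^ 5))
    (ν : ι → ℝ) (z : ℝ) :
    |𝔼 j ∈ s, kernSmooth (τ ^ 4) f (z - ν j) - 𝔼 j ∈ s, f (z - ν j)|
      ≤ C * (τ ^ 3 * mixDensity s ν z + τ ^ 19 + τ ^ 20) := by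
  rw [← Finset.expect_sub_distrib]
  refine (abs_expect_le_expect fun j => hsmooth _).trans_eq ?_
  rw [← Finset.mul_expect, Finset.expect_add_distrib, ← Finset.mul_expect, expect_slackPDF hs,
    Finset.expect_const hs]
  field_simp

namespace WellEstimated

variable [DecidableEq ι] (h : WellEstimated τ s i ν Z z)

include h in
lemma nonempty : s.Nonempty := by
  by_contra! hs
  have := h.card_large
  norm_num [hs] at this

include h in
lemma inv_card_le (hτ : 0 < τ) (hτ1 : τ ≤ 1) : (s.card : ℝ)⁻¹ ≤ τ ^ 19 := by
  have hN : 0 < (s.card : ℝ) := by exact_mod_cast h.nonempty.card_pos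
  calc (s.card : ℝ)⁻¹ ≤ τ ^ 80 := by rw [inv_le_iff_one_le_mul₀ hN]; exact h.card_large
    _ ≤ τ ^ 19 := pow_le_pow_of_le_one hτ.le hτ1 (by norm_num)

include h in
lemma abs_expect_sub_expect_le (hi : i ∉ s) (hτ : 0 < τ) (hτ1 : τ ≤ 1) (hC : 1 ≤ C) {f g : ℝ → ℝ}
    (hf : ∀ u, |f u| ≤ 1) (hg : ∀ v, ∫ e, g (v + e - z) ∂γ = kernSmooth (τ ^ 4) f (z - v))
    (hsmooth : ∀ u, |kernSmooth (τ ^ 4) f u - f u| ≤ C * (τ ^ 4 * slackPDF τ u + (τ ^ 4) ^ 5))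
    (hnoise : |kernelNoise g s ν Z z| ≤ τ ^ 19) :
    |𝔼 j ∈ s, g (Z j - z) - 𝔼 j ∈ insert i s, f (z - ν j)|
      ≤ 8 * C * τ ^ 3 * mixDensity (insert i s) ν z := by
  have hcard := h.inv_card_le hτ hτ1
  have hF := mul_le_mul_of_nonneg_left h.density_large (pow_pos hτ 3).le
  have hfluct : |𝔼 j ∈ s, g (Z j - z) - 𝔼 j ∈ s, kernSmooth (τ ^ 4) f (z - ν j)| ≤ τ ^ 19 := by
    simpa only [kernelNoise, hg, Finset.expect_sub_distrib] using hnoise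
  have hbias := abs_expect_kernSmooth_sub_le h.nonempty hτ hsmooth ν z
  have hlast := abs_expect_sub_expect_insert_le hi h.nonempty fun j => hf (z - ν j)
  have hdens := abs_expect_sub_expect_insert_le hi h.nonempty fun j => abs_stdPDF_le_one (z - ν j)
  rw [← mixDensity_eq_expect, ← mixDensity_eq_expect] at hdens
  set F₀ := mixDensity s ν z
  set F := mixDensity (insert i s) ν z
  have hF₀ : τ ^ 3 * F₀ ≤ τ ^ 3 * F + 2 * τ ^ 19 := by
    have hdiff : F₀ - F ≤ 2 * τ ^ 19 := (le_abs_self _).trans (by linarith)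
    nlinarith [pow_le_one₀ (n := 3) hτ.le hτ1, pow_pos hτ 3, pow_pos hτ 19]
  have hτ20 : τ ^ 20 ≤ τ ^ 19 := pow_le_pow_of_le_one hτ.le hτ1 (by norm_num)
  have hτ19 : τ ^ 19 ≤ τ ^ 3 * F := by linarith [show τ ^ 19 = τ ^ 3 * τ ^ 16 by ring]
  calc |𝔼 j ∈ s, g (Z j - z) - 𝔼 j ∈ insert i s, f (z - ν j)|
      ≤ τ ^ 19 + C * (τ ^ 3 * F₀ + τ ^ 19 + τ ^ 20) + 2 * τ ^ 19 := by
        have h₁ := abs_sub_le (𝔼 j ∈ s, g (Z j - z)) (𝔼 j ∈ s, kernSmooth (τ ^ 4) f (z - ν j))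
          (𝔼 j ∈ insert i s, f (z - ν j))
        have h₂ := abs_sub_le (𝔼 j ∈ s, kernSmooth (τ ^ 4) f (z - ν j)) (𝔼 j ∈ s, f (z - ν j))
          (𝔼 j ∈ insert i s, f (z - ν j))
        linarith
    _ ≤ C * τ ^ 19 + C * (τ ^ 3 * F + 2 * τ ^ 19 + τ ^ 19 + τ ^ 19) + 2 * (C * τ ^ 19) := by
        have hCτ : τ ^ 19 ≤ C * τ ^ 19 := le_mul_of_one_le_left (by positivity) hC
        gcongr
    _ = C * (τ ^ 3 * F) + 7 * (C * τ ^ 19) := by ring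
    _ ≤ C * (τ ^ 3 * F) + 7 * (C * (τ ^ 3 * F)) := by gcongr
    _ = 8 * C * τ ^ 3 * F := by ring

include h in
lemma abs_expect_stdPDFDeriv_le (hτ : 0 < τ) (hC : 0 ≤ C)
    (hderiv : ∀ u, |stdPDFDeriv u| ≤ C * slackPDF τ u) :
    |𝔼 j ∈ insert i s, stdPDFDeriv (z - ν j)|
      ≤ 2 * C * τ⁻¹ * mixDensity (insert i s) ν z := by
  refine (abs_expect_le_expect fun j => hderiv _).trans ?_
  have hτ15 : τ ^ 15 ≤ τ⁻¹ * mixDensity (insert i s) ν z := by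
    rw [le_inv_mul_iff₀' hτ]
    exact h.density_large
  rw [← Finset.mul_expect, expect_slackPDF (Finset.insert_nonempty i s)]
  nlinarith

end WellEstimated

lemma exists_abs_estDecision_sub_oracleDecision_le : ∃ C : ℝ, 1 ≤ C ∧
    ∀ {ι : Type*} [DecidableEq ι] {s : Finset ι} {i : ι} {ν Z : ι → ℝ} {τ z : ℝ}, i ∉ s → 0 < τ →
    C * τ ≤ 1 → WellEstimated τ s i ν Z z →
    |estDecision (τ ^ 4) s Z z - oracleDecision (insert i s) ν z| ≤ C * τ ^ 2 ∧
    |oracleDecision (insert i s) ν z - z| ≤ C * τ⁻¹ := by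
  obtain ⟨C, hC1, hC⟩ := exists_abs_kernSmooth_sub_le
  refine ⟨48 * C ^ 2, by nlinarith, fun {ι _ s i ν Z τ z} hi hτ hCτ h => ?_⟩
  have hC2 : C ≤ C ^ 2 := le_self_pow₀ hC1 two_ne_zero
  have hCτ' : 48 * C * τ ≤ 1 := by nlinarith
  have hτ1 : τ ≤ 1 := by nlinarith
  have hσ : 0 < τ ^ 4 := by positivity
  have hF : 0 < mixDensity (insert i s) ν z := mixDensity_pos (Finset.insert_nonempty i s) ν z
  have hdens := h.abs_expect_sub_expect_le hi hτ hτ1 hC1 abs_stdPDF_le_one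
    (fun v => integral_kern_stdNormal hσ v z) (fun u => ((hC τ u hτ).2 _ hσ.le).1) h.noise_small
  have hderiv := h.abs_expect_sub_expect_le hi hτ hτ1 hC1 abs_stdPDFDeriv_le_one
    (fun v => integral_kernDeriv_stdNormal hσ v z) (fun u => ((hC τ u hτ).2 _ hσ.le).2)
    h.derivNoise_small
  have horacle := h.abs_expect_stdPDFDeriv_le hτ (by linarith) fun u => (hC τ u hτ).1
  rw [← mixDensity_eq_expect] at hdens
  rw [estDecision_eq, oracleDecision_eq, add_sub_add_left_eq_sub, add_sub_cancel_left]
  constructor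
  · have hd : 8 * C * τ ^ 3 ≤ 1 / 2 := by
      nlinarith [pow_le_of_le_one hτ.le hτ1 three_ne_zero]
    calc _ ≤ 2 * (8 * C * τ ^ 3) * (1 + 2 * C * τ⁻¹) :=
          abs_div_sub_div_le hF hdens hderiv horacle hd
      _ = 16 * C * τ * τ ^ 2 + 32 * C ^ 2 * τ ^ 2 := by field_simp; ring
      _ ≤ 16 * C ^ 2 * 1 * τ ^ 2 + 32 * C ^ 2 * τ ^ 2 := by gcongr
      _ = 48 * C ^ 2 * τ ^ 2 := by ring
  · rw [abs_div, abs_of_pos hF, div_le_iff₀ hF]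
    refine horacle.trans ?_
    gcongr
    linarith

lemma sq_le_sq_add_of_abs_sub_le {a b e : ℝ} (hτ : 0 < τ) (hτ1 : τ ≤ 1) (hC : 1 ≤ C)
    (hab : |a - b| ≤ C * τ ^ 2) (hb : |b| ≤ C * τ⁻¹ + |e|) :
    a ^ 2 ≤ b ^ 2 + 3 * C ^ 2 * τ * (2 + e ^ 2) := by
  have hcross : 2 * b * (a - b) ≤ 2 * C ^ 2 * τ + 2 * C * τ ^ 2 * |e| := by
    calc 2 * b * (a - b) ≤ 2 * |b| * |a - b| := by
          rw [mul_assoc, mul_assoc, ← abs_mul]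
          gcongr
          exact le_abs_self _
      _ ≤ 2 * (C * τ⁻¹ + |e|) * (C * τ ^ 2) := by gcongr
      _ = _ := by field_simp
  have hsq : (a - b) ^ 2 ≤ (C * τ ^ 2) ^ 2 :=
    sq_le_sq' (by linarith [abs_le.1 hab]) (abs_le.1 hab).2
  calc a ^ 2 = b ^ 2 + 2 * b * (a - b) + (a - b) ^ 2 := by ring
    _ ≤ b ^ 2 + (2 * C ^ 2 * τ + 2 * C * τ ^ 2 * |e|) + (C * τ ^ 2) ^ 2 := by gcongr
    _ = b ^ 2 + (2 * C ^ 2 * τ + 2 * C * 1 * (τ * τ) * |e| + C ^ 2 * (τ ^ 3 * τ)) := by ring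
    _ ≤ b ^ 2 + (2 * C ^ 2 * τ + 2 * C * C * (1 * τ) * (e ^ 2 + 1) + C ^ 2 * (1 * τ)) := by
        gcongr
        · exact abs_le_sq_add_one e
        · exact pow_le_one₀ hτ.le hτ1
    _ ≤ b ^ 2 + 3 * C ^ 2 * τ * (2 + e ^ 2) := by
        nlinarith [mul_nonneg (mul_nonneg (sq_nonneg C) hτ.le) (sq_nonneg e),
          mul_nonneg (sq_nonneg C) hτ.le]

lemma exists_estDecision_loss_le : ∃ C : ℝ, 1 ≤ C ∧
    ∀ {ι : Type*} [DecidableEq ι] {s : Finset ι} {i : ι} {ν Z : ι → ℝ} {τ e : ℝ}, i ∉ s → 0 < τ →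
    C * τ ≤ 1 → WellEstimated τ s i ν Z (ν i + e) →
    (estDecision (τ ^ 4) s Z (ν i + e) - ν i) ^ 2
      ≤ (oracleDecision (insert i s) ν (ν i + e) - ν i) ^ 2 + C * τ * (2 + e ^ 2) := by
  obtain ⟨C, hC1, hC⟩ := exists_abs_estDecision_sub_oracleDecision_le
  refine ⟨3 * C ^ 2, by nlinarith, fun {ι _ s i ν Z τ e} hi hτ hCτ h => ?_⟩
  obtain ⟨hclose, hbound⟩ := hC hi hτ (by nlinarith) h
  refine sq_le_sq_add_of_abs_sub_le hτ (by nlinarith) hC1 (by rwa [sub_sub_sub_cancel_right]) ?_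
  calc |oracleDecision (insert i s) ν (ν i + e) - ν i|
      = |(oracleDecision (insert i s) ν (ν i + e) - (ν i + e)) + e| := by congr 1; ring
    _ ≤ _ := (abs_add_le _ _).trans (by gcongr)

lemma estDecision_loss_le (hτ : 0 < τ) (s : Finset ι) (Z : ι → ℝ) (v e : ℝ) :
    (estDecision (τ ^ 4) s Z (v + e) - v) ^ 2 ≤ 9 * (τ ^ 8)⁻¹ + τ ^ 8 * e ^ 4 := by
  have h := abs_estDecision_sub_le (pow_pos hτ 4) s Z (v + e)
  set a := estDecision (τ ^ 4) s Z (v + e) - (v + e) with ha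
  have ha2 : a ^ 2 ≤ (2 / τ ^ 4) ^ 2 := sq_le_sq' (by linarith [abs_le.1 h]) (abs_le.1 h).2
  have he2 : 2 * e ^ 2 ≤ (τ ^ 8)⁻¹ + τ ^ 8 * e ^ 4 := by
    have : 0 ≤ τ ^ 8 * (e ^ 2 - (τ ^ 8)⁻¹) ^ 2 := by positivity
    field_simp at this ⊢
    linarith
  calc (estDecision (τ ^ 4) s Z (v + e) - v) ^ 2 = (a + e) ^ 2 := by rw [ha]; ring
    _ ≤ 2 * a ^ 2 + 2 * e ^ 2 := by linarith [sq_nonneg (a - e)]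
    _ ≤ 2 * (2 / τ ^ 4) ^ 2 + ((τ ^ 8)⁻¹ + τ ^ 8 * e ^ 4) := by gcongr
    _ = 9 * (τ ^ 8)⁻¹ + τ ^ 8 * e ^ 4 := by ring

end DecisionFunctions

/-! ### Moments of the standard normal distribution -/

lemma integrable_pow_stdNormal (k : ℕ) : Integrable (fun e : ℝ => e ^ k) γ := by
  rcases k.eq_zero_or_pos with rfl | hk
  · simp
  · exact (memLp_id_gaussianReal k).integrable_norm_pow hk.ne' |>.mono'
      (by fun_prop) (ae_of_all _ fun e => by simp)

lemma integral_self_stdNormal : ∫ e, e ∂γ = 0 :=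
  integral_id_gaussianReal

lemma integral_sq_stdNormal : ∫ e, e ^ 2 ∂γ = 1 := by
  have h := variance_id_gaussianReal (μ := 0) (v := 1)
  rw [variance_eq_sub (memLp_id_gaussianReal 2)] at h
  simpa using h

lemma lintegral_sq_stdNormal : ∫⁻ e, ENNReal.ofReal (e ^ 2) ∂γ = 1 := by
  rw [← ofReal_integral_eq_lintegral_ofReal (integrable_pow_stdNormal 2)
    (ae_of_all _ fun e => sq_nonneg e), integral_sq_stdNormal, ENNReal.ofReal_one]

/-- The fourth moment of the standard normal distribution. Only its finiteness matters, so its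
value is left alone. -/
noncomputable def stdNormalFourth : ℝ := ∫ e, e ^ 4 ∂γ

lemma stdNormalFourth_nonneg : 0 ≤ stdNormalFourth :=
  integral_nonneg fun e => by positivity

lemma lintegral_fourth_stdNormal :
    ∫⁻ e, ENNReal.ofReal (e ^ 4) ∂γ = ENNReal.ofReal stdNormalFourth :=
  (ofReal_integral_eq_lintegral_ofReal (integrable_pow_stdNormal 4)
    (ae_of_all _ fun e => by positivity)).symm

lemma lintegral_stdNormal_add {G : ℝ → ℝ≥0∞} (hG : Measurable G) (v : ℝ) :
    ∫⁻ x, G (v + x) ∂γ = ∫⁻ z, ENNReal.ofReal (φ (z - v)) * G z := by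
  have hshift : ∫⁻ x, G (v + x) ∂γ = ∫⁻ z, G z ∂(gaussianReal v 1) := by
    rw [← zero_add v, ← gaussianReal_map_const_add v, lintegral_map hG (measurable_const_add v)]
    simp
  rw [hshift, gaussianReal_of_var_ne_zero v one_ne_zero,
    lintegral_withDensity_eq_lintegral_mul _ (measurable_gaussianPDF v 1) hG]
  refine lintegral_congr fun z => ?_
  rw [Pi.mul_apply, gaussianPDF, gaussianPDFReal_sub, zero_add]

/-! ### Resampling the noise at one time -/

/-- A state vector together with a noise vector. -/
abbrev Pair (n : ℕ) := (Fin n → ℝ) × (Fin n → ℝ)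

/-- The pair with its noise at time `i` replaced by `x`. -/
def resample {n : ℕ} (i : Fin n) (p : Pair n) (x : ℝ) : Pair n := (p.1, Function.update p.2 i x)

/-- Under `Q`, the noise at each time is standard normal and independent of everything else. It is
encoded as invariance of `Q` under resampling, the form in which it is used for conditioning. -/
def StdNormalNoise {n : ℕ} (Q : Measure (Pair n)) : Prop :=
  ∀ i, MeasurePreserving (fun q : Pair n × ℝ => resample i q.1 q.2) (Q.prod γ) Q

lemma measurePreserving_update_pi {ι : Type*} [Fintype ι] [DecidableEq ι] {X : ι → Type*}
    [∀ i, MeasurableSpace (X i)] (μ : ∀ i, Measure (X i)) [∀ i, IsProbabilityMeasure (μ i)]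
    (i : ι) :
    MeasurePreserving (fun q : (∀ j, X j) × X i => Function.update q.1 i q.2)
      ((Measure.pi μ).prod (μ i)) (Measure.pi μ) := by
  refine ⟨measurable_update', (Measure.pi_eq fun s hs => ?_).symm⟩
  have hpre : (fun q : (∀ j, X j) × X i => Function.update q.1 i q.2) ⁻¹' Set.univ.pi s
      = Set.univ.pi (Function.update s i Set.univ) ×ˢ s i := by
    ext q
    simp only [Set.mem_preimage, Set.mem_univ_pi, Set.mem_prod,
      Function.forall_update_iff q.1 fun j y => y ∈ s j,
      Function.forall_update_iff s fun j t => q.1 j ∈ t, Set.mem_univ, true_and, and_comm]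
  rw [Measure.map_apply measurable_update' (MeasurableSet.univ_pi hs), hpre, Measure.prod_prod,
    Measure.pi_pi, ← Finset.mul_prod_erase Finset.univ _ (Finset.mem_univ i),
    ← Finset.mul_prod_erase Finset.univ (fun j => μ j (s j)) (Finset.mem_univ i),
    Function.update_self, measure_univ, one_mul, mul_comm]
  congr 1
  exact Finset.prod_congr rfl fun j hj => by
    rw [Function.update_of_ne (Finset.ne_of_mem_erase hj)]

lemma stdNormalNoise_prod_pi {n : ℕ} (R : Measure (Fin n → ℝ)) [IsProbabilityMeasure R] :
    StdNormalNoise (R.prod (Measure.pi fun _ => γ)) := fun i =>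
  ((MeasurePreserving.id R).prod (measurePreserving_update_pi (fun _ => γ) i)).comp
    (measurePreserving_prodAssoc R (Measure.pi fun _ => γ) γ)

/-- The states and the noise at `ω`. -/
def pairOf {Ω : Type*} {n : ℕ} (μ ε : Fin n → Ω → ℝ) (ω : Ω) : Pair n :=
  (fun i => μ i ω, fun i => ε i ω)

lemma NoiseModel.measurable_pairOf {Ω : Type*} [MeasurableSpace Ω] {P : Measure Ω} {n : ℕ}
    {μ ε : Fin n → Ω → ℝ} (h : NoiseModel P μ ε) :
    Measurable (pairOf μ ε) :=
  (measurable_pi_lambda _ h.measurable_state).prodMk (measurable_pi_lambda _ h.measurable_noise)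

lemma NoiseModel.stdNormalNoise {Ω : Type*} [MeasurableSpace Ω] {P : Measure Ω}
    [IsProbabilityMeasure P] {n : ℕ} {μ ε : Fin n → Ω → ℝ} (h : NoiseModel P μ ε) :
    StdNormalNoise (P.map (pairOf μ ε)) := by
  have hε : Measurable fun ω => fun i => ε i ω := measurable_pi_lambda _ h.measurable_noise
  have hμ : Measurable fun ω => fun i => μ i ω := measurable_pi_lambda _ h.measurable_state
  have hprod := (indepFun_iff_map_prod_eq_prod_map_map hμ.aemeasurable hε.aemeasurable).1
    h.indep_state.symm
  have hpi := (iIndepFun_iff_map_fun_eq_pi_map fun i => (h.measurable_noise i).aemeasurable).1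
    h.iIndep_noise
  simp only [h.law_noise] at hpi
  have : IsProbabilityMeasure (P.map fun ω => fun i => μ i ω) :=
    Measure.isProbabilityMeasure_map hμ.aemeasurable
  unfold pairOf
  rw [hprod, hpi]
  exact stdNormalNoise_prod_pi _

section Resample

variable {n : ℕ} {Q : Measure (Pair n)}

lemma resample_noise_of_ne {i j : Fin n} (h : j ≠ i) (p : Pair n) (x : ℝ) :
    (resample i p x).2 j = p.2 j := by
  simp only [resample, Function.update_of_ne h]

lemma resample_noise_self (i : Fin n) (p : Pair n) (x : ℝ) : (resample i p x).2 i = x := by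
  simp only [resample, Function.update_self]

lemma StdNormalNoise.lintegral_eq (hQ : StdNormalNoise Q) (i : Fin n) {F : Pair n → ℝ≥0∞}
    (hF : Measurable F) : ∫⁻ p, F p ∂Q = ∫⁻ p, ∫⁻ x, F (resample i p x) ∂γ ∂Q := by
  rw [← (hQ i).lintegral_comp hF]
  exact lintegral_prod _ (hF.comp (hQ i).measurable).aemeasurable

variable [IsProbabilityMeasure Q]

lemma StdNormalNoise.integral_eq (hQ : StdNormalNoise Q) (i : Fin n) {F : Pair n → ℝ}
    (hi : Integrable F Q) :
    ∫ p, F p ∂Q = ∫ p, ∫ x, F (resample i p x) ∂γ ∂Q := by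
  have h : ∫ p, F p ∂Q = ∫ q : Pair n × ℝ, F (resample i q.1 q.2) ∂(Q.prod γ) := by
    conv_lhs => rw [← (hQ i).map_eq]
    refine integral_map (hQ i).aemeasurable ?_
    rw [(hQ i).map_eq]
    exact hi.aestronglyMeasurable
  rw [h]
  exact integral_prod _ ((hQ i).integrable_comp_of_integrable hi)

lemma StdNormalNoise.lintegral_noise (hQ : StdNormalNoise Q) (i : Fin n) {F : ℝ → ℝ≥0∞}
    (hF : Measurable F) : ∫⁻ p, F (p.2 i) ∂Q = ∫⁻ e, F e ∂γ := by
  have hFi : Measurable fun p : Pair n => F (p.2 i) := by fun_prop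
  rw [hQ.lintegral_eq i hFi]
  simp only [resample_noise_self, lintegral_const, measure_univ, mul_one]

/-- `D i` is centred given everything but the noise at time `i`, and does not involve later
noise. -/
structure NoiseDifference (s : Finset (Fin n)) (D : Fin n → Pair n → ℝ) : Prop where
  resample_of_lt : ∀ j ∈ s, ∀ k ∈ s, j < k → ∀ p x, D j (resample k p x) = D j p
  integral_resample : ∀ k ∈ s, ∀ p, ∫ x, D k (resample k p x) ∂γ = 0

lemma StdNormalNoise.integral_mul_eq_zero (hQ : StdNormalNoise Q) {s : Finset (Fin n)}
    {D : Fin n → Pair n → ℝ} (hD : NoiseDifference s D) (hL : ∀ k ∈ s, MemLp (D k) 2 Q)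
    {j k : Fin n} (hj : j ∈ s) (hk : k ∈ s) (hjk : j ≠ k) : ∫ p, D j p * D k p ∂Q = 0 := by
  wlog hlt : j < k generalizing j k
  · simp only [mul_comm (D j _)]
    exact this hk hj hjk.symm (lt_of_le_of_ne (not_lt.1 hlt) hjk.symm)
  have hint : Integrable (fun p => D j p * D k p) Q := (hL j hj).integrable_mul (hL k hk)
  rw [hQ.integral_eq k hint]
  simp only [hD.resample_of_lt j hj k hk hlt, integral_const_mul,
    hD.integral_resample k hk, mul_zero, integral_zero]

lemma memLp_two_of_lintegral_sq_lt_top {α : Type*} [MeasurableSpace α] {μ : Measure α}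
    {f : α → ℝ} (hf : Measurable f) (h : ∫⁻ a, ENNReal.ofReal (f a ^ 2) ∂μ < ∞) :
    MemLp f 2 μ := by
  refine (memLp_two_iff_integrable_sq hf.aestronglyMeasurable).2 ⟨by fun_prop, ?_⟩
  rwa [hasFiniteIntegral_iff_ofReal (ae_of_all _ fun a => sq_nonneg (f a))]

lemma StdNormalNoise.lintegral_sq_sum_le (hQ : StdNormalNoise Q) {s : Finset (Fin n)}
    {D : Fin n → Pair n → ℝ} (hm : ∀ k ∈ s, Measurable (D k)) (hD : NoiseDifference s D) {c : ℝ}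
    (hc : ∀ k ∈ s, ∫⁻ p, ENNReal.ofReal (D k p ^ 2) ∂Q ≤ ENNReal.ofReal c) :
    ∫⁻ p, ENNReal.ofReal ((∑ k ∈ s, D k p) ^ 2) ∂Q ≤ ENNReal.ofReal (s.card * c) := by
  have hL : ∀ k ∈ s, MemLp (D k) 2 Q := fun k hk =>
    memLp_two_of_lintegral_sq_lt_top (hm k hk) ((hc k hk).trans_lt ENNReal.ofReal_lt_top)
  have hint : ∀ j ∈ s, ∀ k ∈ s, Integrable (fun p => D j p * D k p) Q := fun j hj k hk =>
    (hL j hj).integrable_mul (hL k hk)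
  have hdiag : ∫ p, (∑ k ∈ s, D k p) ^ 2 ∂Q = ∑ k ∈ s, ∫ p, D k p ^ 2 ∂Q := by
    simp only [sq, Finset.sum_mul_sum]
    rw [integral_finsetSum _ fun j hj => integrable_finsetSum _ fun k hk => hint j hj k hk]
    refine Finset.sum_congr rfl fun j hj => ?_
    rw [integral_finsetSum _ fun k hk => hint j hj k hk]
    exact Finset.sum_eq_single_of_mem j hj fun k hk hkj =>
      hQ.integral_mul_eq_zero hD hL hj hk hkj.symm
  have hsq : ∀ {f : Pair n → ℝ}, MemLp f 2 Q →
      ∫⁻ p, ENNReal.ofReal (f p ^ 2) ∂Q = ENNReal.ofReal (∫ p, f p ^ 2 ∂Q) := fun hf =>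
    (ofReal_integral_eq_lintegral_ofReal hf.integrable_sq (ae_of_all _ fun p => sq_nonneg _)).symm
  rw [hsq (memLp_finsetSum s hL), hdiag,
    ENNReal.ofReal_sum_of_nonneg fun k _ => integral_nonneg fun p => sq_nonneg (D k p),
    ENNReal.ofReal_mul (Nat.cast_nonneg _), ENNReal.ofReal_natCast, ← nsmul_eq_mul]
  exact Finset.sum_le_card_nsmul _ _ _ fun k hk => hsq (hL k hk) ▸ hc k hk

end Resample

/-! ### Centred states as functions of a pair -/

/-- The data vector of a pair. -/
def pairObs {n : ℕ} (p : Pair n) : Fin n → ℝ := fun i => p.1 i + p.2 i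

/-- The centred states of a pair, for the predictor `m`. -/
def pairCentred {n : ℕ} (m : Fin n → (Fin n → ℝ) → ℝ) (p : Pair n) : Fin n → ℝ :=
  fun i => p.1 i - m i (pairObs p)

lemma obs_eq_pairObs {Ω : Type*} {n : ℕ} (μ ε : Fin n → Ω → ℝ) (ω : Ω) :
    obs μ ε ω = pairObs (pairOf μ ε ω) := rfl

section Centred

variable {n : ℕ} {m : Fin n → (Fin n → ℝ) → ℝ}

lemma measurable_pairObs : Measurable (pairObs : Pair n → Fin n → ℝ) := by
  unfold pairObs; fun_prop

lemma NoiseModel.measurable_obs {Ω : Type*} [MeasurableSpace Ω] {P : Measure Ω}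
    {μ ε : Fin n → Ω → ℝ} (h : NoiseModel P μ ε) : Measurable (obs μ ε) :=
  measurable_pairObs.comp h.measurable_pairOf

lemma measurable_pairCentred (hm : ∀ i, Measurable (m i)) : Measurable (pairCentred m) :=
  measurable_pi_lambda _ fun i => ((measurable_pi_apply i).comp measurable_fst).sub
    ((hm i).comp measurable_pairObs)

lemma measurable_pairCentred_apply (hm : ∀ i, Measurable (m i)) (i : Fin n) :
    Measurable fun p => pairCentred m p i :=
  (measurable_pi_apply i).comp (measurable_pairCentred hm)

lemma measurable_pairResid (hm : ∀ i, Measurable (m i)) :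
    Measurable fun p : Pair n => pairCentred m p + p.2 :=
  (measurable_pairCentred hm).add measurable_snd

lemma measurable_pairResid_apply (hm : ∀ i, Measurable (m i)) (i : Fin n) :
    Measurable fun p : Pair n => pairCentred m p i + p.2 i :=
  (measurable_pi_apply i).comp (measurable_pairResid hm)

lemma resid_pairObs (p : Pair n) : resid m (pairObs p) = pairCentred m p + p.2 := by
  funext i
  simp only [resid, pairCentred, pairObs, Pi.add_apply]
  ring

lemma pairCentred_resample (hdep : ∀ i, DependsOn (m i) (Set.Iio i)) {i j : Fin n} (h : j ≤ i)
    (p : Pair n) (x : ℝ) : pairCentred m (resample i p x) j = pairCentred m p j := by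
  simp only [pairCentred]
  congr 1
  refine hdep j fun k hk => ?_
  simp only [pairObs, resample_noise_of_ne ((Set.mem_Iio.1 hk).trans_le h).ne]
  rfl

variable {Q : Measure (Pair n)}

lemma StdNormalNoise.lintegral_resid_eq (hQ : StdNormalNoise Q) (hm : ∀ i, Measurable (m i))
    (hdep : ∀ i, DependsOn (m i) (Set.Iio i)) (i : Fin n) {H : Pair n → ℝ → ℝ≥0∞}
    (hH : Measurable (Function.uncurry H)) (hHi : ∀ p x, H (resample i p x) = H p) :
    ∫⁻ p, H p (pairCentred m p i + p.2 i) ∂Q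
      = ∫⁻ p, (∫⁻ z, ENNReal.ofReal (φ (z - pairCentred m p i)) * H p z) ∂Q := by
  have hmeas : Measurable fun p : Pair n => H p (pairCentred m p i + p.2 i) :=
    hH.comp (measurable_id.prodMk (measurable_pairResid_apply hm i))
  rw [hQ.lintegral_eq i hmeas]
  refine lintegral_congr fun p => ?_
  simp only [hHi, pairCentred_resample hdep le_rfl, resample_noise_self]
  exact lintegral_stdNormal_add (hH.comp measurable_prodMk_left) _

end Centred

/-! ### Predictable events for the residuals -/

section PredictableEvents

variable {n : ℕ} {m : Fin n → (Fin n → ℝ) → ℝ} {Q : Measure (Pair n)} [IsProbabilityMeasure Q]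

lemma StdNormalNoise.measure_resid_mem_eq (hQ : StdNormalNoise Q) (hm : ∀ i, Measurable (m i))
    (hdep : ∀ i, DependsOn (m i) (Set.Iio i)) (i : Fin n) {S : Pair n → Set ℝ}
    (hS : MeasurableSet {q : Pair n × ℝ | q.2 ∈ S q.1}) (hSi : ∀ p x, S (resample i p x) = S p)
    (L : ℝ) :
    Q {p | |pairCentred m p i + p.2 i| ≤ L ∧ pairCentred m p i + p.2 i ∈ S p}
      = ∫⁻ z in Set.Icc (-L) L,
          (∫⁻ p, (S p).indicator (fun z => ENNReal.ofReal (φ (z - pairCentred m p i))) z ∂Q) := by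
  set T : Set (Pair n × ℝ) := {q | q.2 ∈ Set.Icc (-L) L ∧ q.2 ∈ S q.1}
  have hTm : MeasurableSet T := (measurable_snd measurableSet_Icc).inter hS
  have hφ : Measurable fun q : Pair n × ℝ => ENNReal.ofReal (φ (q.2 - pairCentred m q.1 i)) :=
    ((measurable_gaussianPDFReal 0 1).comp (measurable_snd.sub
      ((measurable_pairCentred_apply hm i).comp measurable_fst))).ennreal_ofReal
  classical
  have hpair : Measurable fun p : Pair n => (p, pairCentred m p i + p.2 i) :=
    measurable_id.prodMk (measurable_pairResid_apply hm i)
  have hevent : {p | |pairCentred m p i + p.2 i| ≤ L ∧ pairCentred m p i + p.2 i ∈ S p}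
      = (fun p => (p, pairCentred m p i + p.2 i)) ⁻¹' T := by
    simp only [abs_le]
    rfl
  rw [hevent, ← lintegral_indicator_one (hpair hTm), ← lintegral_lintegral_swap]
  · refine (hQ.lintegral_resid_eq hm hdep i
      (H := fun p => (Set.Icc (-L) L ∩ S p).indicator 1) (measurable_one.indicator hTm)
      fun p x => by rw [hSi]).trans (lintegral_congr fun p => ?_)
    rw [← lintegral_indicator measurableSet_Icc]
    refine lintegral_congr fun z => ?_
    simp only [Set.indicator_apply, Set.mem_inter_iff, ite_and, Pi.one_apply, mul_ite, mul_one,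
      mul_zero]
  · exact (hφ.indicator hS).aemeasurable

lemma sum_stdPDF_small_le (ν : Fin n → ℝ) (z : ℝ) {θ : ℝ} (hθ : 0 ≤ θ) :
    ∑ i with mixDensity (Finset.Iic i) ν z < θ, φ (z - ν i) ≤ n * θ := by
  set S := Finset.univ.filter fun i => mixDensity (Finset.Iic i) ν z < θ
  rcases S.eq_empty_or_nonempty with h | h
  · rw [h, Finset.sum_empty]
    positivity
  -- All the terms come before the last time `k` at which the mixture density is small.
  set k := S.max' h
  have hk : mixDensity (Finset.Iic k) ν z < θ := (Finset.mem_filter.1 (S.max'_mem h)).2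
  have hcard : ((Finset.Iic k).card : ℝ) ≤ n := by
    exact_mod_cast (Finset.card_le_univ _).trans (Fintype.card_fin n).le
  have hpos : ((Finset.Iic k).card : ℝ) ≠ 0 := by
    exact_mod_cast Finset.card_ne_zero_of_mem (Finset.mem_Iic.2 le_rfl)
  calc ∑ i ∈ S, φ (z - ν i) ≤ ∑ i ∈ Finset.Iic k, φ (z - ν i) :=
        Finset.sum_le_sum_of_subset_of_nonneg
          (fun i hi => Finset.mem_Iic.2 (S.le_max' i hi)) fun i _ _ => (stdPDF_pos _).le
    _ = (Finset.Iic k).card * mixDensity (Finset.Iic k) ν z := by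
        rw [mixDensity, mul_inv_cancel_left₀ hpos]
    _ ≤ n * θ := mul_le_mul hcard hk.le (mixDensity_pos ⟨k, Finset.mem_Iic.2 le_rfl⟩ ν z).le
        (Nat.cast_nonneg n)

lemma measurable_mixDensity_pair (hm : ∀ i, Measurable (m i)) (s : Finset (Fin n)) :
    Measurable fun q : Pair n × ℝ => mixDensity s (pairCentred m q.1) q.2 := by
  unfold mixDensity
  exact measurable_const.mul (Finset.measurable_fun_sum s fun j _ =>
    (measurable_gaussianPDFReal 0 1).comp (measurable_snd.sub
      ((measurable_pairCentred_apply hm j).comp measurable_fst)))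

lemma mixDensity_resample (hdep : ∀ i, DependsOn (m i) (Set.Iio i)) (i : Fin n) (p : Pair n)
    (x z : ℝ) : mixDensity (Finset.Iic i) (pairCentred m (resample i p x)) z
      = mixDensity (Finset.Iic i) (pairCentred m p) z := by
  unfold mixDensity
  congr 1
  exact Finset.sum_congr rfl fun j hj => by
    rw [pairCentred_resample hdep (Finset.mem_Iic.1 hj)]

lemma StdNormalNoise.sum_measure_small_density_le (hQ : StdNormalNoise Q)
    (hm : ∀ i, Measurable (m i)) (hdep : ∀ i, DependsOn (m i) (Set.Iio i)) {L θ : ℝ}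
    (hθ : 0 ≤ θ) :
    ∑ i, Q {p | |pairCentred m p i + p.2 i| ≤ L ∧
        mixDensity (Finset.Iic i) (pairCentred m p) (pairCentred m p i + p.2 i) < θ}
      ≤ ENNReal.ofReal (2 * L * (n * θ)) := by
  set S : Fin n → Pair n → Set ℝ := fun i p =>
    {z | mixDensity (Finset.Iic i) (pairCentred m p) z < θ} with hSdef
  have hS : ∀ i, MeasurableSet {q : Pair n × ℝ | q.2 ∈ S i q.1} := fun i =>
    measurableSet_lt (measurable_mixDensity_pair hm _) measurable_const
  have hφ : ∀ i, Measurable fun q : ℝ × Pair n =>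
      (S i q.2).indicator (fun z => ENNReal.ofReal (φ (z - pairCentred m q.2 i))) q.1 := fun i =>
    (((measurable_gaussianPDFReal 0 1).comp (measurable_fst.sub
      ((measurable_pairCentred_apply hm i).comp measurable_snd))).ennreal_ofReal).indicator
        (measurable_swap (hS i))
  have hsum : ∀ z p,
      ∑ i, (S i p).indicator (fun z => ENNReal.ofReal (φ (z - pairCentred m p i))) z
        ≤ ENNReal.ofReal (n * θ) := fun z p => by
    refine le_of_eq_of_le ?_ (ENNReal.ofReal_le_ofReal (sum_stdPDF_small_le (pairCentred m p) z hθ))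
    rw [ENNReal.ofReal_sum_of_nonneg fun i _ => (stdPDF_pos _).le, Finset.sum_filter]
    rfl
  have heq := fun i => hQ.measure_resid_mem_eq hm hdep i (S := S i) (hS i)
    (fun p x => Set.ext fun z => by
      simp only [hSdef, Set.mem_ofPred_eq, mixDensity_resample hdep]) L
  calc _ = ∑ i, ∫⁻ z in Set.Icc (-L) L, (∫⁻ p, (S i p).indicator
          (fun z => ENNReal.ofReal (φ (z - pairCentred m p i))) z ∂Q) :=
        Finset.sum_congr rfl fun i _ => heq i
    _ = ∫⁻ z in Set.Icc (-L) L, (∫⁻ p, ∑ i, (S i p).indicator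
          (fun z => ENNReal.ofReal (φ (z - pairCentred m p i))) z ∂Q) := by
        rw [← lintegral_finsetSum _ fun i _ => (hφ i).lintegral_prod_right']
        exact lintegral_congr fun z => (lintegral_finsetSum _ fun i _ =>
          (hφ i).comp measurable_prodMk_left).symm
    _ ≤ ∫⁻ _ in Set.Icc (-L) L, (∫⁻ _, ENNReal.ofReal (n * θ) ∂Q) :=
        lintegral_mono fun z => lintegral_mono fun p => hsum z p
    _ = ENNReal.ofReal (2 * L * (n * θ)) := by
        simp only [lintegral_const, measure_univ, mul_one, MeasurableSet.univ,
          Measure.restrict_apply, Set.univ_inter, Real.volume_Icc]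
        rw [← ENNReal.ofReal_mul (by positivity)]
        ring_nf

/-! ### Kernel averages are close to their conditional means -/

lemma measurable_kernelNoise_pair (hm : ∀ i, Measurable (m i)) {g : ℝ → ℝ} (hg : Measurable g)
    (s : Finset (Fin n)) :
    Measurable fun q : Pair n × ℝ =>
      kernelNoise g s (pairCentred m q.1) (pairCentred m q.1 + q.1.2) q.2 := by
  have hsmooth : Measurable fun u : ℝ => ∫ e, g (u + e) ∂γ :=
    (hg.comp (measurable_fst.add measurable_snd)).stronglyMeasurable.integral_prod_right'.measurable
  simp only [kernelNoise, Finset.expect_eq_sum_div_card, add_sub_right_comm _ _ (_ : ℝ)]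
  refine (Finset.measurable_fun_sum _ fun j _ => ?_).div_const _
  have hν : Measurable fun q : Pair n × ℝ => pairCentred m q.1 j :=
    (measurable_pairCentred_apply hm j).comp measurable_fst
  exact (hg.comp (((measurable_pairResid_apply hm j).comp measurable_fst).sub measurable_snd)).sub
    (hsmooth.comp (hν.sub measurable_snd))

lemma kernelNoise_resample (hdep : ∀ i, DependsOn (m i) (Set.Iio i)) (g : ℝ → ℝ) (i : Fin n)
    (p : Pair n) (x z : ℝ) :
    kernelNoise g (Finset.Iio i) (pairCentred m (resample i p x))
        (pairCentred m (resample i p x) + (resample i p x).2) z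
      = kernelNoise g (Finset.Iio i) (pairCentred m p) (pairCentred m p + p.2) z := by
  unfold kernelNoise
  refine Finset.expect_congr rfl fun j hj => ?_
  have hji := Finset.mem_Iio.1 hj
  simp only [Pi.add_apply, pairCentred_resample hdep hji.le, resample_noise_of_ne hji.ne]

lemma StdNormalNoise.lintegral_kernelNoise_sq_le (hQ : StdNormalNoise Q)
    (hm : ∀ i, Measurable (m i)) (hdep : ∀ i, DependsOn (m i) (Set.Iio i)) {g : ℝ → ℝ}
    (hg : Measurable g) {B : ℝ} (hB : ∀ t, |g t| ≤ B) (s : Finset (Fin n)) (z : ℝ) :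
    ∫⁻ p, ENNReal.ofReal (kernelNoise g s (pairCentred m p) (pairCentred m p + p.2) z ^ 2) ∂Q
      ≤ ENNReal.ofReal (4 * B ^ 2 * (s.card : ℝ)⁻¹) := by
  set D : Fin n → Pair n → ℝ := fun j p =>
    g (pairCentred m p j + p.2 j - z) - ∫ e, g (pairCentred m p j + e - z) ∂γ with hD
  have hint : ∀ v, Integrable (fun e => g (v + e - z)) γ := fun v =>
    Integrable.of_bound (hg.comp (by fun_prop)).aestronglyMeasurable B (ae_of_all _ fun e => hB _)
  have hDm : ∀ j, Measurable (D j) := fun j => by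
    have h := (measurable_kernelNoise_pair hm hg {j}).comp (measurable_prodMk_right (y := z))
    simpa only [kernelNoise, Finset.expect_singleton, Function.comp_def, hD, Pi.add_apply] using h
  have hdiff : NoiseDifference s D :=
    { resample_of_lt := fun j _ k _ hjk p x => by
        simp only [hD, pairCentred_resample hdep hjk.le, resample_noise_of_ne hjk.ne]
      integral_resample := fun k _ p => by
        simp only [hD, pairCentred_resample hdep le_rfl, resample_noise_self]
        rw [integral_sub (hint _) (integrable_const _)]
        simp }
  have hDb : ∀ j p, D j p ^ 2 ≤ 4 * B ^ 2 := fun j p => by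
    have hmean : |∫ e, g (pairCentred m p j + e - z) ∂γ| ≤ B := by
      simpa using norm_integral_le_of_norm_le_const (μ := γ)
        (f := fun e => g (pairCentred m p j + e - z)) (ae_of_all γ fun e => hB _)
    have hDj : |D j p| ≤ 2 * B :=
      (abs_sub _ _).trans (by linarith [hB (pairCentred m p j + p.2 j - z)])
    rw [← sq_abs, show 4 * B ^ 2 = (2 * B) ^ 2 by ring]
    gcongr
  have hsum := hQ.lintegral_sq_sum_le (fun k _ => hDm k) hdiff (c := 4 * B ^ 2) fun k _ =>
    (lintegral_mono fun p => ENNReal.ofReal_le_ofReal (hDb k p)).trans_eq (by simp)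
  have hcard : ((s.card : ℝ)⁻¹ ^ 2) * (s.card * (4 * B ^ 2)) = 4 * B ^ 2 * (s.card : ℝ)⁻¹ := by
    rcases eq_or_ne (s.card : ℝ) 0 with h0 | h0
    · simp [h0]
    · field_simp
  have heq : ∀ p, kernelNoise g s (pairCentred m p) (pairCentred m p + p.2) z ^ 2
      = (s.card : ℝ)⁻¹ ^ 2 * (∑ k ∈ s, D k p) ^ 2 := fun p => by
    rw [kernelNoise, Finset.expect_eq_sum_div_card, div_eq_inv_mul, mul_pow]
    rfl
  simp only [heq, ENNReal.ofReal_mul (sq_nonneg (s.card : ℝ)⁻¹)]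
  rw [lintegral_const_mul' _ _ ENNReal.ofReal_ne_top, ← hcard, ENNReal.ofReal_mul (by positivity)]
  gcongr

lemma StdNormalNoise.measure_kernelNoise_large_le (hQ : StdNormalNoise Q)
    (hm : ∀ i, Measurable (m i)) (hdep : ∀ i, DependsOn (m i) (Set.Iio i)) {g : ℝ → ℝ}
    (hg : Measurable g) {B : ℝ} (hB : ∀ t, |g t| ≤ B) (i : Fin n) {L η : ℝ} (hη : 0 < η) :
    Q {p | |pairCentred m p i + p.2 i| ≤ L ∧ η < |kernelNoise g (Finset.Iio i) (pairCentred m p)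
        (pairCentred m p + p.2) (pairCentred m p i + p.2 i)|}
      ≤ ENNReal.ofReal (2 * L * (4 * B ^ 2 * ((Finset.Iio i).card : ℝ)⁻¹ / η ^ 2)) := by
  set N : Pair n → ℝ → ℝ := fun p =>
    kernelNoise g (Finset.Iio i) (pairCentred m p) (pairCentred m p + p.2) with hN
  have hNm : Measurable fun q : Pair n × ℝ => N q.1 q.2 := measurable_kernelNoise_pair hm hg _
  set S : Pair n → Set ℝ := fun p => {z | η < |N p z|} with hSdef
  have hS : MeasurableSet {q : Pair n × ℝ | q.2 ∈ S q.1} :=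
    measurableSet_lt measurable_const hNm.abs
  have hchebyshev : ∀ z, ∫⁻ p, (S p).indicator
      (fun z => ENNReal.ofReal (φ (z - pairCentred m p i))) z ∂Q
        ≤ ENNReal.ofReal (4 * B ^ 2 * ((Finset.Iio i).card : ℝ)⁻¹ / η ^ 2) := fun z => by
    rw [div_eq_inv_mul, ENNReal.ofReal_mul (by positivity)]
    refine le_trans ?_ (mul_le_mul_right
      (hQ.lintegral_kernelNoise_sq_le hm hdep hg hB (Finset.Iio i) z) _)
    rw [← lintegral_const_mul' _ _ ENNReal.ofReal_ne_top]
    refine lintegral_mono fun p => Set.indicator_apply_le' (fun hz => ?_) fun _ => zero_le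
    rw [← ENNReal.ofReal_mul (by positivity)]
    refine ENNReal.ofReal_le_ofReal ((stdPDF_le_one _).trans ?_)
    rw [← div_eq_inv_mul, one_le_div (by positivity), ← sq_abs (kernelNoise _ _ _ _ z)]
    exact pow_le_pow_left₀ hη.le (le_of_lt hz) 2
  calc _ = ∫⁻ z in Set.Icc (-L) L, (∫⁻ p, (S p).indicator
          (fun z => ENNReal.ofReal (φ (z - pairCentred m p i))) z ∂Q) :=
        hQ.measure_resid_mem_eq hm hdep i hS (fun p x => Set.ext fun z => by
          simp only [hSdef, hN, Set.mem_ofPred_eq, kernelNoise_resample hdep]) L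
    _ ≤ ∫⁻ _ in Set.Icc (-L) L,
          ENNReal.ofReal (4 * B ^ 2 * ((Finset.Iio i).card : ℝ)⁻¹ / η ^ 2) :=
        lintegral_mono hchebyshev
    _ = _ := by
        rw [setLIntegral_const, Real.volume_Icc, ← ENNReal.ofReal_mul (by positivity)]
        ring_nf

end PredictableEvents

/-! ### The excess risk of the estimator over the oracle -/

/-- The event that the residual at time `i` is large or is not well estimated from the past. -/
def badEvent {n : ℕ} (m : Fin n → (Fin n → ℝ) → ℝ) (τ : ℝ) (i : Fin n) : Set (Pair n) :=
  {p | (τ ^ 4)⁻¹ < |pairCentred m p i + p.2 i| ∨ ¬ WellEstimated τ (Finset.Iio i) i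
    (pairCentred m p) (pairCentred m p + p.2) (pairCentred m p i + p.2 i)}

/-- The event that the residual at time `i` is not large, but the kernel average of `g` over the
past residuals deviates there by more than `τ ^ 19` from its mean. -/
def noisyEvent {n : ℕ} (m : Fin n → (Fin n → ℝ) → ℝ) (g : ℝ → ℝ) (τ : ℝ) (i : Fin n) :
    Set (Pair n) :=
  {p | |pairCentred m p i + p.2 i| ≤ (τ ^ 4)⁻¹ ∧ τ ^ 19 < |kernelNoise g (Finset.Iio i)
    (pairCentred m p) (pairCentred m p + p.2) (pairCentred m p i + p.2 i)|}

/-- The event that the residual at time `i` is not large, but falls where the oracle density is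
tiny. -/
def sparseEvent {n : ℕ} (m : Fin n → (Fin n → ℝ) → ℝ) (τ : ℝ) (i : Fin n) : Set (Pair n) :=
  {p | |pairCentred m p i + p.2 i| ≤ (τ ^ 4)⁻¹ ∧
    mixDensity (Finset.Iic i) (pairCentred m p) (pairCentred m p i + p.2 i) < τ ^ 16}

section BadEvent

variable {n : ℕ} {m : Fin n → (Fin n → ℝ) → ℝ} {τ : ℝ} {Q : Measure (Pair n)}

lemma badEvent_eq (i : Fin n) : badEvent m τ i =
    {p | (τ ^ 4)⁻¹ < |pairCentred m p i + p.2 i|} ∪ ({_p | τ ^ 80 * (i : ℕ) < 1} ∪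
      (sparseEvent m τ i ∪ (noisyEvent m (kernScaled (τ ^ 4)) τ i ∪
        noisyEvent m (kernScaledDeriv (τ ^ 4)) τ i))) := by
  ext p
  have hiff : ∀ ν Z : Fin n → ℝ, ∀ z, WellEstimated τ (Finset.Iio i) i ν Z z ↔
      1 ≤ τ ^ 80 * (i : ℕ) ∧ τ ^ 16 ≤ mixDensity (Finset.Iic i) ν z ∧
      |kernelNoise (kernScaled (τ ^ 4)) (Finset.Iio i) ν Z z| ≤ τ ^ 19 ∧
      |kernelNoise (kernScaledDeriv (τ ^ 4)) (Finset.Iio i) ν Z z| ≤ τ ^ 19 := fun ν Z z => by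
    rw [← Fin.card_Iio i, ← Finset.Iio_insert i]
    exact ⟨fun h => ⟨h.1, h.2, h.3, h.4⟩, fun h => ⟨h.1, h.2.1, h.2.2.1, h.2.2.2⟩⟩
  simp only [badEvent, sparseEvent, noisyEvent, hiff, Set.mem_union, Set.mem_ofPred_eq, not_and_or,
    not_le]
  rcases lt_or_ge (τ ^ 4)⁻¹ |pairCentred m p i + p.2 i| with h | h
  · simp only [h, true_or]
  · simp only [h, not_lt_of_ge h, true_and, false_or]

lemma measurableSet_noisyEvent (hm : ∀ i, Measurable (m i)) {g : ℝ → ℝ} (hg : Measurable g)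
    (i : Fin n) : MeasurableSet (noisyEvent m g τ i) :=
  (measurableSet_le (measurable_pairResid_apply hm i).abs measurable_const).inter
    (measurableSet_lt measurable_const ((measurable_kernelNoise_pair hm hg _).comp
      (measurable_id.prodMk (measurable_pairResid_apply hm i))).abs)

lemma measurableSet_sparseEvent (hm : ∀ i, Measurable (m i)) (i : Fin n) :
    MeasurableSet (sparseEvent m τ i) :=
  (measurableSet_le (measurable_pairResid_apply hm i).abs measurable_const).inter
    (measurableSet_lt ((measurable_mixDensity_pair hm _).comp
      (measurable_id.prodMk (measurable_pairResid_apply hm i))) measurable_const)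

lemma measurableSet_badEvent (hm : ∀ i, Measurable (m i)) (i : Fin n) :
    MeasurableSet (badEvent m τ i) := by
  rw [badEvent_eq]
  exact (measurableSet_lt measurable_const (measurable_pairResid_apply hm i).abs).union
    ((MeasurableSet.const _).union ((measurableSet_sparseEvent hm i).union
      ((measurableSet_noisyEvent hm (continuous_kernScaled _).measurable i).union
        (measurableSet_noisyEvent hm (continuous_kernScaledDeriv _).measurable i))))

variable [IsProbabilityMeasure Q]

lemma StdNormalNoise.measure_noisyEvent_le (hQ : StdNormalNoise Q) (hm : ∀ i, Measurable (m i))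
    (hdep : ∀ i, DependsOn (m i) (Set.Iio i)) (hτ : 0 < τ) {g : ℝ → ℝ} (hg : Measurable g)
    (hB : ∀ t, |g t| ≤ (τ ^ 8)⁻¹) {i : Fin n} (hi : 1 ≤ τ ^ 80 * (i : ℕ)) :
    Q (noisyEvent m g τ i) ≤ ENNReal.ofReal (8 * τ ^ 22) := by
  have hi0 : 0 < ((i : ℕ) : ℝ) := by
    have := pow_pos hτ 80
    nlinarith
  refine (hQ.measure_kernelNoise_large_le hm hdep hg hB i (pow_pos hτ 19)).trans
    (ENNReal.ofReal_le_ofReal ?_)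
  rw [Fin.card_Iio]
  calc 2 * (τ ^ 4)⁻¹ * (4 * (τ ^ 8)⁻¹ ^ 2 * ((i : ℕ) : ℝ)⁻¹ / (τ ^ 19) ^ 2)
      ≤ 2 * (τ ^ 4)⁻¹ * (4 * (τ ^ 8)⁻¹ ^ 2 * τ ^ 80 / (τ ^ 19) ^ 2) := by
        gcongr
        rwa [inv_le_iff_one_le_mul₀ hi0]
    _ = 8 * τ ^ 22 := by field_simp; norm_num

lemma card_filter_val_lt_le (n : ℕ) {a : ℝ} (ha : 0 ≤ a) :
    (Finset.card {i : Fin n | ((i : ℕ) : ℝ) < a} : ℝ) ≤ a + 1 := by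
  have hcard : Finset.card {i : Fin n | ((i : ℕ) : ℝ) < a} ≤ ⌈a⌉₊ := by
    rw [← Finset.card_range ⌈a⌉₊]
    refine Finset.card_le_card_of_injOn (fun i => (i : ℕ)) (fun i hi => ?_)
      fun i _ j _ h => Fin.ext h
    exact Finset.mem_coe.2 (Finset.mem_range.2 (Nat.lt_ceil.2 (Finset.mem_filter.1 hi).2))
  exact (Nat.cast_le.2 hcard).trans (Nat.ceil_lt_add_one ha).le

lemma StdNormalNoise.measure_badEvent_le (hQ : StdNormalNoise Q) (hm : ∀ i, Measurable (m i))
    (hdep : ∀ i, DependsOn (m i) (Set.Iio i)) (hτ : 0 < τ) (hτ1 : τ ≤ 1) (i : Fin n) :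
    Q (badEvent m τ i) ≤ Q {p | (τ ^ 4)⁻¹ < |pairCentred m p i + p.2 i|} +
      Q (sparseEvent m τ i) + ENNReal.ofReal (16 * τ ^ 22) +
      if ((i : ℕ) : ℝ) < (τ ^ 80)⁻¹ then 1 else 0 := by
  split_ifs with h
  · exact prob_le_one.trans le_add_self
  have hi : 1 ≤ τ ^ 80 * (i : ℕ) := (inv_le_iff_one_le_mul₀' (pow_pos hτ 80)).1 (not_lt.1 h)
  have hkern := hQ.measure_noisyEvent_le hm hdep hτ (continuous_kernScaled _).measurable
    (fun t => (abs_kernScaled_le (pow_pos hτ 4) t).trans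
      (inv_anti₀ (by positivity) (pow_le_pow_of_le_one hτ.le hτ1 (by norm_num)))) hi
  have hkern' := hQ.measure_noisyEvent_le hm hdep hτ (continuous_kernScaledDeriv _).measurable
    (fun t => (abs_kernScaledDeriv_le_inv_sq (pow_pos hτ 4) t).trans_eq
      (by rw [inv_pow, ← pow_mul])) hi
  rw [badEvent_eq, add_zero, show 16 * τ ^ 22 = 8 * τ ^ 22 + 8 * τ ^ 22 by ring,
    ENNReal.ofReal_add (by positivity) (by positivity)]
  calc _ ≤ Q {p | (τ ^ 4)⁻¹ < |pairCentred m p i + p.2 i|} + (0 + (Q (sparseEvent m τ i) +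
        (Q (noisyEvent m (kernScaled (τ ^ 4)) τ i) +
          Q (noisyEvent m (kernScaledDeriv (τ ^ 4)) τ i)))) := by
        refine (measure_union_le _ _).trans ?_
        gcongr
        refine (measure_union_le _ _).trans ?_
        gcongr
        · simp [not_lt.2 hi]
        exact (measure_union_le _ _).trans (by gcongr; exact measure_union_le _ _)
    _ ≤ _ := by
        rw [zero_add, add_assoc]
        gcongr

lemma StdNormalNoise.sum_measure_badEvent_le (hQ : StdNormalNoise Q) (hm : ∀ i, Measurable (m i))
    (hdep : ∀ i, DependsOn (m i) (Set.Iio i)) (hτ : 0 < τ) (hτ1 : τ ≤ 1)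
    (htail : ∑ i, Q {p | (τ ^ 4)⁻¹ < |pairCentred m p i + p.2 i|} ≤ ENNReal.ofReal (n * τ ^ 32)) :
    ∑ i, Q (badEvent m τ i) ≤ ENNReal.ofReal (19 * n * τ ^ 9 + 2 * (τ ^ 80)⁻¹) := by
  have hsparse : ∑ i, Q (sparseEvent m τ i) ≤ ENNReal.ofReal (2 * (τ ^ 4)⁻¹ * (n * τ ^ 16)) :=
    hQ.sum_measure_small_density_le hm hdep (by positivity)
  have hearly : (∑ i : Fin n, if ((i : ℕ) : ℝ) < (τ ^ 80)⁻¹ then (1 : ℝ≥0∞) else 0)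
      ≤ ENNReal.ofReal ((τ ^ 80)⁻¹ + 1) := by
    rw [Finset.sum_boole, ← ENNReal.ofReal_natCast]
    exact ENNReal.ofReal_le_ofReal (card_filter_val_lt_le n (by positivity))
  have hone : 1 ≤ (τ ^ 80)⁻¹ := (one_le_inv₀ (by positivity)).2 (pow_le_one₀ hτ.le hτ1)
  have hconst : ∑ _ : Fin n, ENNReal.ofReal (16 * τ ^ 22)
      = ENNReal.ofReal (n * (16 * τ ^ 22)) := by
    rw [Finset.sum_const, Finset.card_univ, Fintype.card_fin, nsmul_eq_mul,
      ENNReal.ofReal_mul (Nat.cast_nonneg n), ENNReal.ofReal_natCast]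
  calc ∑ i, Q (badEvent m τ i)
      ≤ ENNReal.ofReal (n * τ ^ 32) + ENNReal.ofReal (2 * (τ ^ 4)⁻¹ * (n * τ ^ 16)) +
          ENNReal.ofReal (n * (16 * τ ^ 22)) + ENNReal.ofReal ((τ ^ 80)⁻¹ + 1) := by
        refine (Finset.sum_le_sum fun i _ => hQ.measure_badEvent_le hm hdep hτ hτ1 i).trans ?_
        simp only [Finset.sum_add_distrib, hconst]
        gcongr
    _ = ENNReal.ofReal (n * τ ^ 32 + 2 * (n * τ ^ 12) + 16 * (n * τ ^ 22) + ((τ ^ 80)⁻¹ + 1)) := by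
        rw [← ENNReal.ofReal_add, ← ENNReal.ofReal_add, ← ENNReal.ofReal_add] <;> try positivity
        congr 1
        field_simp
    _ ≤ _ := by
        have h : ∀ k ≥ 9, n * τ ^ k ≤ n * τ ^ 9 := fun k hk => by
          gcongr ?_ * ?_
          exact pow_le_pow_of_le_one hτ.le hτ1 hk
        refine ENNReal.ofReal_le_ofReal ?_
        linarith [h 32 (by norm_num), h 12 (by norm_num), h 22 (by norm_num)]

end BadEvent

/-- A bound for the loss of the estimator in excess of that of the oracle at time `i`, with
bandwidth `τ ^ 4`. -/
noncomputable def excess {n : ℕ} (m : Fin n → (Fin n → ℝ) → ℝ) (C τ : ℝ) (i : Fin n)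
    (p : Pair n) : ℝ≥0∞ :=
  ENNReal.ofReal (C * τ) * (2 + ENNReal.ofReal (p.2 i ^ 2))
    + ENNReal.ofReal (9 * (τ ^ 8)⁻¹) * (badEvent m τ i).indicator 1 p
    + ENNReal.ofReal (τ ^ 8) * ENNReal.ofReal (p.2 i ^ 4)

lemma exists_estDecision_loss_le_excess : ∃ C : ℝ, 1 ≤ C ∧
    ∀ {n : ℕ} (m : Fin n → (Fin n → ℝ) → ℝ) {τ : ℝ}, 0 < τ → C * τ ≤ 1 →
    ∀ (i : Fin n) (p : Pair n),
    ENNReal.ofReal ((estDecision (τ ^ 4) (Finset.Iio i) (pairCentred m p + p.2)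
        (pairCentred m p i + p.2 i) - pairCentred m p i) ^ 2)
      ≤ ENNReal.ofReal ((oracleDecision (Finset.Iic i) (pairCentred m p)
        (pairCentred m p i + p.2 i) - pairCentred m p i) ^ 2) + excess m C τ i p := by
  obtain ⟨C, hC1, hC⟩ := exists_estDecision_loss_le
  refine ⟨C, hC1, fun {n} m τ hτ hCτ i p => ?_⟩
  by_cases hp : p ∈ badEvent m τ i
  · refine le_add_left ?_
    rw [excess, Set.indicator_of_mem hp, Pi.one_apply, mul_one,
      ← ENNReal.ofReal_mul (by positivity), add_assoc,
      ← ENNReal.ofReal_add (by positivity) (by positivity)]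
    exact le_add_left (ENNReal.ofReal_le_ofReal (estDecision_loss_le hτ _ _ _ _))
  · have hwell := not_not.1 (not_or.1 hp).2
    refine (ENNReal.ofReal_le_ofReal (hC Finset.notMem_Iio_self hτ hCτ hwell)).trans ?_
    rw [Finset.Iio_insert, ENNReal.ofReal_add (by positivity) (by positivity),
      ENNReal.ofReal_mul (by positivity), ENNReal.ofReal_add (by norm_num) (by positivity),
      ENNReal.ofReal_ofNat, excess, add_assoc]
    gcongr
    exact le_self_add

section Excess

variable {n : ℕ} {m : Fin n → (Fin n → ℝ) → ℝ} {C τ : ℝ} {Q : Measure (Pair n)}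
  [IsProbabilityMeasure Q]

lemma measurable_excess (hm : ∀ i, Measurable (m i)) (i : Fin n) : Measurable (excess m C τ i) := by
  have := (measurable_one (α := ℝ≥0∞)).indicator (measurableSet_badEvent (τ := τ) hm i)
  unfold excess
  fun_prop

lemma StdNormalNoise.lintegral_excess (hQ : StdNormalNoise Q) (hm : ∀ i, Measurable (m i))
    (i : Fin n) : ∫⁻ p, excess m C τ i p ∂Q = ENNReal.ofReal (C * τ) * 3
      + ENNReal.ofReal (9 * (τ ^ 8)⁻¹) * Q (badEvent m τ i)
      + ENNReal.ofReal (τ ^ 8) * ENNReal.ofReal stdNormalFourth := by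
  have hind := (measurable_one (α := ℝ≥0∞)).indicator (measurableSet_badEvent (τ := τ) hm i)
  simp only [excess]
  rw [lintegral_add_right _ (by fun_prop), lintegral_add_right _ (by fun_prop),
    lintegral_const_mul _ (by fun_prop), lintegral_const_mul _ hind,
    lintegral_const_mul _ (by fun_prop), lintegral_indicator_one (measurableSet_badEvent hm i),
    lintegral_add_right _ (by fun_prop),
    hQ.lintegral_noise i (F := fun x => ENNReal.ofReal (x ^ 2)) (by fun_prop),
    hQ.lintegral_noise i (F := fun x => ENNReal.ofReal (x ^ 4)) (by fun_prop),
    lintegral_sq_stdNormal, lintegral_fourth_stdNormal, lintegral_const, measure_univ, mul_one]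
  norm_num

lemma StdNormalNoise.lintegral_sum_excess_le (hQ : StdNormalNoise Q) (hm : ∀ i, Measurable (m i))
    (hdep : ∀ i, DependsOn (m i) (Set.Iio i)) (hτ : 0 < τ) (hτ1 : τ ≤ 1) (hC : 0 ≤ C)
    (htail : ∑ i, Q {p | (τ ^ 4)⁻¹ < |pairCentred m p i + p.2 i|} ≤ ENNReal.ofReal (n * τ ^ 32)) :
    ∫⁻ p, ∑ i, excess m C τ i p ∂Q
      ≤ ENNReal.ofReal ((3 * C + 171 + stdNormalFourth) * (n * τ) + 18 * (τ ^ 88)⁻¹) := by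
  have h4 := stdNormalFourth_nonneg
  rw [lintegral_finsetSum _ fun i _ => measurable_excess hm i]
  simp only [hQ.lintegral_excess hm, Finset.sum_add_distrib, ← Finset.mul_sum, Finset.sum_const,
    Finset.card_univ, Fintype.card_fin, nsmul_eq_mul]
  calc _ ≤ ENNReal.ofReal (C * τ) * (n * 3) + ENNReal.ofReal (9 * (τ ^ 8)⁻¹) *
          ENNReal.ofReal (19 * n * τ ^ 9 + 2 * (τ ^ 80)⁻¹) +
          ENNReal.ofReal (τ ^ 8) * (n * ENNReal.ofReal stdNormalFourth) :=
        add_le_add_left (add_le_add_right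
          (mul_le_mul_right (hQ.sum_measure_badEvent_le hm hdep hτ hτ1 htail) _) _) _
    _ = ENNReal.ofReal (C * τ * (n * 3) + 9 * (τ ^ 8)⁻¹ * (19 * n * τ ^ 9 + 2 * (τ ^ 80)⁻¹)
          + τ ^ 8 * (n * stdNormalFourth)) := by
        rw [← ENNReal.ofReal_natCast, ← ENNReal.ofReal_ofNat 3]
        repeat rw [← ENNReal.ofReal_mul (by positivity)]
        repeat rw [← ENNReal.ofReal_add (by positivity) (by positivity)]
    _ ≤ ENNReal.ofReal ((3 * C + 171 + stdNormalFourth) * (n * τ) + 18 * (τ ^ 88)⁻¹) := by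
        refine ENNReal.ofReal_le_ofReal ?_
        have hbad : 9 * (τ ^ 8)⁻¹ * (19 * n * τ ^ 9 + 2 * (τ ^ 80)⁻¹)
            = 171 * (n * τ) + 18 * (τ ^ 88)⁻¹ := by field_simp; ring
        have hfourth : τ ^ 8 * (n * stdNormalFourth) ≤ τ * (n * stdNormalFourth) := by
          gcongr
          exact pow_le_of_le_one hτ.le hτ1 (by norm_num)
        linarith

lemma estimIS_pairObs_sub (m : Fin n → (Fin n → ℝ) → ℝ) (i : Fin n) (p : Pair n) :
    estimIS m i (pairObs p) - p.1 i
      = estDecision (1 / Real.log n) (Finset.Iio i) (pairCentred m p + p.2)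
          (pairCentred m p i + p.2 i) - pairCentred m p i := by
  rw [estimIS, resid_pairObs, Pi.add_apply, pairCentred]
  ring

lemma oracleIS_sub {Ω : Type*} (μ ε : Fin n → Ω → ℝ) (m : Fin n → (Fin n → ℝ) → ℝ) (i : Fin n)
    (ω : Ω) : oracleIS μ ε m i ω - μ i ω
      = oracleDecision (Finset.Iic i) (centred μ ε m ω) (centred μ ε m ω i + ε i ω)
        - centred μ ε m ω i := by
  have hresid : resid m (obs μ ε ω) i = centred μ ε m ω i + ε i ω := by
    simp only [resid, centred, obs]
    ring
  rw [oracleIS, hresid]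
  simp only [centred]
  ring

end Excess

lemma NoiseModel.map_pairOf_large_resid {Ω : Type*} [MeasurableSpace Ω] {P : Measure Ω} {n : ℕ}
    {μ ε : Fin n → Ω → ℝ} {m : Fin n → (Fin n → ℝ) → ℝ} (hmodel : NoiseModel P μ ε)
    (hm : ∀ i, Measurable (m i)) (i : Fin n) (L : ℝ) :
    P.map (pairOf μ ε) {p | L < |pairCentred m p i + p.2 i|}
      = P {ω | L < |resid m (obs μ ε ω) i|} := by
  rw [Measure.map_apply hmodel.measurable_pairOf (measurableSet_lt measurable_const
    (measurable_pairResid_apply hm i).abs)]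
  simp only [obs_eq_pairObs, resid_pairObs]
  rfl

lemma exists_risk_estimIS_le : ∃ K : ℝ,
    ∀ {Ω : Type*} [MeasurableSpace Ω] {P : Measure Ω} [IsProbabilityMeasure P] {n : ℕ}
      {μ ε : Fin n → Ω → ℝ} {m : Fin n → (Fin n → ℝ) → ℝ} {τ : ℝ}, NoiseModel P μ ε →
    (∀ i, Measurable (m i)) → (∀ i, DependsOn (m i) (Set.Iio i)) → 0 < τ → K * τ ≤ 1 →
    τ ^ 4 = 1 / Real.log n →
    ∑ i, P {ω | Real.log n < |resid m (obs μ ε ω) i|} ≤ ENNReal.ofReal (n * τ ^ 32) →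
    risk P μ (fun i ω => estimIS m i (obs μ ε ω))
      ≤ risk P μ (oracleIS μ ε m) + ENNReal.ofReal (K * (n * τ) + 18 * (τ ^ 88)⁻¹) := by
  obtain ⟨C, hC1, hC⟩ := exists_estDecision_loss_le_excess
  have h4 := stdNormalFourth_nonneg
  refine ⟨3 * C + 171 + stdNormalFourth, ?_⟩
  intro Ω _ P _ n μ ε m τ hmodel hm hdep hτ hKτ hσ htail
  have hτ1 : τ ≤ 1 := by nlinarith
  have hCτ : C * τ ≤ 1 := by nlinarith
  have hpair : Measurable (pairOf μ ε) := hmodel.measurable_pairOf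
  set Q := P.map (pairOf μ ε)
  have : IsProbabilityMeasure Q := Measure.isProbabilityMeasure_map hpair.aemeasurable
  have htailQ : ∑ i, Q {p | (τ ^ 4)⁻¹ < |pairCentred m p i + p.2 i|}
      ≤ ENNReal.ofReal (n * τ ^ 32) := by
    rw [hσ, one_div, inv_inv]
    exact (Finset.sum_congr rfl fun i _ => hmodel.map_pairOf_large_resid hm i _).trans_le htail
  have hexcess : Measurable fun p : Pair n => ∑ i, excess m C τ i p :=
    Finset.measurable_fun_sum _ fun i _ => measurable_excess hm i
  calc risk P μ (fun i ω => estimIS m i (obs μ ε ω))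
      ≤ ∫⁻ ω, (ENNReal.ofReal (∑ i, (oracleIS μ ε m i ω - μ i ω) ^ 2)
          + ∑ i, excess m C τ i (pairOf μ ε ω)) ∂P := by
        refine lintegral_mono fun ω => ?_
        simp only
        rw [ENNReal.ofReal_sum_of_nonneg fun i _ => sq_nonneg _,
          ENNReal.ofReal_sum_of_nonneg fun i _ => sq_nonneg _, ← Finset.sum_add_distrib]
        refine Finset.sum_le_sum fun i _ => ?_
        rw [oracleIS_sub, obs_eq_pairObs]
        refine le_of_eq_of_le ?_ (hC m hτ hCτ i (pairOf μ ε ω))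
        rw [hσ, ← estimIS_pairObs_sub]
        rfl
    _ = risk P μ (oracleIS μ ε m) + ∫⁻ p, ∑ i, excess m C τ i p ∂Q := by
        rw [lintegral_map hexcess hpair]
        exact lintegral_add_right _ (hexcess.comp hpair)
    _ ≤ _ := by
        gcongr
        exact hmodel.stdNormalNoise.lintegral_sum_excess_le hm hdep hτ hτ1 (by linarith) htailQ

/-! ### Risks of decision functions -/

section Risks

variable {ι : Type*} {δ : ℝ → ℝ}

lemma measurable_oracleDecision (s : Finset ι) (ν : ι → ℝ) : Measurable (oracleDecision s ν) :=
  measurable_id.add ((measurable_deriv _).div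
    (continuous_iff_continuousAt.2 fun z => (mixDensity_hasDerivAt s ν z).continuousAt).measurable)

lemma sum_normalRisk_oracleDecision_Iic_le {n : ℕ} (ν : Fin n → ℝ) :
    ∑ i, normalRisk (oracleDecision (Finset.Iic i) ν) (ν i)
      ≤ ∑ i, normalRisk (oracleDecision Finset.univ ν) (ν i) := by
  let s (k : ℕ) : Finset (Fin n) := {j | (j : ℕ) < k}
  suffices h : ∀ k ≤ n, ∑ i ∈ s k, normalRisk (oracleDecision (Finset.Iic i) ν) (ν i)
      ≤ ∑ i ∈ s k, normalRisk (oracleDecision (s k) ν) (ν i) by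
    simpa [s] using h n le_rfl
  intro k
  induction k with
  | zero => simp [s]
  | succ k ih =>
    intro hk
    have hlast : (⟨k, hk⟩ : Fin n) ∉ s k := by simp [s]
    have hinsert : s (k + 1) = insert ⟨k, hk⟩ (s k) := by
      ext j
      simp only [s, Finset.mem_filter_univ, Finset.mem_insert, Fin.ext_iff]
      omega
    have hIic : Finset.Iic (⟨k, hk⟩ : Fin n) = insert ⟨k, hk⟩ (s k) := by
      rw [← hinsert]
      ext j
      simp only [s, Finset.mem_Iic, Finset.mem_filter_univ, Fin.le_def]
      omega
    rw [hinsert, Finset.sum_insert hlast, Finset.sum_insert hlast, hIic]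
    exact add_le_add le_rfl
      ((ih (by omega)).trans (oracleDecision_isMin _ ν _ (measurable_oracleDecision _ ν)))

/-- The decision function `δ` with its displacement `δ z - z` truncated at `T`, so that its risk is
bounded. -/
noncomputable def truncDecision (T : ℝ) (δ : ℝ → ℝ) (z : ℝ) : ℝ := z + max (-T) (min (δ z - z) T)

lemma measurable_truncDecision (hδ : Measurable δ) (T : ℝ) : Measurable (truncDecision T δ) := by
  unfold truncDecision
  fun_prop

lemma sq_trunc_le {T : ℝ} (hT : 0 ≤ T) (w : ℝ) : max (-T) (min w T) ^ 2 ≤ T ^ 2 :=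
  sq_le_sq' (le_max_left _ _) (max_le (by linarith) (min_le_right _ _))

lemma sq_trunc_sub_le {T : ℝ} (hT : 0 < T) (w x : ℝ) :
    (max (-T) (min w T) - x) ^ 2 ≤ (w - x) ^ 2 + 4 * x ^ 4 / T ^ 2 := by
  rcases le_or_gt |x| T with hx | hx
  · obtain ⟨hx1, hx2⟩ := abs_le.1 hx
    have hcontract : |max (-T) (min w T) - x| ≤ |w - x| := by
      have := (abs_max_sub_max_le_max (-T) (min w T) (-T) (min x T)).trans
        (max_le_max le_rfl (abs_min_sub_min_le_max w T x T))
      simpa [min_eq_left hx2, max_eq_right hx1] using this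
    exact (sq_le_sq.2 hcontract).trans (le_add_of_nonneg_right (by positivity))
  · have hTx : T ^ 2 ≤ x ^ 2 := by
      rw [← sq_abs x]
      gcongr
    calc (max (-T) (min w T) - x) ^ 2 ≤ 2 * (T ^ 2 + x ^ 2) := by
          nlinarith [sq_trunc_le hT.le w, sq_nonneg (max (-T) (min w T) + x)]
      _ ≤ 4 * x ^ 4 / T ^ 2 := by
          rw [le_div_iff₀ (by positivity)]
          nlinarith [sq_nonneg x, sq_nonneg T]
      _ ≤ _ := le_add_of_nonneg_left (sq_nonneg _)

lemma normalRisk_truncDecision_le (hδ : Measurable δ) {T : ℝ} (hT : 0 < T) (v : ℝ) :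
    normalRisk (truncDecision T δ) v
      ≤ normalRisk δ v + ENNReal.ofReal (4 * stdNormalFourth / T ^ 2) := by
  calc normalRisk (truncDecision T δ) v
      ≤ ∫⁻ e, (ENNReal.ofReal ((δ (v + e) - v) ^ 2)
          + ENNReal.ofReal (4 / T ^ 2) * ENNReal.ofReal (e ^ 4)) ∂γ := by
        refine lintegral_mono fun e => ?_
        rw [← ENNReal.ofReal_mul (by positivity), ← ENNReal.ofReal_add (by positivity)
          (by positivity)]
        refine ENNReal.ofReal_le_ofReal ?_
        have := sq_trunc_sub_le hT (δ (v + e) - (v + e)) (-e)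
        rw [truncDecision]
        convert this using 1 <;> ring
    _ = _ := by
        rw [lintegral_add_left (by fun_prop), lintegral_const_mul _ (by fun_prop),
          lintegral_fourth_stdNormal, ← ENNReal.ofReal_mul (by positivity), div_mul_eq_mul_div,
          normalRisk]

lemma normalRisk_truncDecision_le_const {T : ℝ} (hT : 0 ≤ T) (δ : ℝ → ℝ) (v : ℝ) :
    normalRisk (truncDecision T δ) v ≤ ENNReal.ofReal (2 * (T ^ 2 + 1)) := by
  calc normalRisk (truncDecision T δ) v
      ≤ ∫⁻ e, (ENNReal.ofReal (2 * T ^ 2) + ENNReal.ofReal 2 * ENNReal.ofReal (e ^ 2)) ∂γ := by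
        refine lintegral_mono fun e => ?_
        rw [← ENNReal.ofReal_mul (by norm_num), ← ENNReal.ofReal_add (by positivity)
          (by positivity)]
        refine ENNReal.ofReal_le_ofReal ?_
        rw [truncDecision]
        nlinarith [sq_trunc_le hT (δ (v + e) - (v + e)),
          sq_nonneg (e - max (-T) (min (δ (v + e) - (v + e)) T))]
    _ = _ := by
        rw [lintegral_add_left measurable_const, lintegral_const, measure_univ, mul_one,
          lintegral_const_mul _ (by fun_prop), lintegral_sq_stdNormal, mul_one,
          ← ENNReal.ofReal_add (by positivity) (by norm_num)]
        ring_nf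

lemma sum_normalRisk_oracleDecision_univ_le [Fintype ι] [DecidableEq ι] (ν : ι → ℝ) (s : Finset ι)
    {T : ℝ} (hT : 0 < T) (hδ : Measurable δ) :
    ∑ i, normalRisk (oracleDecision Finset.univ ν) (ν i)
      ≤ ∑ j ∈ s, normalRisk δ (ν j)
        + (ENNReal.ofReal (Fintype.card ι * (4 * stdNormalFourth / T ^ 2))
          + ENNReal.ofReal (2 * (T ^ 2 + 1)) * sᶜ.card) := by
  have htrunc := measurable_truncDecision hδ T
  calc ∑ i, normalRisk (oracleDecision Finset.univ ν) (ν i)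
      ≤ ∑ i, normalRisk (truncDecision T δ) (ν i) := oracleDecision_isMin _ ν _ htrunc
    _ = ∑ i ∈ s, normalRisk (truncDecision T δ) (ν i)
          + ∑ i ∈ sᶜ, normalRisk (truncDecision T δ) (ν i) := (Finset.sum_add_sum_compl s _).symm
    _ ≤ ∑ i ∈ s, (normalRisk δ (ν i) + ENNReal.ofReal (4 * stdNormalFourth / T ^ 2))
          + ∑ i ∈ sᶜ, ENNReal.ofReal (2 * (T ^ 2 + 1)) :=
        add_le_add (Finset.sum_le_sum fun i _ => normalRisk_truncDecision_le hδ hT _)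
          (Finset.sum_le_sum fun i _ => normalRisk_truncDecision_le_const hT.le δ _)
    _ ≤ _ := by
        rw [Finset.sum_add_distrib, add_assoc, Finset.sum_const, Finset.sum_const, nsmul_eq_mul,
          nsmul_eq_mul, mul_comm (sᶜ.card : ℝ≥0∞), ENNReal.ofReal_mul (Nat.cast_nonneg _),
          ENNReal.ofReal_natCast]
        gcongr
        exact Finset.card_le_univ s

lemma normalRisk_eq_ofReal_integral {v : ℝ}
    (h : Integrable (fun e => (δ (v + e) - v) ^ 2) γ) :
    normalRisk δ v = ENNReal.ofReal (∫ e, (δ (v + e) - v) ^ 2 ∂γ) :=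
  (ofReal_integral_eq_lintegral_ofReal h (ae_of_all _ fun _ => sq_nonneg _)).symm

lemma memLp_linear_sub (β v : ℝ) : MemLp (fun e => β * (v + e) - v) 2 γ :=
  (((memLp_const v).add (memLp_id_gaussianReal 2)).const_mul β).sub (memLp_const v)

lemma integral_sq_linear_sub (β v : ℝ) :
    ∫ e, (β * (v + e) - v) ^ 2 ∂γ = (1 - β) ^ 2 * v ^ 2 + β ^ 2 := by
  have hlin : Integrable (fun e : ℝ => 2 * β * (1 - β) * v * e) γ :=
    Integrable.const_mul (by simpa using integrable_pow_stdNormal 1) _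
  have hconst : Integrable (fun e : ℝ => (1 - β) ^ 2 * v ^ 2 - 2 * β * (1 - β) * v * e) γ :=
    (integrable_const _).sub hlin
  have hexpand : ∀ e : ℝ, (β * (v + e) - v) ^ 2
      = (1 - β) ^ 2 * v ^ 2 - 2 * β * (1 - β) * v * e + β ^ 2 * e ^ 2 := fun e => by ring
  simp only [hexpand]
  rw [integral_add hconst ((integrable_pow_stdNormal 2).const_mul _),
    integral_sub (integrable_const _) hlin, integral_const_mul (2 * β * (1 - β) * v),
    integral_const_mul (β ^ 2), integral_self_stdNormal, integral_sq_stdNormal]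
  simp

lemma normalRisk_linear (β v : ℝ) :
    normalRisk (fun z => β * z) v = ENNReal.ofReal ((1 - β) ^ 2 * v ^ 2 + β ^ 2) := by
  rw [normalRisk_eq_ofReal_integral (memLp_linear_sub β v).integrable_sq, integral_sq_linear_sub]

lemma sum_normalRisk_linear (s : Finset ι) (ν : ι → ℝ) (β : ℝ) :
    ∑ i ∈ s, normalRisk (fun z => β * z) (ν i)
      = ENNReal.ofReal ((1 - β) ^ 2 * ∑ i ∈ s, ν i ^ 2 + s.card * β ^ 2) := by
  simp only [normalRisk_linear]
  rw [← ENNReal.ofReal_sum_of_nonneg fun i _ => by positivity, Finset.sum_add_distrib,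
    ← Finset.mul_sum, Finset.sum_const, nsmul_eq_mul]

lemma sum_sq_linear_sub (s : Finset ι) (ν e : ι → ℝ) (β : ℝ) :
    ∑ i ∈ s, (β * (ν i + e i) - ν i) ^ 2
      = (1 - β) ^ 2 * ∑ i ∈ s, ν i ^ 2 - 2 * β * (1 - β) * ∑ i ∈ s, ν i * e i
        + β ^ 2 * (s.card + ∑ i ∈ s, (e i ^ 2 - 1)) := by
  rw [Finset.sum_sub_distrib, Finset.sum_const, nsmul_one, add_sub_cancel, Finset.mul_sum,
    Finset.mul_sum, Finset.mul_sum, ← Finset.sum_sub_distrib, ← Finset.sum_add_distrib]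
  exact Finset.sum_congr rfl fun i _ => by ring

-- A weight above `1` is no better than `1`, so the linear rule can be taken to be a contraction.
lemma sum_normalRisk_linear_min_le (s : Finset ι) (ν e : ι → ℝ) {β : ℝ} (hβ : 0 ≤ β) :
    ∑ i ∈ s, normalRisk (fun z => min β 1 * z) (ν i)
      ≤ ENNReal.ofReal (∑ i ∈ s, (β * (ν i + e i) - ν i) ^ 2 + |∑ i ∈ s, ν i * e i|
        + |∑ i ∈ s, (e i ^ 2 - 1)|) := by
  rw [sum_normalRisk_linear]
  refine ENNReal.ofReal_le_ofReal ?_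
  have hloss := sum_sq_linear_sub s ν e β
  have hloss0 : 0 ≤ ∑ i ∈ s, (β * (ν i + e i) - ν i) ^ 2 := Finset.sum_nonneg fun i _ => sq_nonneg _
  have hraw : 0 ≤ ∑ i ∈ s, ν i ^ 2 + 2 * ∑ i ∈ s, ν i * e i
      + (s.card + ∑ i ∈ s, (e i ^ 2 - 1)) := by
    have hexpand : ∑ i ∈ s, (ν i + e i) ^ 2 = ∑ i ∈ s, ν i ^ 2 + 2 * ∑ i ∈ s, ν i * e i
        + (s.card + ∑ i ∈ s, (e i ^ 2 - 1)) := by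
      rw [Finset.sum_sub_distrib, Finset.sum_const, nsmul_one, add_sub_cancel, Finset.mul_sum,
        ← Finset.sum_add_distrib, ← Finset.sum_add_distrib]
      exact Finset.sum_congr rfl fun i _ => by ring
    exact hexpand ▸ Finset.sum_nonneg fun i _ => sq_nonneg _
  set S := ∑ i ∈ s, ν i ^ 2
  set W := ∑ i ∈ s, ν i * e i
  set q := ∑ i ∈ s, (e i ^ 2 - 1)
  have hW := abs_le.1 (le_refl |W|)
  have hq := abs_le.1 (le_refl |q|)
  rcases le_total β 1 with hβ1 | hβ1
  · have hcross : 2 * β * (1 - β) * W ≤ |W| := by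
      have : 2 * β * (1 - β) ≤ 1 := by nlinarith [sq_nonneg (2 * β - 1)]
      nlinarith [mul_nonneg hβ (sub_nonneg.2 hβ1)]
    have hnoise : -(β ^ 2 * q) ≤ |q| := by
      nlinarith [sq_nonneg β, pow_le_one₀ hβ hβ1 (n := 2)]
    rw [min_eq_left hβ1]
    linarith
  · rw [min_eq_right hβ1]
    rcases le_total 0 (W + (s.card + q)) with h | h
    · nlinarith [mul_nonneg (sub_nonneg.2 hβ1) h, mul_nonneg (sq_nonneg (β - 1)) hraw, hW.1, hW.2,
        abs_nonneg W, abs_nonneg q]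
    · linarith [hW.1, hq.1, hloss0]

end Risks

section OracleRisk

variable {n : ℕ} {m : Fin n → (Fin n → ℝ) → ℝ}

lemma measurable_oracleDecision_pair (hm : ∀ i, Measurable (m i)) (s : Finset (Fin n)) :
    Measurable fun q : Pair n × ℝ => oracleDecision s (pairCentred m q.1) q.2 := by
  simp only [oracleDecision_eq]
  refine measurable_snd.add (Measurable.div ?_ (measurable_mixDensity_pair hm s))
  simp only [Finset.expect_eq_sum_div_card]
  exact (Finset.measurable_fun_sum s fun j _ => continuous_stdPDFDeriv.measurable.comp
    (measurable_snd.sub ((measurable_pairCentred_apply hm j).comp measurable_fst))).div_const _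

lemma oracleDecision_resample (hdep : ∀ i, DependsOn (m i) (Set.Iio i)) (i : Fin n) (p : Pair n)
    (x : ℝ) : oracleDecision (Finset.Iic i) (pairCentred m (resample i p x))
      = oracleDecision (Finset.Iic i) (pairCentred m p) := by
  funext z
  rw [oracleDecision_eq, oracleDecision_eq, mixDensity_resample hdep]
  congr 2
  exact Finset.expect_congr rfl fun j hj => by
    rw [pairCentred_resample hdep (Finset.mem_Iic.1 hj)]

lemma StdNormalNoise.lintegral_oracleLoss_eq {Q : Measure (Pair n)} (hQ : StdNormalNoise Q)
    (hm : ∀ i, Measurable (m i)) (hdep : ∀ i, DependsOn (m i) (Set.Iio i)) (i : Fin n) :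
    ∫⁻ p, ENNReal.ofReal ((oracleDecision (Finset.Iic i) (pairCentred m p)
        (pairCentred m p i + p.2 i) - pairCentred m p i) ^ 2) ∂Q
      = ∫⁻ p, normalRisk (oracleDecision (Finset.Iic i) (pairCentred m p)) (pairCentred m p i)
          ∂Q := by
  rw [hQ.lintegral_resid_eq hm hdep i
    (H := fun p z => ENNReal.ofReal ((oracleDecision (Finset.Iic i) (pairCentred m p) z
      - pairCentred m p i) ^ 2))]
  · simp only [normalRisk_eq (measurable_oracleDecision _ _),
      ENNReal.ofReal_mul (gaussianPDFReal_nonneg 0 1 _)]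
  · exact (((measurable_oracleDecision_pair hm _).sub
      ((measurable_pairCentred_apply hm i).comp measurable_fst)).pow_const 2).ennreal_ofReal
  · simp only [oracleDecision_resample hdep, pairCentred_resample hdep le_rfl, implies_true]

lemma measurable_normalRisk_oracleDecision (hm : ∀ i, Measurable (m i)) (s : Finset (Fin n))
    (i : Fin n) : Measurable fun p : Pair n =>
      normalRisk (oracleDecision s (pairCentred m p)) (pairCentred m p i) := by
  have hν : Measurable fun q : Pair n × ℝ => pairCentred m q.1 i :=
    (measurable_pairCentred_apply hm i).comp measurable_fst
  unfold normalRisk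
  exact Measurable.lintegral_prod_right' ((((measurable_oracleDecision_pair hm s).comp
    (measurable_fst.prodMk (hν.add measurable_snd))).sub hν).pow_const 2).ennreal_ofReal

lemma NoiseModel.risk_oracleIS_le {Ω : Type*} [MeasurableSpace Ω] {P : Measure Ω}
    [IsProbabilityMeasure P] {μ ε : Fin n → Ω → ℝ} (hmodel : NoiseModel P μ ε)
    (hm : ∀ i, Measurable (m i)) (hdep : ∀ i, DependsOn (m i) (Set.Iio i)) :
    risk P μ (oracleIS μ ε m)
      ≤ ∫⁻ ω, ∑ i, normalRisk (oracleDecision Finset.univ (centred μ ε m ω)) (centred μ ε m ω i)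
          ∂P := by
  have hpair := hmodel.measurable_pairOf
  have hloss : ∀ i, Measurable fun p : Pair n =>
      ENNReal.ofReal ((oracleDecision (Finset.Iic i) (pairCentred m p)
        (pairCentred m p i + p.2 i) - pairCentred m p i) ^ 2) := fun i =>
    ((((measurable_oracleDecision_pair hm _).comp
      (measurable_id.prodMk (measurable_pairResid_apply hm i))).sub
        (measurable_pairCentred_apply hm i)).pow_const 2).ennreal_ofReal
  have hrisk := measurable_normalRisk_oracleDecision hm
  calc risk P μ (oracleIS μ ε m)
      = ∫⁻ p, ∑ i, ENNReal.ofReal ((oracleDecision (Finset.Iic i) (pairCentred m p)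
          (pairCentred m p i + p.2 i) - pairCentred m p i) ^ 2) ∂(P.map (pairOf μ ε)) := by
        rw [lintegral_map (Finset.measurable_fun_sum _ fun i _ => hloss i) hpair, risk]
        simp only [oracleIS_sub, ENNReal.ofReal_sum_of_nonneg fun _ _ => sq_nonneg _]
        rfl
    _ = ∫⁻ p, ∑ i, normalRisk (oracleDecision (Finset.Iic i) (pairCentred m p))
          (pairCentred m p i) ∂(P.map (pairOf μ ε)) := by
        rw [lintegral_finsetSum _ fun i _ => hloss i, lintegral_finsetSum _ fun i _ => hrisk _ i]
        simp only [hmodel.stdNormalNoise.lintegral_oracleLoss_eq hm hdep]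
    _ ≤ ∫⁻ p, ∑ i, normalRisk (oracleDecision Finset.univ (pairCentred m p))
          (pairCentred m p i) ∂(P.map (pairOf μ ε)) :=
        lintegral_mono fun p => sum_normalRisk_oracleDecision_Iic_le _
    _ = _ := lintegral_map (Finset.measurable_fun_sum _ fun i _ => hrisk _ i) hpair

end OracleRisk

/-! ### Weighted averages as benchmarks -/

section Pathwise

variable {ι : Type*} [Fintype ι]

/-- The price of replacing the loss of a linear rule over the times `s` by its risk, where `ν` are
the centred states, `e` is the noise, and every time outside `s` costs `D`. -/
noncomputable def linearLossError [DecidableEq ι] (D : ℝ) (s : Finset ι) (ν e : ι → ℝ) : ℝ≥0∞ :=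
  ENNReal.ofReal |∑ i ∈ s, ν i * e i| + ENNReal.ofReal |∑ i ∈ s, (e i ^ 2 - 1)|
    + ENNReal.ofReal D * sᶜ.card

lemma sq_sub_le_add_mul_sq {r : ℝ} (hr : 0 < r) (a b : ℝ) :
    (a - b) ^ 2 ≤ (1 + r) * a ^ 2 + (1 + r⁻¹) * b ^ 2 := by
  have h : 0 ≤ r⁻¹ * (r * a + b) ^ 2 := by positivity
  have hexpand : r⁻¹ * (r * a + b) ^ 2 = r * a ^ 2 + 2 * a * b + r⁻¹ * b ^ 2 := by
    field_simp
    ring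
  linarith

lemma sum_sq_linear_sub_le (s : Finset ι) (ν e x : ι → ℝ) (β : ℝ) {r : ℝ} (hr : 0 < r) :
    ∑ i ∈ s, (β * (ν i + e i) - ν i) ^ 2
      ≤ (1 + r) * ∑ i, x i ^ 2
        + (1 + r⁻¹) * ∑ i ∈ s, (x i - (β * (ν i + e i) - ν i)) ^ 2 := by
  calc ∑ i ∈ s, (β * (ν i + e i) - ν i) ^ 2
      ≤ ∑ i ∈ s, ((1 + r) * x i ^ 2 + (1 + r⁻¹) * (x i - (β * (ν i + e i) - ν i)) ^ 2) :=
        Finset.sum_le_sum fun i _ => by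
          simpa using sq_sub_le_add_mul_sq hr (x i) (x i - (β * (ν i + e i) - ν i))
    _ = (1 + r) * ∑ i ∈ s, x i ^ 2
          + (1 + r⁻¹) * ∑ i ∈ s, (x i - (β * (ν i + e i) - ν i)) ^ 2 := by
        rw [Finset.sum_add_distrib, Finset.mul_sum, Finset.mul_sum]
    _ ≤ _ := by
        gcongr ?_ * ?_ + _
        exact Finset.sum_le_univ_sum_of_nonneg fun i => sq_nonneg (x i)

-- `x` is the error of an estimator close to the linear rule `β z` at the times in `s`, and `δ`
-- improves on that linear rule by `g`.
lemma sum_normalRisk_oracleDecision_add_le [DecidableEq ι] (s : Finset ι) (ν e x : ι → ℝ)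
    {β r T c : ℝ} (hβ : 0 ≤ β) (hr : 0 < r) (hT : 0 < T) (hc : 0 ≤ c) {δ : ℝ → ℝ}
    (hδ : Measurable δ) {g : ℝ≥0∞} (hg : ∑ i ∈ s, normalRisk δ (ν i) + g
      ≤ ∑ i ∈ s, normalRisk (fun z => min β 1 * z) (ν i) + ENNReal.ofReal c * sᶜ.card) :
    ∑ i, normalRisk (oracleDecision Finset.univ ν) (ν i) + g
      ≤ ENNReal.ofReal (1 + r) * ENNReal.ofReal (∑ i, x i ^ 2)
        + ENNReal.ofReal (1 + r⁻¹)
            * ∑ i ∈ s, ENNReal.ofReal ((x i - (β * (ν i + e i) - ν i)) ^ 2)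
        + linearLossError (2 * (T ^ 2 + 1) + c) s ν e
        + ENNReal.ofReal (Fintype.card ι * (4 * stdNormalFourth / T ^ 2)) := by
  have hlinear : ∑ i ∈ s, normalRisk (fun z => min β 1 * z) (ν i)
      ≤ ENNReal.ofReal (1 + r) * ENNReal.ofReal (∑ i, x i ^ 2)
        + ENNReal.ofReal (1 + r⁻¹)
            * ∑ i ∈ s, ENNReal.ofReal ((x i - (β * (ν i + e i) - ν i)) ^ 2)
        + ENNReal.ofReal |∑ i ∈ s, ν i * e i| + ENNReal.ofReal |∑ i ∈ s, (e i ^ 2 - 1)| := by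
    rw [← ENNReal.ofReal_sum_of_nonneg fun i _ => sq_nonneg _, ← ENNReal.ofReal_mul (by positivity),
      ← ENNReal.ofReal_mul (by positivity), ← ENNReal.ofReal_add (by positivity) (by positivity),
      ← ENNReal.ofReal_add (by positivity) (by positivity),
      ← ENNReal.ofReal_add (by positivity) (by positivity)]
    refine (sum_normalRisk_linear_min_le s ν e hβ).trans (ENNReal.ofReal_le_ofReal ?_)
    gcongr
    exact sum_sq_linear_sub_le s ν e x β hr
  rw [linearLossError, ENNReal.ofReal_add (by positivity) hc, add_mul]
  set B := ENNReal.ofReal (2 * (T ^ 2 + 1)) * (sᶜ.card : ℝ≥0∞)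
  set E := ENNReal.ofReal (Fintype.card ι * (4 * stdNormalFourth / T ^ 2))
  calc ∑ i, normalRisk (oracleDecision Finset.univ ν) (ν i) + g
      ≤ ∑ i ∈ s, normalRisk δ (ν i) + (E + B) + g :=
        add_le_add (sum_normalRisk_oracleDecision_univ_le ν s hT hδ) le_rfl
    _ = ∑ i ∈ s, normalRisk δ (ν i) + g + (E + B) := add_right_comm _ _ _
    _ ≤ _ := (add_le_add (hg.trans (add_le_add hlinear le_rfl)) le_rfl).trans_eq (by ring)

end Pathwise

/-- The time points that are far from both ends. -/
noncomputable def midTimes (n : ℕ) (κ : ℝ) : Finset (Fin n) :=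
  {i : Fin n | κ * n ≤ (i : ℕ) + 1 ∧ ((i : ℕ) + 1 : ℝ) ≤ (1 - κ) * n}

lemma card_compl_midTimes_le (n : ℕ) {κ : ℝ} (hκ : 0 ≤ κ) :
    ((midTimes n κ)ᶜ.card : ℝ) ≤ 2 * (κ * n + 1) := by
  set A : Finset (Fin n) := {i : Fin n | ((i : ℕ) : ℝ) < κ * n}
  have hA : (A.card : ℝ) ≤ κ * n + 1 := card_filter_val_lt_le n (by positivity)
  have hsub : (midTimes n κ)ᶜ ⊆ A ∪ A.map Fin.revPerm.toEmbedding := by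
    intro i hi
    simp only [midTimes, Finset.mem_compl, Finset.mem_filter_univ, not_and_or, not_le] at hi
    refine Finset.mem_union.2 (hi.imp (fun h => ?_) fun h => ?_)
    · exact Finset.mem_filter_univ i |>.2 (by linarith)
    · refine Finset.mem_map_equiv.2 (Finset.mem_filter_univ _ |>.2 ?_)
      have hrev : ((Fin.rev i : ℕ) : ℝ) = n - ((i : ℕ) + 1) := by
        rw [Fin.val_rev, Nat.cast_sub i.2, Nat.cast_add_one]
      rw [Fin.revPerm_symm, Fin.revPerm_apply, hrev]
      linarith
  have hcard : ((midTimes n κ)ᶜ.card : ℝ) ≤ A.card + A.card := by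
    exact_mod_cast (Finset.card_le_card hsub).trans
      ((Finset.card_union_le _ _).trans_eq (by rw [Finset.card_map]))
  linarith

section TameTimes

variable {n : ℕ} {m : Fin n → (Fin n → ℝ) → ℝ} {κ L : ℝ}

/-- The time points far from both ends at which the centred state is not large. -/
noncomputable def tameTimes (m : Fin n → (Fin n → ℝ) → ℝ) (κ L : ℝ) (p : Pair n) :
    Finset (Fin n) :=
  {i ∈ midTimes n κ | |pairCentred m p i| ≤ 2 * L}

lemma tameTimes_subset_midTimes (p : Pair n) : tameTimes m κ L p ⊆ midTimes n κ :=
  Finset.filter_subset _ _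

lemma mem_tameTimes {p : Pair n} {i : Fin n} :
    i ∈ tameTimes m κ L p ↔ i ∈ midTimes n κ ∧ |pairCentred m p i| ≤ 2 * L :=
  Finset.mem_filter

lemma mem_tameTimes_resample (hdep : ∀ i, DependsOn (m i) (Set.Iio i)) {i j : Fin n} (h : j ≤ i)
    (p : Pair n) (x : ℝ) : j ∈ tameTimes m κ L (resample i p x) ↔ j ∈ tameTimes m κ L p := by
  rw [mem_tameTimes, mem_tameTimes, pairCentred_resample hdep h]

lemma measurableSet_mem_tameTimes (hm : ∀ i, Measurable (m i)) (i : Fin n) :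
    MeasurableSet {p | i ∈ tameTimes m κ L p} := by
  simp only [mem_tameTimes]
  exact (MeasurableSet.const _).inter
    (measurableSet_le (measurable_pairCentred_apply hm i).abs measurable_const)

lemma measurable_sum_tameTimes {M : Type*} [AddCommMonoid M] [MeasurableSpace M] [MeasurableAdd₂ M]
    (hm : ∀ i, Measurable (m i)) {D : Fin n → Pair n → M} (hD : ∀ i, Measurable (D i)) :
    Measurable fun p => ∑ i ∈ tameTimes m κ L p, D i p := by
  have hsum : ∀ p, ∑ i ∈ tameTimes m κ L p, D i p
      = ∑ i, if i ∈ tameTimes m κ L p then D i p else 0 := fun p => by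
    rw [Finset.sum_ite_mem, Finset.univ_inter]
  simp only [hsum]
  exact Finset.measurable_fun_sum _ fun i _ =>
    (hD i).ite (measurableSet_mem_tameTimes hm i) measurable_const

lemma measurable_sum_centred_mul_noise (hm : ∀ i, Measurable (m i)) :
    Measurable fun p => ∑ i ∈ tameTimes m κ L p, pairCentred m p i * p.2 i :=
  measurable_sum_tameTimes hm fun i => (measurable_pairCentred_apply hm i).mul (by fun_prop)

lemma measurable_sum_noise_sq_sub_one (hm : ∀ i, Measurable (m i)) :
    Measurable fun p => ∑ i ∈ tameTimes m κ L p, (p.2 i ^ 2 - 1) :=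
  measurable_sum_tameTimes hm fun i => by fun_prop

lemma card_compl_tameTimes_eq (p : Pair n) :
    ((tameTimes m κ L p)ᶜ.card : ℝ≥0∞) = ∑ i, if i ∈ tameTimes m κ L p then 0 else 1 := by
  simp [Finset.sum_ite, Finset.compl_eq_univ_sdiff, ← Finset.filter_notMem_eq_sdiff]

lemma measurable_card_compl_tameTimes (hm : ∀ i, Measurable (m i)) :
    Measurable fun p => ((tameTimes m κ L p)ᶜ.card : ℝ≥0∞) := by
  simp only [card_compl_tameTimes_eq]
  exact Finset.measurable_fun_sum _ fun i _ =>
    measurable_const.ite (measurableSet_mem_tameTimes hm i) measurable_const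

lemma measurable_linearLossError (hm : ∀ i, Measurable (m i)) (D : ℝ) :
    Measurable fun p => linearLossError D (tameTimes m κ L p) (pairCentred m p) p.2 :=
  ((measurable_sum_centred_mul_noise hm).abs.ennreal_ofReal.add
    (measurable_sum_noise_sq_sub_one hm).abs.ennreal_ofReal).add
      ((measurable_card_compl_tameTimes hm).const_mul _)

lemma StdNormalNoise.lintegral_sq_sum_tameTimes_le {Q : Measure (Pair n)} [IsProbabilityMeasure Q]
    (hQ : StdNormalNoise Q) (hm : ∀ i, Measurable (m i)) (hdep : ∀ i, DependsOn (m i) (Set.Iio i))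
    {f : ℝ → ℝ → ℝ} (hf : Measurable (Function.uncurry f)) (hf0 : ∀ v, ∫ e, f v e ∂γ = 0) {c : ℝ}
    (hfc : ∀ v, |v| ≤ 2 * L → ∫⁻ e, ENNReal.ofReal (f v e ^ 2) ∂γ ≤ ENNReal.ofReal c) :
    ∫⁻ p, ENNReal.ofReal ((∑ i ∈ tameTimes m κ L p, f (pairCentred m p i) (p.2 i)) ^ 2) ∂Q
      ≤ ENNReal.ofReal (n * c) := by
  set D : Fin n → Pair n → ℝ := fun i p =>
    if i ∈ tameTimes m κ L p then f (pairCentred m p i) (p.2 i) else 0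
  have hD : ∀ i, Measurable (D i) := fun i =>
    (hf.comp ((measurable_pairCentred_apply hm i).prodMk (by fun_prop))).ite
      (measurableSet_mem_tameTimes hm i) measurable_const
  have hself : ∀ i p x, D i (resample i p x)
      = if i ∈ tameTimes m κ L p then f (pairCentred m p i) x else 0 := fun i p x => by
    simp only [D, mem_tameTimes_resample hdep le_rfl, pairCentred_resample hdep le_rfl,
      resample_noise_self]
  have hdiff : NoiseDifference Finset.univ D := by
    refine ⟨fun j _ k _ hjk p x => ?_, fun k _ p => ?_⟩
    · simp only [D, mem_tameTimes_resample hdep hjk.le, pairCentred_resample hdep hjk.le,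
        resample_noise_of_ne hjk.ne]
    · simp only [hself]
      split_ifs
      · exact hf0 _
      · exact integral_zero _ _
  have hsum : ∀ p, ∑ i ∈ tameTimes m κ L p, f (pairCentred m p i) (p.2 i) = ∑ i, D i p :=
    fun p => by rw [Finset.sum_ite_mem, Finset.univ_inter]
  simp only [hsum]
  refine (hQ.lintegral_sq_sum_le (c := c) (fun k _ => hD k) hdiff fun k _ => ?_).trans_eq
    (by rw [Finset.card_univ, Fintype.card_fin])
  rw [hQ.lintegral_eq k ((hD k).pow_const 2).ennreal_ofReal]
  refine (lintegral_mono fun p => ?_).trans_eq (by rw [lintegral_const, measure_univ, mul_one])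
  simp only [hself]
  split_ifs with h
  · exact hfc _ (mem_tameTimes.1 h).2
  · simp

lemma lintegral_abs_le_of_sq {α : Type*} [MeasurableSpace α] {P : Measure α}
    [IsProbabilityMeasure P] {f : α → ℝ} {a b : ℝ} (ha : 0 < a) (hb : 0 ≤ b)
    (hf : ∫⁻ x, ENNReal.ofReal (f x ^ 2) ∂P ≤ ENNReal.ofReal (a * b)) :
    ∫⁻ x, ENNReal.ofReal |f x| ∂P ≤ ENNReal.ofReal (a + b) := by
  have hamgm : ∀ t : ℝ, |t| ≤ a + a⁻¹ * t ^ 2 := fun t => by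
    rw [← sq_abs t]
    have : 0 ≤ a⁻¹ * (|t| - a) ^ 2 := by positivity
    have hexpand : a⁻¹ * (|t| - a) ^ 2 = a⁻¹ * |t| ^ 2 - 2 * |t| + a := by
      field_simp
      ring
    linarith [abs_nonneg t]
  calc ∫⁻ x, ENNReal.ofReal |f x| ∂P
      ≤ ∫⁻ x, (ENNReal.ofReal a + ENNReal.ofReal a⁻¹ * ENNReal.ofReal (f x ^ 2)) ∂P := by
        refine lintegral_mono fun x => ?_
        rw [← ENNReal.ofReal_mul (by positivity), ← ENNReal.ofReal_add ha.le (by positivity)]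
        exact ENNReal.ofReal_le_ofReal (hamgm _)
    _ = ENNReal.ofReal a + ENNReal.ofReal a⁻¹ * ∫⁻ x, ENNReal.ofReal (f x ^ 2) ∂P := by
        rw [lintegral_add_left measurable_const, lintegral_const, measure_univ, mul_one,
          lintegral_const_mul' _ _ ENNReal.ofReal_ne_top]
    _ ≤ ENNReal.ofReal a + ENNReal.ofReal a⁻¹ * ENNReal.ofReal (a * b) := by gcongr
    _ = _ := by
        rw [← ENNReal.ofReal_mul (by positivity), inv_mul_cancel_left₀ ha.ne',
          ← ENNReal.ofReal_add ha.le hb]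

lemma StdNormalNoise.sum_measure_large_centred_le {Q : Measure (Pair n)} [IsProbabilityMeasure Q]
    (hQ : StdNormalNoise Q) (hL : 0 < L)
    (htail : ∑ i, Q {p | L < |pairCentred m p i + p.2 i|} ≤ ENNReal.ofReal (n / L ^ 2)) :
    ∑ i, Q {p | 2 * L < |pairCentred m p i|} ≤ ENNReal.ofReal (2 * (n / L ^ 2)) := by
  have hnoise : ∀ i, Q {p | L < |p.2 i|} ≤ ENNReal.ofReal (1 / L ^ 2) := fun i => by
    have hsub : {p : Pair n | L < |p.2 i|}
        ⊆ {p | ENNReal.ofReal (L ^ 2) ≤ ENNReal.ofReal (p.2 i ^ 2)} := fun p hp =>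
      ENNReal.ofReal_le_ofReal (sq_le_sq.2 (by rw [abs_of_pos hL]; exact hp.le))
    refine (measure_mono hsub).trans ((meas_ge_le_lintegral_div (by fun_prop)
      (by simpa using hL.ne') ENNReal.ofReal_ne_top).trans_eq ?_)
    rw [hQ.lintegral_noise i (F := fun e => ENNReal.ofReal (e ^ 2)) (by fun_prop),
      lintegral_sq_stdNormal, ENNReal.ofReal_div_of_pos (by positivity), ENNReal.ofReal_one]
  calc ∑ i, Q {p | 2 * L < |pairCentred m p i|}
      ≤ ∑ i, (Q {p | L < |pairCentred m p i + p.2 i|} + Q {p | L < |p.2 i|}) := by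
        refine Finset.sum_le_sum fun i _ => (measure_mono fun p hp => ?_).trans
          (measure_union_le _ _)
        by_contra! h
        simp only [Set.mem_union, Set.mem_ofPred_eq, not_or, not_lt] at h
        have := abs_sub (pairCentred m p i + p.2 i) (p.2 i)
        rw [add_sub_cancel_right] at this
        exact absurd hp.out (by linarith)
    _ ≤ ENNReal.ofReal (n / L ^ 2) + ∑ _ : Fin n, ENNReal.ofReal (1 / L ^ 2) := by
        rw [Finset.sum_add_distrib]
        gcongr
        exact hnoise _
    _ = _ := by
        rw [Finset.sum_const, Finset.card_univ, Fintype.card_fin, nsmul_eq_mul,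
          ← ENNReal.ofReal_natCast, ← ENNReal.ofReal_mul (by positivity),
          ← ENNReal.ofReal_add (by positivity) (by positivity)]
        ring_nf

lemma lintegral_card_compl_tameTimes_le (hm : ∀ i, Measurable (m i)) (hκ : 0 ≤ κ)
    (Q : Measure (Pair n)) [IsProbabilityMeasure Q] :
    ∫⁻ p, (tameTimes m κ L p)ᶜ.card ∂Q
      ≤ ENNReal.ofReal (2 * (κ * n + 1)) + ∑ i, Q {p | 2 * L < |pairCentred m p i|} := by
  have hlarge : ∀ i, MeasurableSet {p : Pair n | 2 * L < |pairCentred m p i|} := fun i =>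
    measurableSet_lt measurable_const (measurable_pairCentred_apply hm i).abs
  have hcard : ∀ p, ((tameTimes m κ L p)ᶜ.card : ℝ≥0∞) ≤ (midTimes n κ)ᶜ.card
      + ∑ i, {p : Pair n | 2 * L < |pairCentred m p i|}.indicator 1 p := fun p => by
    have hsub : (tameTimes m κ L p)ᶜ
        ⊆ (midTimes n κ)ᶜ ∪ ({i | 2 * L < |pairCentred m p i|} : Finset (Fin n)) := fun i hi => by
      simpa [mem_tameTimes, imp_iff_not_or] using hi
    have hsum : (Finset.card {i : Fin n | 2 * L < |pairCentred m p i|} : ℝ≥0∞)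
        = ∑ i, {p : Pair n | 2 * L < |pairCentred m p i|}.indicator 1 p := by
      simp [Set.indicator_apply]
    rw [← hsum]
    exact_mod_cast (Finset.card_le_card hsub).trans (Finset.card_union_le _ _)
  refine (lintegral_mono hcard).trans ?_
  rw [lintegral_add_left measurable_const, lintegral_const, measure_univ, mul_one,
    lintegral_finsetSum _ fun i _ => measurable_one.indicator (hlarge i)]
  simp only [lintegral_indicator_one (hlarge _)]
  rw [← ENNReal.ofReal_natCast]
  gcongr
  exact card_compl_midTimes_le n hκ

lemma lintegral_sq_sub_one_stdNormal_le :
    ∫⁻ e, ENNReal.ofReal ((e ^ 2 - 1) ^ 2) ∂γ ≤ ENNReal.ofReal (stdNormalFourth + 1) := by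
  calc ∫⁻ e, ENNReal.ofReal ((e ^ 2 - 1) ^ 2) ∂γ
      ≤ ∫⁻ e, (ENNReal.ofReal (e ^ 4) + ENNReal.ofReal 1) ∂γ := by
        refine lintegral_mono fun e => ?_
        rw [← ENNReal.ofReal_add (by positivity) zero_le_one]
        exact ENNReal.ofReal_le_ofReal (by nlinarith [sq_nonneg e])
    _ = _ := by
        rw [lintegral_add_right _ measurable_const, lintegral_const, measure_univ, mul_one,
          lintegral_fourth_stdNormal, ENNReal.ofReal_add stdNormalFourth_nonneg zero_le_one]

lemma StdNormalNoise.lintegral_abs_sum_centred_mul_noise_le {Q : Measure (Pair n)}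
    [IsProbabilityMeasure Q] (hQ : StdNormalNoise Q) (hm : ∀ i, Measurable (m i))
    (hdep : ∀ i, DependsOn (m i) (Set.Iio i)) (hn : 0 < n) {r : ℝ} (hr : 0 < r) (hL : 0 < L) :
    ∫⁻ p, ENNReal.ofReal |∑ i ∈ tameTimes m κ L p, pairCentred m p i * p.2 i| ∂Q
      ≤ ENNReal.ofReal (r * n + (4 * L ^ 2) / r) := by
  refine lintegral_abs_le_of_sq (by positivity) (by positivity)
    ((hQ.lintegral_sq_sum_tameTimes_le hm hdep (f := fun v e => v * e) (c := 4 * L ^ 2)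
      (by fun_prop) (fun v => ?_) fun v hv => ?_).trans_eq ?_)
  · rw [integral_const_mul, integral_self_stdNormal, mul_zero]
  · simp only [mul_pow, ENNReal.ofReal_mul (sq_nonneg v)]
    rw [lintegral_const_mul _ (by fun_prop), lintegral_sq_stdNormal, mul_one]
    exact ENNReal.ofReal_le_ofReal (by nlinarith [sq_le_sq' (abs_le.1 hv).1 (abs_le.1 hv).2])
  · congr 1
    field_simp

lemma StdNormalNoise.lintegral_abs_sum_noise_sq_sub_one_le {Q : Measure (Pair n)}
    [IsProbabilityMeasure Q] (hQ : StdNormalNoise Q) (hm : ∀ i, Measurable (m i))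
    (hdep : ∀ i, DependsOn (m i) (Set.Iio i)) (hn : 0 < n) {r : ℝ} (hr : 0 < r) :
    ∫⁻ p, ENNReal.ofReal |∑ i ∈ tameTimes m κ L p, (p.2 i ^ 2 - 1)| ∂Q
      ≤ ENNReal.ofReal (r * n + (stdNormalFourth + 1) / r) := by
  have h4 := stdNormalFourth_nonneg
  refine lintegral_abs_le_of_sq (by positivity) (by positivity)
    ((hQ.lintegral_sq_sum_tameTimes_le hm hdep (f := fun _ e => e ^ 2 - 1)
      (c := stdNormalFourth + 1) (by fun_prop) (fun _ => ?_)
        fun _ _ => lintegral_sq_sub_one_stdNormal_le).trans_eq ?_)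
  · rw [integral_sub (integrable_pow_stdNormal 2) (integrable_const _), integral_sq_stdNormal]
    simp
  · congr 1
    field_simp

lemma StdNormalNoise.lintegral_linearLossError_le {Q : Measure (Pair n)} [IsProbabilityMeasure Q]
    (hQ : StdNormalNoise Q) (hm : ∀ i, Measurable (m i)) (hdep : ∀ i, DependsOn (m i) (Set.Iio i))
    (hn : 0 < n) {D r : ℝ} (hD : 0 ≤ D) (hr : 0 < r) (hκ : 0 ≤ κ) (hL : 0 < L)
    (htail : ∑ i, Q {p | L < |pairCentred m p i + p.2 i|} ≤ ENNReal.ofReal (n / L ^ 2)) :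
    ∫⁻ p, linearLossError D (tameTimes m κ L p) (pairCentred m p) p.2 ∂Q
      ≤ ENNReal.ofReal (r * n + (4 * L ^ 2) / r + (r * n + (stdNormalFourth + 1) / r)
        + D * (2 * (κ * n + 1) + 2 * (n / L ^ 2))) := by
  have h4 := stdNormalFourth_nonneg
  have hcard : ∫⁻ p, (tameTimes m κ L p)ᶜ.card ∂Q
      ≤ ENNReal.ofReal (2 * (κ * n + 1) + 2 * (n / L ^ 2)) :=
    (lintegral_card_compl_tameTimes_le hm hκ Q).trans
      ((add_le_add le_rfl (hQ.sum_measure_large_centred_le hL htail)).trans_eq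
        (ENNReal.ofReal_add (by positivity) (by positivity)).symm)
  rw [ENNReal.ofReal_add (q := D * _) (by positivity) (by positivity),
    ENNReal.ofReal_add (q := r * n + (stdNormalFourth + 1) / r) (by positivity) (by positivity),
    ENNReal.ofReal_mul hD]
  unfold linearLossError
  rw [lintegral_add_right _ ((measurable_card_compl_tameTimes hm).const_mul _),
    lintegral_add_right _ (measurable_sum_noise_sq_sub_one hm).abs.ennreal_ofReal,
    lintegral_const_mul' _ _ ENNReal.ofReal_ne_top]
  exact add_le_add (add_le_add (hQ.lintegral_abs_sum_centred_mul_noise_le hm hdep hn hr hL)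
    (hQ.lintegral_abs_sum_noise_sq_sub_one_le hm hdep hn hr)) (mul_le_mul_right hcard _)

end TameTimes

section Benchmark

variable {Ω : Type*} {n : ℕ} {μ ε W : Fin n → Ω → ℝ} {m : Fin n → (Fin n → ℝ) → ℝ} {A : Ω → ℝ}
  {κ L c : ℝ}

/-- The deviation `W_i - (A μ̃_i + (1 - A) Y_i)` of an estimator from the weighted average with the
weight `A`. -/
def weightRemainder (μ ε : Fin n → Ω → ℝ) (m : Fin n → (Fin n → ℝ) → ℝ) (W : Fin n → Ω → ℝ)
    (A : Ω → ℝ) (i : Fin n) (ω : Ω) : ℝ :=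
  W i ω - (A ω * m i (obs μ ε ω) + (1 - A ω) * obs μ ε ω i)

lemma sub_linear_centred_eq_weightRemainder (i : Fin n) (ω : Ω) :
    W i ω - μ i ω - ((1 - A ω) * (centred μ ε m ω i + ε i ω) - centred μ ε m ω i)
      = weightRemainder μ ε m W A i ω := by
  simp only [weightRemainder, centred, obs]
  ring

/-- At `ω`, the decision function `δ` improves on the linear rule with slope `1 - A`, truncated at
`1`, by `g` over the tame times, up to a cost of `c` for each of the other times. -/
def ImprovesLinear (μ ε : Fin n → Ω → ℝ) (m : Fin n → (Fin n → ℝ) → ℝ) (A : Ω → ℝ) (κ L c : ℝ)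
    (δ : ℝ → ℝ) (g : ℝ≥0∞) (ω : Ω) : Prop :=
  ∑ i ∈ tameTimes m κ L (pairOf μ ε ω), normalRisk δ (centred μ ε m ω i) + g
    ≤ ∑ i ∈ tameTimes m κ L (pairOf μ ε ω),
        normalRisk (fun z => min (1 - A ω) 1 * z) (centred μ ε m ω i)
      + ENNReal.ofReal c * (tameTimes m κ L (pairOf μ ε ω))ᶜ.card

lemma ImprovesLinear.sum_normalRisk_oracleDecision_add_le {ω : Ω} {δ : ℝ → ℝ} {g : ℝ≥0∞}
    (hg : ImprovesLinear μ ε m A κ L c δ g ω) (hδ : Measurable δ) (hA : A ω ≤ 1) {r T : ℝ}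
    (hr : 0 < r) (hT : 0 < T) (hc : 0 ≤ c) :
    ∑ i, normalRisk (oracleDecision Finset.univ (centred μ ε m ω)) (centred μ ε m ω i) + g
      ≤ ENNReal.ofReal (1 + r) * ENNReal.ofReal (∑ i, (W i ω - μ i ω) ^ 2)
        + ENNReal.ofReal (1 + r⁻¹)
            * ∑ i ∈ midTimes n κ, ENNReal.ofReal (weightRemainder μ ε m W A i ω ^ 2)
        + linearLossError (2 * (T ^ 2 + 1) + c) (tameTimes m κ L (pairOf μ ε ω))
            (pairCentred m (pairOf μ ε ω)) (pairOf μ ε ω).2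
        + ENNReal.ofReal (n * (4 * stdNormalFourth / T ^ 2)) := by
  have h := SeqEB.sum_normalRisk_oracleDecision_add_le (tameTimes m κ L (pairOf μ ε ω))
    (centred μ ε m ω) (fun i => ε i ω) (fun i => W i ω - μ i ω) (sub_nonneg.2 hA) hr hT hc hδ hg
  simp only [sub_linear_centred_eq_weightRemainder, Fintype.card_fin] at h
  refine h.trans (add_le_add (add_le_add (add_le_add le_rfl ?_) le_rfl) le_rfl)
  gcongr
  exact tameTimes_subset_midTimes _

variable [MeasurableSpace Ω] {P : Measure Ω}

lemma NoiseModel.measurable_weightRemainder (hmodel : NoiseModel P μ ε)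
    (hm : ∀ i, Measurable (m i)) (hW : ∀ i, Measurable (W i)) (hA : Measurable A) (i : Fin n) :
    Measurable (weightRemainder μ ε m W A i) :=
  (hW i).sub ((hA.mul ((hm i).comp hmodel.measurable_obs)).add
    ((measurable_const.sub hA).mul ((measurable_pi_apply i).comp hmodel.measurable_obs)))

lemma NoiseModel.risk_oracleIS_add_le [IsProbabilityMeasure P] (hmodel : NoiseModel P μ ε)
    (hm : ∀ i, Measurable (m i)) (hdep : ∀ i, DependsOn (m i) (Set.Iio i))
    (hW : ∀ i, Measurable (W i)) (hA : Measurable A) (hA1 : ∀ ω, A ω ≤ 1) (hn : 0 < n)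
    {r T ζ : ℝ} (hr : 0 < r) (hT : 0 < T) (hc : 0 ≤ c) (hκ : 0 ≤ κ) (hL : 0 < L)
    (htail : ∑ i, P {ω | L < |resid m (obs μ ε ω) i|} ≤ ENNReal.ofReal (n / L ^ 2))
    (hζ : ∀ i ∈ midTimes n κ,
      ∫⁻ ω, ENNReal.ofReal (weightRemainder μ ε m W A i ω ^ 2) ∂P ≤ ENNReal.ofReal ζ)
    {δ : Ω → ℝ → ℝ} (hδ : ∀ ω, Measurable (δ ω)) {g : Ω → ℝ≥0∞}
    (hg : ∀ ω, ImprovesLinear μ ε m A κ L c (δ ω) (g ω) ω) :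
    risk P μ (oracleIS μ ε m) + ∫⁻ ω, g ω ∂P
      ≤ ENNReal.ofReal (1 + r) * risk P μ W
        + ENNReal.ofReal (1 + r⁻¹) * (n * ENNReal.ofReal ζ)
        + ENNReal.ofReal (r * n + (4 * L ^ 2) / r + (r * n + (stdNormalFourth + 1) / r)
            + (2 * (T ^ 2 + 1) + c) * (2 * (κ * n + 1) + 2 * (n / L ^ 2)))
        + ENNReal.ofReal (n * (4 * stdNormalFourth / T ^ 2)) := by
  have hpair := hmodel.measurable_pairOf
  have hQ : IsProbabilityMeasure (P.map (pairOf μ ε)) :=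
    Measure.isProbabilityMeasure_map hpair.aemeasurable
  have hx : ∀ i, Measurable fun ω => ENNReal.ofReal (weightRemainder μ ε m W A i ω ^ 2) :=
    fun i => ((hmodel.measurable_weightRemainder hm hW hA i).pow_const 2).ennreal_ofReal
  have herror := measurable_linearLossError (κ := κ) (L := L) hm (2 * (T ^ 2 + 1) + c)
  have herrorΩ : Measurable fun ω => linearLossError (2 * (T ^ 2 + 1) + c)
      (tameTimes m κ L (pairOf μ ε ω)) (pairCentred m (pairOf μ ε ω)) (pairOf μ ε ω).2 :=
    herror.comp hpair
  calc risk P μ (oracleIS μ ε m) + ∫⁻ ω, g ω ∂P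
      ≤ _ := add_le_add (hmodel.risk_oracleIS_le hm hdep) le_rfl
    _ ≤ _ := le_lintegral_add _ _
    _ ≤ _ := lintegral_mono fun ω =>
        (hg ω).sum_normalRisk_oracleDecision_add_le (W := W) (hδ ω) (hA1 ω) hr hT hc
    _ = ENNReal.ofReal (1 + r) * risk P μ W
        + ENNReal.ofReal (1 + r⁻¹) * ∑ i ∈ midTimes n κ,
            ∫⁻ ω, ENNReal.ofReal (weightRemainder μ ε m W A i ω ^ 2) ∂P
        + ∫⁻ p, linearLossError (2 * (T ^ 2 + 1) + c) (tameTimes m κ L p) (pairCentred m p) p.2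
            ∂(P.map (pairOf μ ε))
        + ENNReal.ofReal (n * (4 * stdNormalFourth / T ^ 2)) := by
        rw [lintegral_add_right _ measurable_const, lintegral_add_right _ herrorΩ,
          lintegral_add_right _ ((Finset.measurable_fun_sum _ fun i _ => hx i).const_mul _),
          lintegral_const_mul' _ _ ENNReal.ofReal_ne_top,
          lintegral_const_mul' _ _ ENNReal.ofReal_ne_top, lintegral_finsetSum _ fun i _ => hx i,
          lintegral_const, measure_univ, mul_one, lintegral_map herror hpair]
        rfl
    _ ≤ _ := by
        gcongr
        · refine (Finset.sum_le_card_nsmul _ _ _ hζ).trans ?_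
          rw [nsmul_eq_mul]
          gcongr
          exact (Finset.card_le_univ _).trans_eq (Fintype.card_fin n)
        · exact hmodel.stdNormalNoise.lintegral_linearLossError_le hm hdep hn (by positivity) hr hκ
            hL ((Finset.sum_congr rfl fun i _ => hmodel.map_pairOf_large_resid hm i L).trans_le
              htail)

end Benchmark

/-! ### Linear rules are improvable unless the prior is normal -/

section Mixture

variable (G : Measure ℝ)

/-- The density of `G ∗ N(0,1)`. -/
noncomputable def mixtureDensity (z : ℝ) : ℝ := ∫ v, φ (z - v) ∂G

/-- The derivative of the density of `G ∗ N(0,1)`. -/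
noncomputable def mixtureDensityDeriv (z : ℝ) : ℝ := ∫ v, stdPDFDeriv (z - v) ∂G

/-- The difference between the linear rule `b z` and the Bayes rule for the prior `G`, multiplied by
the density of `G ∗ N(0,1)` at `z`. -/
noncomputable def linearResidual (b z : ℝ) : ℝ := ∫ v, φ (z - v) * (b * z - v) ∂G

lemma mixtureDensity_nonneg (z : ℝ) : 0 ≤ mixtureDensity G z :=
  integral_nonneg fun _ => (stdPDF_pos _).le

variable [IsFiniteMeasure G]

lemma integrable_stdPDF_sub (z : ℝ) : Integrable (fun v => φ (z - v)) G :=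
  .of_bound (continuous_stdPDF.comp (by fun_prop)).aestronglyMeasurable 1
    (ae_of_all _ fun _ => abs_stdPDF_le_one _)

lemma integrable_stdPDFDeriv_sub (z : ℝ) : Integrable (fun v => stdPDFDeriv (z - v)) G :=
  .of_bound (continuous_stdPDFDeriv.comp (by fun_prop)).aestronglyMeasurable 1
    (ae_of_all _ fun _ => abs_stdPDFDeriv_le_one _)

lemma hasDerivAt_mixtureDensity (z : ℝ) :
    HasDerivAt (mixtureDensity G) (mixtureDensityDeriv G z) z :=
  (hasDerivAt_integral_of_dominated_loc_of_deriv_le (F := fun z v => φ (z - v))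
    (F' := fun z v => stdPDFDeriv (z - v)) (bound := fun _ => 1) univ_mem
    (Eventually.of_forall fun x => (integrable_stdPDF_sub G x).aestronglyMeasurable)
    (integrable_stdPDF_sub G z) (integrable_stdPDFDeriv_sub G z).aestronglyMeasurable
    (ae_of_all _ fun _ _ _ => abs_stdPDFDeriv_le_one _) (integrable_const _)
    (ae_of_all _ fun v x _ => (hasDerivAt_stdPDF (x - v)).comp_sub_const x v)).2

lemma continuous_mixtureDensity : Continuous (mixtureDensity G) :=
  continuous_iff_continuousAt.2 fun z => (hasDerivAt_mixtureDensity G z).continuousAt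

lemma continuous_mixtureDensityDeriv : Continuous (mixtureDensityDeriv G) :=
  continuous_of_dominated (bound := fun _ => 1)
    (fun z => (integrable_stdPDFDeriv_sub G z).aestronglyMeasurable)
    (fun _ => ae_of_all _ fun _ => abs_stdPDFDeriv_le_one _) (integrable_const _)
    (ae_of_all _ fun _ => continuous_stdPDFDeriv.comp (by fun_prop))

lemma stdPDF_mul_linear_eq (b z v : ℝ) :
    φ (z - v) * (b * z - v) = -stdPDFDeriv (z - v) - (1 - b) * z * φ (z - v) := by
  unfold stdPDFDeriv
  ring

lemma linearResidual_eq (b z : ℝ) :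
    linearResidual G b z = -mixtureDensityDeriv G z - (1 - b) * z * mixtureDensity G z := by
  have hneg : Integrable (fun v => -stdPDFDeriv (z - v)) G := (integrable_stdPDFDeriv_sub G z).neg
  simp only [linearResidual, stdPDF_mul_linear_eq]
  rw [integral_sub hneg ((integrable_stdPDF_sub G z).const_mul _), integral_neg,
    integral_const_mul]
  rfl

lemma continuous_linearResidual (b : ℝ) : Continuous (linearResidual G b) := by
  have hdensity := continuous_mixtureDensity G
  have hderiv := continuous_mixtureDensityDeriv G
  rw [funext (linearResidual_eq G b)]
  fun_prop

lemma conv_stdNormal_eq_withDensity :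
    G ∗ γ = (volume : Measure ℝ).withDensity fun z => ENNReal.ofReal (mixtureDensity G z) := by
  have hφ := measurable_gaussianPDFReal 0 1
  ext S hS
  have hind : Measurable (S.indicator (1 : ℝ → ℝ≥0∞)) := measurable_one.indicator hS
  rw [← lintegral_indicator_one hS, Measure.lintegral_conv hind, withDensity_apply _ hS,
    ← lintegral_indicator hS]
  simp only [lintegral_stdNormal_add hind]
  rw [lintegral_lintegral_swap]
  · refine lintegral_congr fun z => ?_
    have hdensity : ENNReal.ofReal (mixtureDensity G z) = ∫⁻ v, ENNReal.ofReal (φ (z - v)) ∂G :=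
      ofReal_integral_eq_lintegral_ofReal (integrable_stdPDF_sub G z)
        (ae_of_all _ fun v => (stdPDF_pos _).le)
    by_cases h : z ∈ S <;> simp [h, hdensity]
  · refine Measurable.aemeasurable ?_
    exact ((hφ.comp (measurable_snd.sub measurable_fst)).ennreal_ofReal).mul
      (hind.comp measurable_snd)

lemma mixtureDensity_eq_mul_exp {a : ℝ} (h : ∀ z, linearResidual G (1 - a) z = 0) (z : ℝ) :
    mixtureDensity G z = mixtureDensity G 0 * Real.exp (-(a * z ^ 2 / 2)) := by
  have hderiv : ∀ z, HasDerivAt (fun z => mixtureDensity G z * Real.exp (a * z ^ 2 / 2)) 0 z := by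
    intro z
    have hsq : HasDerivAt (fun z : ℝ => a * z ^ 2 / 2) (a * z) z :=
      (((hasDerivAt_pow 2 z).const_mul a).div_const 2).congr_deriv (by push_cast; ring)
    refine ((hasDerivAt_mixtureDensity G z).mul hsq.exp).congr_deriv ?_
    have hzero := (linearResidual_eq G (1 - a) z).symm.trans (h z)
    linear_combination -Real.exp (a * z ^ 2 / 2) * hzero
  have hconst := is_const_of_deriv_eq_zero (fun z => (hderiv z).differentiableAt)
    (fun z => (hderiv z).deriv) z 0
  rw [Real.exp_neg, ← div_eq_mul_inv, eq_div_iff (Real.exp_pos _).ne', hconst]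
  simp

end Mixture

section Deconvolution

lemma exp_neg_mul_sq_eq_gaussianPDFReal {a : ℝ} (ha : 0 < a) (z : ℝ) :
    Real.exp (-(a * z ^ 2 / 2))
      = √(2 * Real.pi * a⁻¹) * gaussianPDFReal 0 (Real.toNNReal a⁻¹) z := by
  have hroot : √(2 * Real.pi * a⁻¹) ≠ 0 := by positivity
  rw [gaussianPDFReal, Real.coe_toNNReal _ (inv_pos.2 ha).le, mul_inv_cancel_left₀ hroot]
  congr 1
  field_simp
  ring

lemma conv_stdNormal_eq_gaussianReal (G : Measure ℝ) [IsProbabilityMeasure G] {a : ℝ} (ha : 0 < a)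
    (h : ∀ z, linearResidual G (1 - a) z = 0) :
    G ∗ γ = gaussianReal 0 (Real.toNNReal a⁻¹) := by
  set c := mixtureDensity G 0 * √(2 * Real.pi * a⁻¹) with hc
  have hc0 : 0 ≤ c := mul_nonneg (mixtureDensity_nonneg G 0) (Real.sqrt_nonneg _)
  have hsmul : G ∗ γ = ENNReal.ofReal c • gaussianReal 0 (Real.toNNReal a⁻¹) := by
    rw [conv_stdNormal_eq_withDensity,
      gaussianReal_of_var_ne_zero 0 (Real.toNNReal_pos.2 (inv_pos.2 ha)).ne',
      ← withDensity_smul _ (measurable_gaussianPDF _ _)]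
    congr 1
    funext z
    rw [Pi.smul_apply, smul_eq_mul, gaussianPDF, ← ENNReal.ofReal_mul hc0,
      mixtureDensity_eq_mul_exp G h, exp_neg_mul_sq_eq_gaussianPDFReal ha, hc,
      mul_assoc (mixtureDensity G 0)]
  have hone : ENNReal.ofReal c = 1 := by
    simpa using (congrArg (fun ν : Measure ℝ => ν Set.univ) hsmul).symm
  rw [hsmul, hone, one_smul]

lemma eq_of_conv_stdNormal_eq {G G' : Measure ℝ} [IsFiniteMeasure G] [IsFiniteMeasure G']
    (h : G ∗ γ = G' ∗ γ) : G = G' := by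
  refine Measure.ext_of_charFun (funext fun t => ?_)
  have hchar : charFun γ t ≠ 0 := by
    rw [charFun_gaussianReal]
    exact Complex.exp_ne_zero _
  exact mul_right_cancel₀ hchar (by rw [← charFun_conv, ← charFun_conv, h])

lemma exists_linearResidual_ne_zero (G : Measure ℝ) [IsProbabilityMeasure G] {a : ℝ} (ha : 0 < a)
    (ha1 : a ≤ 1) (hG : G ≠ gaussianReal 0 (Real.toNNReal ((1 - a) / a))) :
    ∃ z, linearResidual G (1 - a) z ≠ 0 := by
  by_contra! h
  refine hG (eq_of_conv_stdNormal_eq ?_)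
  have hvar : Real.toNNReal ((1 - a) / a) + 1 = Real.toNNReal a⁻¹ := by
    rw [← Real.toNNReal_one, ← Real.toNNReal_add (div_nonneg (sub_nonneg.2 ha1) ha.le) zero_le_one]
    congr 1
    field_simp
    ring
  rw [conv_stdNormal_eq_gaussianReal G ha h, gaussianReal_conv_gaussianReal, hvar, add_zero]

end Deconvolution

section Perturbation

/-- The `N(0,1)`-inner product of the perturbation `h` with the error of the linear rule `β z`, at
the state `v`. -/
noncomputable def linearScore (h : ℝ → ℝ) (β v : ℝ) : ℝ := ∫ e, h (v + e) * (β * (v + e) - v) ∂γ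

/-- The amount by which the risk of the linear rule `β z` at the state `v` drops when the rule is
replaced by `β z - t h z`. -/
noncomputable def perturbGain (h : ℝ → ℝ) (t β v : ℝ) : ℝ :=
  2 * t * linearScore h β v - t ^ 2 * ∫ e, h (v + e) ^ 2 ∂γ

lemma exists_hasCompactSupport_integral_mul_pos {u : ℝ → ℝ} (hu : Continuous u) {z₀ : ℝ}
    (hz₀ : u z₀ ≠ 0) :
    ∃ h : ℝ → ℝ, Continuous h ∧ HasCompactSupport h ∧ 0 < ∫ z, h z * u z := by
  let χ : ContDiffBump z₀ := default
  have hsupp : HasCompactSupport fun z => u z * χ z := χ.hasCompactSupport.mul_left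
  refine ⟨fun z => u z * χ z, hu.mul χ.continuous, hsupp, ?_⟩
  refine ((hu.mul χ.continuous).mul hu).integral_pos_of_hasCompactSupport_nonneg_nonzero
    (x := z₀) hsupp.mul_right (fun z => ?_) ?_
  · calc 0 ≤ χ z * u z ^ 2 := mul_nonneg χ.nonneg (sq_nonneg _)
      _ = u z * χ z * u z := by ring
  · simpa [χ.one_of_mem_closedBall (Metric.mem_closedBall_self χ.rIn_pos.le)] using hz₀

variable {h : ℝ → ℝ}

lemma memLp_two_comp_add (hh : Measurable h) {H : ℝ} (hH : ∀ z, |h z| ≤ H) (v : ℝ) :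
    MemLp (fun e => h (v + e)) 2 γ :=
  .of_bound (hh.comp (by fun_prop)).aestronglyMeasurable H (ae_of_all _ fun _ => hH _)

lemma integrable_perturb_mul_linear_sub (hh : Measurable h) {H : ℝ} (hH : ∀ z, |h z| ≤ H)
    (β v : ℝ) : Integrable (fun e => h (v + e) * (β * (v + e) - v)) γ :=
  (memLp_two_comp_add hh hH v).integrable_mul (memLp_linear_sub β v)

lemma integral_sq_linear_sub_perturb (hh : Measurable h) {H : ℝ} (hH : ∀ z, |h z| ≤ H)
    (t β v : ℝ) :
    ∫ e, (β * (v + e) - t * h (v + e) - v) ^ 2 ∂γ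
      = (1 - β) ^ 2 * v ^ 2 + β ^ 2 - perturbGain h t β v := by
  have hexpand : ∀ e, (β * (v + e) - t * h (v + e) - v) ^ 2 = (β * (v + e) - v) ^ 2
      - (2 * t * (h (v + e) * (β * (v + e) - v)) - t ^ 2 * h (v + e) ^ 2) := fun e => by ring
  have hscore := (integrable_perturb_mul_linear_sub hh hH β v).const_mul (2 * t)
  have hsq := (memLp_two_comp_add hh hH v).integrable_sq.const_mul (t ^ 2)
  have hdiff : Integrable
      (fun e => 2 * t * (h (v + e) * (β * (v + e) - v)) - t ^ 2 * h (v + e) ^ 2) γ := hscore.sub hsq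
  simp only [hexpand]
  rw [integral_sub (memLp_linear_sub β v).integrable_sq hdiff, integral_sub hscore hsq,
    integral_sq_linear_sub, integral_const_mul, integral_const_mul]
  rfl

lemma normalRisk_linear_sub_perturb (hh : Measurable h) {H : ℝ} (hH : ∀ z, |h z| ≤ H)
    (t β v : ℝ) :
    normalRisk (fun z => β * z - t * h z) v
      = ENNReal.ofReal ((1 - β) ^ 2 * v ^ 2 + β ^ 2 - perturbGain h t β v) := by
  rw [← integral_sq_linear_sub_perturb hh hH, normalRisk_eq_ofReal_integral]
  simpa only [Pi.sub_apply, sub_right_comm] using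
    ((memLp_linear_sub β v).sub ((memLp_two_comp_add hh hH v).const_mul t)).integrable_sq

lemma linearScore_eq (h : ℝ → ℝ) (β v : ℝ) :
    linearScore h β v = ∫ z, h z * (φ (z - v) * (β * z - v)) := by
  rw [linearScore, integral_gaussianReal_eq_integral_smul one_ne_zero,
    ← integral_add_left_eq_self (fun z => h z * (φ (z - v) * (β * z - v))) v]
  refine integral_congr_ae (ae_of_all _ fun e => ?_)
  simp only [smul_eq_mul, add_sub_cancel_left]
  ring

lemma abs_stdPDF_mul_linear_le (b z v : ℝ) :
    |φ (z - v) * (b * z - v)| ≤ 1 + |1 - b| * |z| := by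
  rw [stdPDF_mul_linear_eq]
  refine (abs_sub _ _).trans (add_le_add ((abs_neg _).trans_le (abs_stdPDFDeriv_le_one _)) ?_)
  rw [abs_mul, abs_mul]
  exact mul_le_of_le_one_right (by positivity) (abs_stdPDF_le_one _)

lemma integral_linearScore (hh : Continuous h) (hs : HasCompactSupport h) (G : Measure ℝ)
    [IsFiniteMeasure G] (b : ℝ) : ∫ v, linearScore h b v ∂G = ∫ z, h z * linearResidual G b z := by
  have hφ := continuous_stdPDF
  have hbound : Integrable fun z => |h z| * (1 + |1 - b| * |z|) :=
    Continuous.integrable_of_hasCompactSupport (by fun_prop)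
      (hs.comp_left (g := fun x => |x|) abs_zero).mul_right
  simp only [linearScore_eq]
  rw [integral_integral_swap]
  · simp only [integral_const_mul, linearResidual]
  · refine Integrable.mono' (hbound.comp_snd G) (Continuous.aestronglyMeasurable ?_)
      (ae_of_all _ fun q => ?_)
    · simp only [Function.uncurry_def]
      fun_prop
    · exact (abs_mul _ _).trans_le
        (mul_le_mul_of_nonneg_left (abs_stdPDF_mul_linear_le b q.2 q.1) (abs_nonneg _))

variable {H C : ℝ}

lemma perturb_mul_linear_sub_eq (h : ℝ → ℝ) (β v e : ℝ) :
    h (v + e) * (β * (v + e) - v) = h (v + e) * e - (1 - β) * ((v + e) * h (v + e)) := by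
  ring

lemma abs_perturb_mul_linear_sub_le (hH : ∀ z, |h z| ≤ H) (hC : ∀ z, |z * h z| ≤ C) (β v e : ℝ) :
    |h (v + e) * (β * (v + e) - v)| ≤ H * |e| + |1 - β| * C := by
  rw [perturb_mul_linear_sub_eq]
  refine (abs_sub _ _).trans (add_le_add ?_ ?_) <;> rw [abs_mul]
  · exact mul_le_mul_of_nonneg_right (hH _) (abs_nonneg _)
  · exact mul_le_mul_of_nonneg_left (hC _) (abs_nonneg _)

lemma integrable_perturb_bound (H c : ℝ) : Integrable (fun e => H * |e| + c) γ := by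
  have habs : Integrable (fun e : ℝ => |e|) γ := by simpa using (integrable_pow_stdNormal 1).abs
  exact (habs.const_mul H).add (integrable_const c)

lemma continuous_linearScore (hh : Continuous h) (hH : ∀ z, |h z| ≤ H) (hC : ∀ z, |z * h z| ≤ C)
    (β : ℝ) : Continuous (linearScore h β) :=
  continuous_of_dominated (fun _ => Continuous.aestronglyMeasurable (by fun_prop))
    (fun v => ae_of_all _ (abs_perturb_mul_linear_sub_le hH hC β v))
    (integrable_perturb_bound H _) (ae_of_all _ fun e => by fun_prop)

lemma abs_linearScore_le (hH : ∀ z, |h z| ≤ H) (hC : ∀ z, |z * h z| ≤ C) (β v : ℝ) :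
    |linearScore h β v| ≤ ∫ e, (H * |e| + |1 - β| * C) ∂γ :=
  norm_integral_le_of_norm_le (f := fun e => h (v + e) * (β * (v + e) - v))
    (integrable_perturb_bound H (|1 - β| * C))
    (ae_of_all _ (abs_perturb_mul_linear_sub_le hH hC β v))

lemma abs_linearScore_sub_le (hh : Measurable h) (hH : ∀ z, |h z| ≤ H) (hC : ∀ z, |z * h z| ≤ C)
    (β b v : ℝ) : |linearScore h β v - linearScore h b v| ≤ C * |β - b| := by
  rw [linearScore, linearScore, ← integral_sub (integrable_perturb_mul_linear_sub hh hH β v)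
    (integrable_perturb_mul_linear_sub hh hH b v)]
  suffices hpoint : ∀ e,
      ‖h (v + e) * (β * (v + e) - v) - h (v + e) * (b * (v + e) - v)‖ ≤ C * |β - b| from
    (norm_integral_le_of_norm_le_const (ae_of_all γ hpoint)).trans_eq
      (by rw [probReal_univ, mul_one])
  intro e
  have hfactor : h (v + e) * (β * (v + e) - v) - h (v + e) * (b * (v + e) - v)
      = (v + e) * h (v + e) * (β - b) := by ring
  rw [hfactor, Real.norm_eq_abs, abs_mul]
  exact mul_le_mul_of_nonneg_right (hC _) (abs_nonneg _)

lemma continuous_integral_sq_comp_add (hh : Continuous h) (hH : ∀ z, |h z| ≤ H) :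
    Continuous fun v => ∫ e, h (v + e) ^ 2 ∂γ :=
  continuous_of_dominated (bound := fun _ => H ^ 2)
    (fun _ => Continuous.aestronglyMeasurable (by fun_prop))
    (fun _ => ae_of_all _ fun _ => by
      rw [Real.norm_eq_abs, abs_pow]
      exact pow_le_pow_left₀ (abs_nonneg _) (hH _) 2)
    (integrable_const _) (ae_of_all _ fun _ => by fun_prop)

lemma integral_sq_comp_add_le (hH : ∀ z, |h z| ≤ H) (v : ℝ) :
    ∫ e, h (v + e) ^ 2 ∂γ ≤ H ^ 2 := by
  refine (integral_mono_of_nonneg (ae_of_all _ fun _ => sq_nonneg _) (integrable_const (H ^ 2))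
    (ae_of_all _ fun e => ?_)).trans_eq (by simp)
  exact sq_le_sq' (abs_le.1 (hH _)).1 (abs_le.1 (hH _)).2

lemma exists_perturbGain_boundedContinuous (hh : Continuous h) (hH : ∀ z, |h z| ≤ H)
    (hC : ∀ z, |z * h z| ≤ C) (t b : ℝ) : ∃ g : ℝ →ᵇ ℝ, ∀ v, g v = perturbGain h t b v := by
  have hscore := continuous_linearScore hh hH hC b
  have hsq := continuous_integral_sq_comp_add hh hH
  refine ⟨BoundedContinuousFunction.ofNormedAddCommGroup (perturbGain h t b)
    (by unfold perturbGain; fun_prop)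
    (|2 * t| * ∫ e, (H * |e| + |1 - b| * C) ∂γ + t ^ 2 * H ^ 2) fun v => ?_, fun _ => rfl⟩
  refine (norm_sub_le _ _).trans (add_le_add ?_ ?_) <;> rw [norm_mul, Real.norm_eq_abs]
  · exact mul_le_mul_of_nonneg_left (abs_linearScore_le hH hC b v) (abs_nonneg _)
  · rw [abs_of_nonneg (sq_nonneg t), Real.norm_of_nonneg (integral_nonneg fun _ => sq_nonneg _)]
    exact mul_le_mul_of_nonneg_left (integral_sq_comp_add_le hH v) (sq_nonneg t)

lemma exists_integral_perturbGain_pos (hh : Continuous h) (hH : ∀ z, |h z| ≤ H)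
    (hC : ∀ z, |z * h z| ≤ C) {G : Measure ℝ} [IsProbabilityMeasure G] {b : ℝ}
    (hp : 0 < ∫ v, linearScore h b v ∂G) : ∃ t, 0 < t ∧ 0 < ∫ v, perturbGain h t b v ∂G := by
  set p := ∫ v, linearScore h b v ∂G
  have hscore : Integrable (linearScore h b) G :=
    .of_bound (continuous_linearScore hh hH hC b).aestronglyMeasurable _
      (ae_of_all _ (abs_linearScore_le hH hC b))
  have hsq : Integrable (fun v => ∫ e, h (v + e) ^ 2 ∂γ) G :=
    .of_bound (continuous_integral_sq_comp_add hh hH).aestronglyMeasurable (H ^ 2)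
      (ae_of_all _ fun v => by
        rw [Real.norm_of_nonneg (integral_nonneg fun _ => sq_nonneg _)]
        exact integral_sq_comp_add_le hH v)
  have hsq_le : ∫ v, (∫ e, h (v + e) ^ 2 ∂γ) ∂G ≤ H ^ 2 :=
    (integral_mono hsq (integrable_const _) (integral_sq_comp_add_le hH)).trans_eq (by simp)
  have ht : 0 < p / (H ^ 2 + 1) := by positivity
  have hpt : p = p / (H ^ 2 + 1) * (H ^ 2 + 1) := by field_simp
  refine ⟨p / (H ^ 2 + 1), ht, ?_⟩
  unfold perturbGain
  rw [integral_sub (hscore.const_mul _) (hsq.const_mul _), integral_const_mul, integral_const_mul]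
  change 0 < 2 * (p / (H ^ 2 + 1)) * p - _
  generalize p / (H ^ 2 + 1) = t at ht hpt ⊢
  have hquad := mul_le_mul_of_nonneg_left hsq_le (sq_nonneg t)
  rw [hpt]
  nlinarith [sq_nonneg H, mul_pos ht ht]

lemma exists_linear_improvement (G : Measure ℝ) [IsProbabilityMeasure G] {b : ℝ}
    (hG : ∃ z, linearResidual G b z ≠ 0) :
    ∃ (k : ℝ → ℝ) (g : ℝ →ᵇ ℝ) (C : ℝ), Measurable k ∧ 0 ≤ C ∧ 0 < ∫ v, g v ∂G ∧
      ∀ β v, 0 ≤ (1 - β) ^ 2 * v ^ 2 + β ^ 2 - g v + C * |β - b| ∧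
        normalRisk (fun z => β * z - k z) v
          ≤ ENNReal.ofReal ((1 - β) ^ 2 * v ^ 2 + β ^ 2 - g v + C * |β - b|) := by
  obtain ⟨z₀, hz₀⟩ := hG
  obtain ⟨h, hh, hs, hpos⟩ :=
    exists_hasCompactSupport_integral_mul_pos (continuous_linearResidual G b) hz₀
  obtain ⟨H, hH⟩ := hs.exists_bound_of_continuous hh
  obtain ⟨C, hC⟩ := hs.mul_left.exists_bound_of_continuous (continuous_id.mul hh)
  obtain ⟨t, ht, hgain⟩ := exists_integral_perturbGain_pos hh hH hC
    ((integral_linearScore hh hs G b).symm ▸ hpos)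
  obtain ⟨g, hg⟩ := exists_perturbGain_boundedContinuous hh hH hC t b
  have hC0 : 0 ≤ C := (norm_nonneg _).trans (hC 0)
  refine ⟨fun z => t * h z, g, 2 * t * C, (hh.measurable.const_mul t), by positivity, ?_,
    fun β v => ?_⟩
  · simpa only [hg] using hgain
  have hnonneg : 0 ≤ (1 - β) ^ 2 * v ^ 2 + β ^ 2 - perturbGain h t β v :=
    integral_sq_linear_sub_perturb hh.measurable hH t β v ▸ integral_nonneg fun _ => sq_nonneg _
  have hle : perturbGain h t b v - perturbGain h t β v ≤ 2 * t * C * |β - b| := by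
    have hscore := (abs_le.1 (abs_linearScore_sub_le hh.measurable hH hC β b v)).1
    unfold perturbGain
    nlinarith
  rw [hg, normalRisk_linear_sub_perturb hh.measurable hH]
  exact ⟨by linarith, ENNReal.ofReal_le_ofReal (by linarith)⟩

end Perturbation

/-! ### Asymptotics -/

lemma leUpToLittleO_of_forall_eventually_le {A B : ℕ → ℝ≥0∞}
    (hle : ∀ r : ℝ, 0 < r → ∀ᶠ n in atTop, A n ≤ B n + ENNReal.ofReal (r * n)) :
    LeUpToLittleO A B := by
  have hsub : ∀ r : ℝ, 0 < r → ∀ᶠ n in atTop, A n - B n ≤ ENNReal.ofReal (r * n) := fun r hr =>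
    (hle r hr).mono fun n hn => tsub_le_iff_left.2 hn
  refine ⟨fun n => (A n - B n).toReal, Asymptotics.isLittleO_iff.2 fun c hc => ?_, ?_⟩
  · filter_upwards [hsub c hc] with n hn
    rw [Real.norm_of_nonneg ENNReal.toReal_nonneg, Real.norm_of_nonneg (Nat.cast_nonneg n)]
    exact ENNReal.toReal_le_of_le_ofReal (by positivity) hn
  · filter_upwards [hsub 1 one_pos] with n hn
    rw [ENNReal.ofReal_toReal (ne_top_of_le_ne_top ENNReal.ofReal_ne_top hn)]
    exact le_add_tsub

lemma add_le_mul_of_add_le {O B : ℝ≥0∞} {N q : ℝ} (hN : 0 ≤ N) (hq : 0 ≤ q) (hO : O ≠ ∞)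
    (hB : B ≤ ENNReal.ofReal (4 * N)) (hgain : O + ENNReal.ofReal (q * N)
      ≤ ENNReal.ofReal (1 + q / 12) * B + ENNReal.ofReal (q / 12 * N)) :
    O + ENNReal.ofReal (q / 12 * N) ≤ ENNReal.ofReal (1 - q / 8) * B := by
  obtain ⟨o, ho, rfl⟩ : ∃ o : ℝ, 0 ≤ o ∧ ENNReal.ofReal o = O :=
    ⟨O.toReal, ENNReal.toReal_nonneg, ENNReal.ofReal_toReal hO⟩
  obtain ⟨b, hb, rfl⟩ : ∃ b : ℝ, 0 ≤ b ∧ ENNReal.ofReal b = B :=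
    ⟨B.toReal, ENNReal.toReal_nonneg,
      ENNReal.ofReal_toReal (ne_top_of_le_ne_top ENNReal.ofReal_ne_top hB)⟩
  rw [ENNReal.ofReal_le_ofReal_iff (by positivity)] at hB
  rw [← ENNReal.ofReal_mul (by positivity), ← ENNReal.ofReal_add ho (by positivity),
    ← ENNReal.ofReal_add (by positivity) (by positivity),
    ENNReal.ofReal_le_ofReal_iff (by positivity)] at hgain
  rw [← ENNReal.ofReal_add ho (by positivity), ← ENNReal.ofReal_mul' hb]
  refine ENNReal.ofReal_le_ofReal ?_
  have hqb : q * b ≤ q * (4 * N) := mul_le_mul_of_nonneg_left hB hq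
  linarith

lemma exists_eventually_le_mul {E O B : ℕ → ℝ≥0∞} {q : ℝ} (hq : 0 < q)
    (hEO : ∀ r : ℝ, 0 < r → ∀ᶠ n in atTop, E n ≤ O n + ENNReal.ofReal (r * n))
    (hO : ∀ n : ℕ, O n ≤ n)
    (hgain : ∀ r : ℝ, 0 < r → ∀ᶠ n in atTop,
      O n + ENNReal.ofReal (q * n) ≤ ENNReal.ofReal (1 + r) * B n + ENNReal.ofReal (r * n)) :
    ∃ c : ℝ, 0 < c ∧ c < 1 ∧ ∀ᶠ n in atTop, E n ≤ ENNReal.ofReal c * B n := by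
  refine ⟨max (1 / 2) (1 - q / 8), lt_max_of_lt_left (by norm_num),
    max_lt (by norm_num) (by linarith), ?_⟩
  filter_upwards [hEO 1 one_pos, hEO (q / 12) (by positivity), hgain (q / 12) (by positivity)]
    with n hE_one hE_small hgain_n
  have hn : (0 : ℝ) ≤ n := Nat.cast_nonneg n
  rcases le_total (ENNReal.ofReal (4 * n)) (B n) with hB | hB
  · calc E n ≤ ENNReal.ofReal n + ENNReal.ofReal (1 * n) :=
          hE_one.trans (add_le_add ((hO n).trans_eq (ENNReal.ofReal_natCast n).symm) le_rfl)
      _ = ENNReal.ofReal (1 / 2) * ENNReal.ofReal (4 * n) := by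
          rw [← ENNReal.ofReal_add hn (by positivity), ← ENNReal.ofReal_mul (by norm_num)]
          congr 1
          ring
      _ ≤ _ := mul_le_mul' (ENNReal.ofReal_le_ofReal (le_max_left _ _)) hB
  · calc E n ≤ ENNReal.ofReal (1 - q / 8) * B n := hE_small.trans (add_le_mul_of_add_le hn hq.le
          (ne_top_of_le_ne_top (ENNReal.natCast_ne_top n) (hO n)) hB hgain_n)
      _ ≤ _ := mul_le_mul' (ENNReal.ofReal_le_ofReal (le_max_right _ _)) le_rfl

lemma tendsto_log_natCast : Tendsto (fun n : ℕ => Real.log n) atTop atTop :=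
  Real.tendsto_log_atTop.comp tendsto_natCast_atTop_atTop

lemma eventually_const_mul_log_pow_le (B : ℝ) (k : ℕ) {q : ℝ} (hq : 0 < q) :
    ∀ᶠ n : ℕ in atTop, B * Real.log n ^ k ≤ q * n := by
  have hlittle : (fun n : ℕ => B * Real.log n ^ k) =o[atTop] fun n : ℕ => (n : ℝ) :=
    (Real.isLittleO_pow_log_id_atTop.comp_tendsto tendsto_natCast_atTop_atTop).const_mul_left B
  filter_upwards [hlittle.def hq] with n hn
  exact (le_abs_self _).trans (hn.trans_eq (by rw [Real.norm_natCast]))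

section Arrays

variable {Ω : Type*}

lemma improvesLinear_zero {n : ℕ} (μ ε : Fin n → Ω → ℝ) (m : Fin n → (Fin n → ℝ) → ℝ) (A : Ω → ℝ)
    (κ L c : ℝ) (ω : Ω) :
    ImprovesLinear μ ε m A κ L c (fun z => min (1 - A ω) 1 * z) 0 ω :=
  (add_zero _).trans_le le_self_add

variable [MeasurableSpace Ω] {P : Measure Ω}
  {μ ε W : ∀ n : ℕ, Fin n → Ω → ℝ} {m : ∀ n : ℕ, Fin n → (Fin n → ℝ) → ℝ} {A : ℕ → Ω → ℝ}

/-- The estimators `W` are asymptotically the weighted averages `A μ̃_i + (1 - A) Y_i`. Unlike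
`AsympWeightedAverage`, this does not make `W` and the weights `A` functions of the observations. -/
structure AsympRandomWeightedAverage (P : Measure Ω) (μ ε : ∀ n, Fin n → Ω → ℝ)
    (m : ∀ n, Fin n → (Fin n → ℝ) → ℝ) (W : ∀ n, Fin n → Ω → ℝ) (A : ℕ → Ω → ℝ) : Prop where
  measurable : ∀ n i, Measurable (W n i)
  measurable_weight : ∀ n, Measurable (A n)
  weight_le_one : ∀ n ω, A n ω ≤ 1
  remainder : ∀ κ : ℝ, 0 < κ → ∀ r : ℝ≥0∞, 0 < r → ∀ᶠ n : ℕ in atTop, ∀ i : Fin n,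
    κ * n ≤ (i : ℕ) + 1 → ((i : ℕ) + 1 : ℝ) ≤ (1 - κ) * n →
      ∫⁻ ω, ENNReal.ofReal (weightRemainder (μ n) (ε n) (m n) (W n) (A n) i ω ^ 2) ∂P ≤ r

lemma AsympWeightedAverage.asympRandomWeightedAverage {h : ∀ n, Fin n → (Fin n → ℝ) → ℝ}
    {α : ∀ n, (Fin n → ℝ) → ℝ} (hα : AsympWeightedAverage P μ ε m h α)
    (hmodel : ∀ n, NoiseModel P (μ n) (ε n)) (hh : ∀ n i, Measurable (h n i)) :
    AsympRandomWeightedAverage P μ ε m (fun n i ω => h n i (obs (μ n) (ε n) ω))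
      fun n ω => α n (obs (μ n) (ε n) ω) where
  measurable n i := (hh n i).comp (hmodel n).measurable_obs
  measurable_weight n := (hα.measurable n).comp (hmodel n).measurable_obs
  weight_le_one n _ := (hα.lt_one n _).le
  remainder := hα.remainder

variable [IsProbabilityMeasure P]

lemma TightResiduals.eventually_sum_measure_le (hA3 : TightResiduals P μ ε m) :
    ∀ᶠ n : ℕ in atTop, ∑ i, P {ω | Real.log n < |resid (m n) (obs (μ n) (ε n) ω) i|}
      ≤ ENNReal.ofReal (n / Real.log n ^ 8) := by
  filter_upwards [hA3, eventually_gt_atTop 0] with n hn hn0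
  rw [one_div, inv_mul_le_iff₀ (Nat.cast_pos.2 hn0), mul_one_div] at hn
  refine le_of_eq_of_le ?_ (ENNReal.ofReal_le_ofReal hn)
  rw [ENNReal.ofReal_sum_of_nonneg fun i _ => measureReal_nonneg]
  exact Finset.sum_congr rfl fun i _ => (ofReal_measureReal).symm

lemma NoiseModel.risk_oracleIS_le_natCast {n : ℕ} {μ ε : Fin n → Ω → ℝ}
    {m : Fin n → (Fin n → ℝ) → ℝ} (hmodel : NoiseModel P μ ε) (hm : ∀ i, Measurable (m i))
    (hdep : ∀ i, DependsOn (m i) (Set.Iio i)) : risk P μ (oracleIS μ ε m) ≤ n := by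
  calc risk P μ (oracleIS μ ε m) ≤ _ := hmodel.risk_oracleIS_le hm hdep
    _ ≤ ∫⁻ ω, ∑ i, normalRisk id (centred μ ε m ω i) ∂P :=
        lintegral_mono fun _ => oracleDecision_isMin _ _ id measurable_id
    _ = n := by simp [normalRisk, lintegral_sq_stdNormal]

lemma eventually_risk_estimIS_le (hmodel : ∀ n, NoiseModel P (μ n) (ε n))
    (hm : ∀ n i, Measurable (m n i)) (hdep : ∀ n i, DependsOn (m n i) (Set.Iio i))
    (hA3 : TightResiduals P μ ε m) {r : ℝ} (hr : 0 < r) :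
    ∀ᶠ n : ℕ in atTop, risk P (μ n) (fun i ω => estimIS (m n) i (obs (μ n) (ε n) ω))
      ≤ risk P (μ n) (oracleIS (μ n) (ε n) (m n)) + ENNReal.ofReal (r * n) := by
  obtain ⟨K, hK⟩ := exists_risk_estimIS_le
  have hτ_lim : Tendsto (fun n : ℕ => K * (√√(Real.log n))⁻¹) atTop (𝓝 (K * 0)) :=
    (tendsto_inv_atTop_zero.comp (Real.tendsto_sqrt_atTop.comp
      (Real.tendsto_sqrt_atTop.comp tendsto_log_natCast))).const_mul K
  rw [mul_zero] at hτ_lim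
  filter_upwards [hA3.eventually_sum_measure_le, hτ_lim.eventually_le_const one_pos,
    hτ_lim.eventually_le_const (half_pos hr), eventually_const_mul_log_pow_le 18 22 (half_pos hr),
    tendsto_log_natCast.eventually_gt_atTop 0] with n htail hKτ_one hKτ_r hlog hlog_pos
  set τ := (√√(Real.log n))⁻¹ with hτ
  have hτ_pos : 0 < τ := by positivity
  have hτ4 : τ ^ 4 = (Real.log n)⁻¹ := by
    rw [hτ, inv_pow, show (4 : ℕ) = 2 * 2 from rfl, pow_mul, Real.sq_sqrt (Real.sqrt_nonneg _),
      Real.sq_sqrt hlog_pos.le]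
  have hτ32 : τ ^ 32 = (Real.log n ^ 8)⁻¹ := by
    rw [show (32 : ℕ) = 4 * 8 from rfl, pow_mul, hτ4, inv_pow]
  have hτ88 : (τ ^ 88)⁻¹ = Real.log n ^ 22 := by
    rw [show (88 : ℕ) = 4 * 22 from rfl, pow_mul, hτ4, inv_pow, inv_inv]
  refine (hK (hmodel n) (hm n) (hdep n) hτ_pos hKτ_one (by rw [hτ4, one_div])
    (by rwa [hτ32, ← div_eq_mul_inv])).trans (add_le_add le_rfl (ENNReal.ofReal_le_ofReal ?_))
  rw [hτ88]
  have hmain := mul_le_mul_of_nonneg_right hKτ_r (Nat.cast_nonneg (α := ℝ) n)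
  linarith

lemma exists_div_sq_le {a q : ℝ} (ha : 0 ≤ a) (hq : 0 < q) : ∃ T : ℝ, 0 < T ∧ a / T ^ 2 ≤ q := by
  refine ⟨√(a / q + 1), by positivity, ?_⟩
  rw [Real.sq_sqrt (by positivity), div_le_iff₀ (by positivity), mul_add, mul_div_cancel₀ _ hq.ne']
  linarith

-- The parameters for which the error terms of `NoiseModel.risk_oracleIS_add_le` are at most `r n`.
lemma exists_eventually_error_le {c r : ℝ} (hc : 0 ≤ c) (hr : 0 < r) :
    ∃ q κ T ζ : ℝ, 0 < q ∧ q ≤ r ∧ 0 < κ ∧ 0 < T ∧ 0 < ζ ∧ ∀ᶠ n : ℕ in atTop,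
      (1 + q⁻¹) * (n * ζ)
        + (q * n + 4 * Real.log n ^ 2 / q + (q * n + (stdNormalFourth + 1) / q)
            + (2 * (T ^ 2 + 1) + c) * (2 * (κ * n + 1) + 2 * (n / Real.log n ^ 2)))
        + n * (4 * stdNormalFourth / T ^ 2) ≤ r * n := by
  have hF := stdNormalFourth_nonneg
  obtain ⟨q, hq, hqr⟩ : ∃ q, 0 < q ∧ r = 8 * q := ⟨r / 8, by positivity, by ring⟩
  obtain ⟨T, hT, hTq⟩ := exists_div_sq_le (a := 4 * stdNormalFourth) (by positivity) hq
  set D := 2 * (T ^ 2 + 1) + c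
  have hD : 0 < D := by positivity
  refine ⟨q, q / (2 * D), T, q / (1 + q⁻¹), hq, by linarith, by positivity, hT, by positivity, ?_⟩
  have hinv : Tendsto (fun n : ℕ => 2 * D * (Real.log n ^ 2)⁻¹) atTop (𝓝 (2 * D * 0)) :=
    ((tendsto_pow_atTop two_ne_zero).comp tendsto_log_natCast).inv_tendsto_atTop.const_mul (2 * D)
  filter_upwards [eventually_const_mul_log_pow_le (4 / q) 2 hq,
    eventually_const_mul_log_pow_le ((stdNormalFourth + 1) / q + 2 * D) 0 hq,
    hinv.eventually_le_const (show 2 * D * 0 < q by rwa [mul_zero])] with n hlog_sq hconst hlog_inv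
  have hn : (0 : ℝ) ≤ n := Nat.cast_nonneg n
  have hζ : (1 + q⁻¹) * (n * (q / (1 + q⁻¹))) = q * n := by field_simp
  have hκ : D * (2 * (q / (2 * D) * n)) = q * n := by field_simp
  have htail := mul_le_mul_of_nonneg_right hlog_inv hn
  have htrunc := mul_le_mul_of_nonneg_left hTq hn
  rw [pow_zero, mul_one] at hconst
  rw [hζ, hqr, div_eq_mul_inv (n : ℝ), mul_div_right_comm 4, mul_add D, mul_add 2, mul_add D, hκ]
  linarith

lemma eventually_risk_oracleIS_add_le (hmodel : ∀ n, NoiseModel P (μ n) (ε n))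
    (hm : ∀ n i, Measurable (m n i)) (hdep : ∀ n i, DependsOn (m n i) (Set.Iio i))
    (hA3 : TightResiduals P μ ε m) (hW : AsympRandomWeightedAverage P μ ε m W A)
    {c : ℝ} (hc : 0 ≤ c) {g : ℕ → Ω → ℝ≥0∞}
    (hg : ∀ n κ L ω, ∃ δ, Measurable δ ∧
      ImprovesLinear (μ n) (ε n) (m n) (A n) κ L c δ (g n ω) ω) {r : ℝ} (hr : 0 < r) :
    ∀ᶠ n : ℕ in atTop, risk P (μ n) (oracleIS (μ n) (ε n) (m n)) + ∫⁻ ω, g n ω ∂P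
      ≤ ENNReal.ofReal (1 + r) * risk P (μ n) (W n) + ENNReal.ofReal (r * n) := by
  obtain ⟨q, κ, T, ζ, hq, hqr, hκ, hT, hζ, herror⟩ := exists_eventually_error_le hc hr
  filter_upwards [herror, hA3.eventually_sum_measure_le, eventually_gt_atTop 0,
    tendsto_log_natCast.eventually_ge_atTop 1,
    hW.remainder κ hκ (ENNReal.ofReal ζ) (ENNReal.ofReal_pos.2 hζ)]
    with n herror_n htail hn hlog hrem
  choose δ hδ himproves using hg n κ (Real.log n)
  have hF := stdNormalFourth_nonneg
  have hmid : ∀ i ∈ midTimes n κ, ∫⁻ ω, ENNReal.ofReal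
      (weightRemainder (μ n) (ε n) (m n) (W n) (A n) i ω ^ 2) ∂P ≤ ENNReal.ofReal ζ :=
    fun i hi => hrem i ((Finset.mem_filter_univ i).1 hi).1 ((Finset.mem_filter_univ i).1 hi).2
  have htail_sq : ∑ i, P {ω | Real.log n < |resid (m n) (obs (μ n) (ε n) ω) i|}
      ≤ ENNReal.ofReal (n / Real.log n ^ 2) := by
    refine htail.trans (ENNReal.ofReal_le_ofReal ?_)
    gcongr
    norm_num
  refine ((hmodel n).risk_oracleIS_add_le (hm n) (hdep n) (hW.measurable n)
    (hW.measurable_weight n) (hW.weight_le_one n) hn hq hT hc hκ.le (zero_lt_one.trans_le hlog)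
    htail_sq hmid hδ himproves).trans ?_
  rw [← ENNReal.ofReal_natCast, ← ENNReal.ofReal_mul (by positivity),
    ← ENNReal.ofReal_mul (by positivity), add_assoc, add_assoc, ← add_assoc (ENNReal.ofReal _),
    ← ENNReal.ofReal_add (by positivity) (by positivity),
    ← ENNReal.ofReal_add (by positivity) (by positivity)]
  exact add_le_add (mul_le_mul' (ENNReal.ofReal_le_ofReal (by linarith)) le_rfl)
    (ENNReal.ofReal_le_ofReal herror_n)

lemma eventually_risk_oracleIS_le (hmodel : ∀ n, NoiseModel P (μ n) (ε n))
    (hm : ∀ n i, Measurable (m n i)) (hdep : ∀ n i, DependsOn (m n i) (Set.Iio i))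
    (hA3 : TightResiduals P μ ε m) (hW : AsympRandomWeightedAverage P μ ε m W A)
    {r : ℝ} (hr : 0 < r) :
    ∀ᶠ n : ℕ in atTop, risk P (μ n) (oracleIS (μ n) (ε n) (m n))
      ≤ risk P (μ n) (W n) + ENNReal.ofReal (r * n) := by
  filter_upwards [eventually_risk_oracleIS_add_le hmodel hm hdep hA3 hW le_rfl (g := 0)
    (fun n κ L ω => ⟨_, by fun_prop, improvesLinear_zero (μ n) (ε n) (m n) (A n) κ L 0 ω⟩)
    (half_pos hr)] with n hn
  rcases le_total (n : ℝ≥0∞) (risk P (μ n) (W n)) with hlarge | hsmall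
  · exact ((hmodel n).risk_oracleIS_le_natCast (hm n) (hdep n)).trans
      (hlarge.trans le_self_add)
  · calc risk P (μ n) (oracleIS (μ n) (ε n) (m n))
        ≤ ENNReal.ofReal (1 + r / 2) * risk P (μ n) (W n) + ENNReal.ofReal (r / 2 * n) :=
          le_self_add.trans hn
      _ = risk P (μ n) (W n) + (ENNReal.ofReal (r / 2) * risk P (μ n) (W n)
            + ENNReal.ofReal (r / 2 * n)) := by
          rw [ENNReal.ofReal_add zero_le_one (half_pos hr).le, ENNReal.ofReal_one, add_mul, one_mul,
            add_assoc]
      _ ≤ risk P (μ n) (W n) + (ENNReal.ofReal (r / 2) * n + ENNReal.ofReal (r / 2 * n)) :=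
          add_le_add le_rfl (add_le_add (mul_le_mul' le_rfl hsmall) le_rfl)
      _ = _ := by
          rw [← ENNReal.ofReal_natCast, ← ENNReal.ofReal_mul (half_pos hr).le,
            ← ENNReal.ofReal_add (by positivity) (by positivity), ← add_mul, add_halves]

end Arrays

/-! ### The gain over the benchmark -/

lemma abs_min_one_sub_le {a : ℝ} (ha : 0 ≤ a) (p : ℝ) : |min (1 - p) 1 - (1 - a)| ≤ |p - a| := by
  have h := abs_min_sub_min_le_max (1 - p) 1 (1 - a) 1
  rw [min_eq_left (sub_le_self 1 ha), sub_self, abs_zero, max_eq_left (abs_nonneg _),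
    sub_sub_sub_cancel_left, abs_sub_comm a] at h
  exact h

lemma sum_normalRisk_sub_add_le {ι : Type*} [Fintype ι] [DecidableEq ι] {k : ℝ → ℝ} {g : ℝ →ᵇ ℝ}
    {β d Γ : ℝ} (hk : ∀ v, 0 ≤ (1 - β) ^ 2 * v ^ 2 + β ^ 2 - g v + d ∧
      normalRisk (fun z => β * z - k z) v
        ≤ ENNReal.ofReal ((1 - β) ^ 2 * v ^ 2 + β ^ 2 - g v + d))
    (hΓ : 0 ≤ Γ) (hd : d ≤ Γ / 4) (s : Finset ι) (ν : ι → ℝ)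
    (hsum : 3 / 4 * Γ * Fintype.card ι ≤ ∑ i, g (ν i)) :
    ∑ i ∈ s, normalRisk (fun z => β * z - k z) (ν i) + ENNReal.ofReal (Γ / 2 * Fintype.card ι)
      ≤ ∑ i ∈ s, normalRisk (fun z => β * z) (ν i) + ENNReal.ofReal ‖g‖ * sᶜ.card := by
  have hnonneg : 0 ≤ ∑ i ∈ s, ((1 - β) ^ 2 * ν i ^ 2 + β ^ 2 - g (ν i) + d) :=
    Finset.sum_nonneg fun i _ => (hk _).1
  have hcompl : ∑ i ∈ sᶜ, g (ν i) ≤ sᶜ.card * ‖g‖ :=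
    (Finset.sum_le_card_nsmul _ _ ‖g‖ fun i _ =>
      (le_abs_self _).trans (g.norm_coe_le_norm _)).trans_eq (nsmul_eq_mul _ _)
  have hsplit := Finset.sum_add_sum_compl s fun i => g (ν i)
  have hcost : s.card * d ≤ Fintype.card ι * (Γ / 4) :=
    (mul_le_mul_of_nonneg_left hd (Nat.cast_nonneg _)).trans
      (mul_le_mul_of_nonneg_right (Nat.cast_le.2 s.card_le_univ) (by positivity))
  simp only [normalRisk_linear]
  calc ∑ i ∈ s, normalRisk (fun z => β * z - k z) (ν i) + ENNReal.ofReal (Γ / 2 * Fintype.card ι)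
      ≤ ∑ i ∈ s, ENNReal.ofReal ((1 - β) ^ 2 * ν i ^ 2 + β ^ 2 - g (ν i) + d)
          + ENNReal.ofReal (Γ / 2 * Fintype.card ι) :=
        add_le_add (Finset.sum_le_sum fun i _ => (hk _).2) le_rfl
    _ = ENNReal.ofReal (∑ i ∈ s, ((1 - β) ^ 2 * ν i ^ 2 + β ^ 2 - g (ν i) + d)
          + Γ / 2 * Fintype.card ι) := by
        rw [← ENNReal.ofReal_sum_of_nonneg fun i _ => (hk _).1,
          ← ENNReal.ofReal_add hnonneg (by positivity)]
    _ ≤ ENNReal.ofReal (∑ i ∈ s, ((1 - β) ^ 2 * ν i ^ 2 + β ^ 2) + ‖g‖ * sᶜ.card) := by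
        refine ENNReal.ofReal_le_ofReal ?_
        rw [Finset.sum_add_distrib, Finset.sum_sub_distrib, Finset.sum_const, nsmul_eq_mul]
        linarith
    _ = _ := by
        rw [ENNReal.ofReal_add (Finset.sum_nonneg fun i _ => by positivity) (by positivity),
          ENNReal.ofReal_sum_of_nonneg fun i _ => by positivity,
          ENNReal.ofReal_mul (norm_nonneg g), ENNReal.ofReal_natCast]

lemma integral_empirical {n : ℕ} (v : Fin n → ℝ) (g : ℝ →ᵇ ℝ) :
    ∫ x, g x ∂empirical v = (n : ℝ)⁻¹ * ∑ i, g (v i) := by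
  rw [empirical, integral_smul_measure,
    integral_finsetSum_measure fun i _ => integrable_dirac (by simp)]
  simp [ENNReal.toReal_inv]

section Gain

variable {Ω : Type*}

/-- The event that the weight `A` is within `η` of `a` while `g` averages to at least `ℓ` over the
entries of `ν`. -/
def gainEvent {n : ℕ} (A : Ω → ℝ) (ν : Ω → Fin n → ℝ) (a η : ℝ) (g : ℝ → ℝ) (ℓ : ℝ) : Set Ω :=
  {ω | |A ω - a| ≤ η ∧ ℓ * n ≤ ∑ i, g (ν ω i)}

lemma exists_improvesLinear {n : ℕ} (μ ε : Fin n → Ω → ℝ) (m : Fin n → (Fin n → ℝ) → ℝ) (A : Ω → ℝ)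
    {k : ℝ → ℝ} (hkm : Measurable k) {g : ℝ →ᵇ ℝ} {C a η Γ : ℝ}
    (hk : ∀ β v, 0 ≤ (1 - β) ^ 2 * v ^ 2 + β ^ 2 - g v + C * |β - (1 - a)| ∧
      normalRisk (fun z => β * z - k z) v
        ≤ ENNReal.ofReal ((1 - β) ^ 2 * v ^ 2 + β ^ 2 - g v + C * |β - (1 - a)|))
    (hC : 0 ≤ C) (ha : 0 ≤ a) (hη : C * η ≤ Γ / 4) (hΓ : 0 ≤ Γ) (κ L : ℝ) (ω : Ω) :
    ∃ δ, Measurable δ ∧ ImprovesLinear μ ε m A κ L ‖g‖ δ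
      ((gainEvent A (centred μ ε m) a η g (3 / 4 * Γ)).indicator
        (fun _ => ENNReal.ofReal (Γ / 2 * n)) ω) ω := by
  by_cases hω : ω ∈ gainEvent A (centred μ ε m) a η g (3 / 4 * Γ)
  · refine ⟨fun z => min (1 - A ω) 1 * z - k z, by fun_prop, ?_⟩
    have hd : C * |min (1 - A ω) 1 - (1 - a)| ≤ Γ / 4 :=
      (mul_le_mul_of_nonneg_left ((abs_min_one_sub_le ha _).trans hω.1) hC).trans hη
    have h := sum_normalRisk_sub_add_le (hk _) hΓ hd (tameTimes m κ L (pairOf μ ε ω))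
      (centred μ ε m ω) (by rw [Fintype.card_fin]; exact hω.2)
    rw [Set.indicator_of_mem hω]
    rwa [Fintype.card_fin] at h
  · rw [Set.indicator_of_notMem hω]
    exact ⟨_, by fun_prop, improvesLinear_zero μ ε m A κ L _ ω⟩

variable [MeasurableSpace Ω] {P : Measure Ω}

lemma measurableSet_gainEvent {n : ℕ} {A : Ω → ℝ} (hA : Measurable A) {ν : Ω → Fin n → ℝ}
    (hν : ∀ i, Measurable fun ω => ν ω i) (a η : ℝ) {g : ℝ → ℝ} (hg : Measurable g) (ℓ : ℝ) :
    MeasurableSet (gainEvent A ν a η g ℓ) :=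
  (measurableSet_le (hA.sub_const a).abs measurable_const).inter
    (measurableSet_le measurable_const (Finset.measurable_fun_sum _ fun i _ => hg.comp (hν i)))

variable [IsProbabilityMeasure P]

lemma eventually_inv_two_le_measure_gainEvent {A : ℕ → Ω → ℝ} {ν : ∀ n, Ω → Fin n → ℝ}
    {a η : ℝ} (hA : TendstoInMeasure P A atTop fun _ => a) {G : Measure ℝ}
    (hG : EmpiricalTendsto P ν G) (hη : 0 < η) {g : ℝ →ᵇ ℝ} {ℓ : ℝ} (hℓ : ℓ < ∫ v, g v ∂G) :
    ∀ᶠ n in atTop, 2⁻¹ ≤ P (gainEvent (A n) (ν n) a η g ℓ) := by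
  have hquarter : (0 : ℝ≥0∞) < 4⁻¹ := by simp
  filter_upwards [(tendstoInMeasure_iff_dist.1 hA η hη).eventually_le_const hquarter,
    (tendstoInMeasure_iff_dist.1 (hG g) _ (sub_pos.2 hℓ)).eventually_le_const hquarter,
    eventually_gt_atTop 0] with n hA_n hG_n hn
  set E := gainEvent (A n) (ν n) a η g ℓ
  set EA := {ω | η ≤ dist (A n ω) a}
  set EG := {ω | ∫ v, g v ∂G - ℓ ≤ dist (∫ x, g x ∂empirical (ν n ω)) (∫ v, g v ∂G)}
  have hcover : Set.univ ⊆ E ∪ (EA ∪ EG) := by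
    intro ω _
    by_contra hω
    simp only [EA, EG, Set.mem_union, Set.mem_ofPred_eq, not_or, not_le, Real.dist_eq] at hω
    obtain ⟨hωE, hωA, hωG⟩ := hω
    refine hωE ⟨hωA.le, ?_⟩
    have hmean : ℓ ≤ (n : ℝ)⁻¹ * ∑ i, g (ν n ω i) := by
      rw [← integral_empirical]
      linarith [(abs_lt.1 hωG).1]
    rw [le_inv_mul_iff₀ (Nat.cast_pos.2 hn), mul_comm] at hmean
    exact hmean
  have hone : 1 ≤ P E + 2⁻¹ := by
    calc 1 = P Set.univ := measure_univ.symm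
      _ ≤ P E + (P EA + P EG) := (measure_mono hcover).trans
          ((measure_union_le _ _).trans (add_le_add le_rfl (measure_union_le _ _)))
      _ ≤ P E + (4⁻¹ + 4⁻¹) := add_le_add le_rfl (add_le_add hA_n hG_n)
      _ = P E + 2⁻¹ := by
          rw [← two_mul, show (4 : ℝ≥0∞) = 2 * 2 by norm_num,
            ENNReal.mul_inv (by simp) (by simp), ← mul_assoc,
            ENNReal.mul_inv_cancel (by simp) (by simp), one_mul]
  rw [← ENNReal.inv_two_add_inv_two] at hone
  exact (ENNReal.add_le_add_iff_right (by simp)).1 hone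

variable {μ ε W : ∀ n : ℕ, Fin n → Ω → ℝ} {m : ∀ n : ℕ, Fin n → (Fin n → ℝ) → ℝ}
  {A : ℕ → Ω → ℝ}

lemma exists_risk_oracleIS_add_le (hmodel : ∀ n, NoiseModel P (μ n) (ε n))
    (hm : ∀ n i, Measurable (m n i)) (hdep : ∀ n i, DependsOn (m n i) (Set.Iio i))
    (hA3 : TightResiduals P μ ε m) (hW : AsympRandomWeightedAverage P μ ε m W A)
    {a : ℝ} (ha : 0 < a) (ha1 : a ≤ 1) (hA : TendstoInMeasure P A atTop fun _ => a)
    {G : Measure ℝ} [IsProbabilityMeasure G]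
    (hG : EmpiricalTendsto P (fun n => centred (μ n) (ε n) (m n)) G)
    (hGne : G ≠ gaussianReal 0 (Real.toNNReal ((1 - a) / a))) :
    ∃ q : ℝ, 0 < q ∧ ∀ r : ℝ, 0 < r → ∀ᶠ n : ℕ in atTop,
      risk P (μ n) (oracleIS (μ n) (ε n) (m n)) + ENNReal.ofReal (q * n)
        ≤ ENNReal.ofReal (1 + r) * risk P (μ n) (W n) + ENNReal.ofReal (r * n) := by
  obtain ⟨k, g, C, hkm, hC, hΓ, hk⟩ :=
    exists_linear_improvement G (exists_linearResidual_ne_zero G ha ha1 hGne)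
  set Γ := ∫ v, g v ∂G
  obtain ⟨η, hη, hCη⟩ : ∃ η, 0 < η ∧ C * η ≤ Γ / 4 := by
    refine ⟨Γ / 4 / (C + 1), by positivity, ?_⟩
    rw [← mul_div_assoc, div_le_iff₀ (by positivity)]
    nlinarith
  refine ⟨Γ / 4, by positivity, fun r hr => ?_⟩
  filter_upwards [eventually_inv_two_le_measure_gainEvent hA hG hη
      (show 3 / 4 * Γ < ∫ v, g v ∂G by linarith),
    eventually_risk_oracleIS_add_le hmodel hm hdep hA3 hW (norm_nonneg g)
      (fun n κ L ω => exists_improvesLinear (μ n) (ε n) (m n) (A n) hkm hk hC ha.le hCη hΓ.le κ L ω)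
      hr] with n hprob hgain
  refine (add_le_add le_rfl ?_).trans hgain
  have hcentred : ∀ i, Measurable fun ω => centred (μ n) (ε n) (m n) ω i := fun i =>
    (measurable_pairCentred_apply (hm n) i).comp (hmodel n).measurable_pairOf
  rw [lintegral_indicator_const (measurableSet_gainEvent (hW.measurable_weight n) hcentred a η
    g.continuous.measurable _)]
  calc ENNReal.ofReal (Γ / 4 * n) = ENNReal.ofReal (Γ / 2 * n) * 2⁻¹ := by
        rw [← ENNReal.ofReal_ofNat, ← ENNReal.ofReal_inv_of_pos two_pos,
          ← ENNReal.ofReal_mul (by positivity)]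
        congr 1
        ring
    _ ≤ _ := mul_le_mul' le_rfl hprob

end Gain

end SeqEB

open SeqEB in
theorem theorem2_general {Ω : Type*} [MeasurableSpace Ω] (P : Measure Ω) [IsProbabilityMeasure P]
    (μ ε : ∀ n : ℕ, Fin n → Ω → ℝ) (μt : ∀ n : ℕ, Fin n → (Fin n → ℝ) → ℝ)
    (hmodel : ∀ n, NoiseModel P (μ n) (ε n)) (hm : ∀ n i, Measurable (μt n i))
    (hdep : ∀ n i, DependsOn (μt n i) (Set.Iio i)) (hA3 : TightResiduals P μ ε μt) :
    LeUpToLittleO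
        (fun n => risk P (μ n) (fun i ω => estimIS (μt n) i (obs (μ n) (ε n) ω)))
        (fun n => risk P (μ n) (oracleIS (μ n) (ε n) (μt n))) ∧
    ∀ (W : ∀ n : ℕ, Fin n → Ω → ℝ) (A : ℕ → Ω → ℝ), AsympRandomWeightedAverage P μ ε μt W A →
      LeUpToLittleO
        (fun n => risk P (μ n) (oracleIS (μ n) (ε n) (μt n)))
        (fun n => risk P (μ n) (W n)) ∧
      ∀ a : ℝ, 0 < a → a ≤ 1 → TendstoInMeasure P A atTop (fun _ => a) →
        ∀ G : Measure ℝ, IsProbabilityMeasure G →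
          EmpiricalTendsto P (fun n => centred (μ n) (ε n) (μt n)) G →
          G ≠ gaussianReal 0 (Real.toNNReal ((1 - a) / a)) →
          ∃ c : ℝ, 0 < c ∧ c < 1 ∧ ∀ᶠ n : ℕ in atTop,
            risk P (μ n) (fun i ω => estimIS (μt n) i (obs (μ n) (ε n) ω))
              ≤ ENNReal.ofReal c * risk P (μ n) (W n) := by
  have hestim := fun r (hr : 0 < r) => eventually_risk_estimIS_le hmodel hm hdep hA3 hr
  refine ⟨leUpToLittleO_of_forall_eventually_le hestim, fun W A hW =>
    ⟨leUpToLittleO_of_forall_eventually_le fun r hr =>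
      eventually_risk_oracleIS_le hmodel hm hdep hA3 hW hr, ?_⟩⟩
  intro a ha ha1 hA G _ hG hGne
  obtain ⟨q, hq, hgain⟩ := exists_risk_oracleIS_add_le hmodel hm hdep hA3 hW ha ha1 hA hG hGne
  exact exists_eventually_le_mul hq hestim
    (fun n => (hmodel n).risk_oracleIS_le_natCast (hm n) (hdep n)) hgain

open SeqEB in
theorem theorem2 {Ω : Type*} [MeasurableSpace Ω] (P : Measure Ω) [IsProbabilityMeasure P]
    (μ ε : ∀ n : ℕ, Fin n → Ω → ℝ)
    (μt μh : ∀ n : ℕ, Fin n → (Fin n → ℝ) → ℝ) (ρ : ℕ → ℝ)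
    (hmodel : ∀ n, NoiseModel P (μ n) (ε n))
    (hfilter : SequentialFilter μh)
    (hA1 : LipschitzPredictor μt ρ)
    (hA3 : TightResiduals P μ ε μt) :
    (LeUpToLittleO
        (fun n => risk P (μ n) (fun i ω => estimIS (μt n) i (obs (μ n) (ε n) ω)))
        (fun n => risk P (μ n) (oracleIS (μ n) (ε n) (μt n)))) ∧
    (∀ α : ∀ n : ℕ, (Fin n → ℝ) → ℝ, AsympWeightedAverage P μ ε μt μh α →
      (LeUpToLittleO
        (fun n => risk P (μ n) (oracleIS (μ n) (ε n) (μt n)))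
        (fun n => risk P (μ n) (fun i ω => μh n i (obs (μ n) (ε n) ω)))) ∧
      (∀ a : ℝ, 0 < a → a < 1 →
        TendstoInMeasure P (fun n ω => α n (obs (μ n) (ε n) ω)) atTop (fun _ => a) →
        ∀ G : Measure ℝ, IsProbabilityMeasure G →
          EmpiricalTendsto P (fun n => centred (μ n) (ε n) (μt n)) G →
          G ≠ gaussianReal 0 (Real.toNNReal ((1 - a) / a)) →
          ∃ c : ℝ, 0 < c ∧ c < 1 ∧ ∀ᶠ n : ℕ in atTop,
            risk P (μ n) (fun i ω => estimIS (μt n) i (obs (μ n) (ε n) ω))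
              ≤ ENNReal.ofReal c
                * risk P (μ n) (fun i ω => μh n i (obs (μ n) (ε n) ω)))) :=
  (theorem2_general P μ ε μt hmodel hA1.measurable hA1.dependsOn hA3).imp_right fun h _ hα =>
    (h _ _ (hα.asympRandomWeightedAverage hmodel hfilter.measurable)).imp_right
      fun hgain a ha ha1 => hgain a ha ha1.le
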